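/- Let $C$ be a nodal curve over $\mathbb{C}$, i.e. a compact Hausdorff reduced complex space (not necessarily connected) which near each of its points is biholomorphic either to an open subset of $\mathbb{C}$ (smooth point) or to a neighbourhood of the origin in $\{(z,w)\in\mathbb{C}^2 : zw=0\}$ (node). Let $L$ be a holomorphic line bundle on $C$, and write $h^0$ for the dimension of the space of global sections of a sheaf. Let $C_{\mathrm{mid}}$ be an irreducible component of $C$ that is biholomorphic to $\mathbb{P}^1$, and let $C_1,C_2$ be irreducible components of $C$ different from $C_{\mathrm{mid}}$, possibly $C_1=C_2$. Suppose that $p_1\neq p_2$ are nodes of $C$ with $p_1\in C_{\mathrm{mid}}\cap C_1$ and $p_2\in C_{\mathrm{mid}}\cap C_2$, and that $C_{\mathrm{mid}}$ meets the closure of $C\setminus C_{\mathrm{mid}}$ exactly in $\{p_1,p_2\}$. Let $d=\deg(L|_{C_{\mathrm{mid}}})$. Let $Z=\overline{C\setminus C_{\mathrm{mid}}}$ be the union of the other components, with its reduced structure. Then $Z$ is a nodal curve, $L|_Z$ is a line bundle on it, and: 1. If $d>0$, then $h^0(C,L)=h^0(Z,L|_Z)+d-1$. 2. If $d<0$, let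 $L'=L|_Z\otimes\mathcal{O}_Z(-p_1-p_2)$ be the sheaf of sections of $L|_Z$ that vanish at $p_1$ and $p_2$. Then $L'$ is locally free of rank one, and $h^0(C,L)=h^0(Z,L')$. 3. If $d=0$, let $\pi:C\to C'$ be the contraction of $C_{\mathrm{mid}}$: $C'$ is the topological quotient of $C$ in which $C_{\mathrm{mid}}$ is collapsed to one point $q$, with structure sheaf $\mathcal{O}_{C'}=\pi_*\mathcal{O}_C$. Then $C'$ is a nodal curve, $q$ is a node of $C'$, the sheaf $\pi_*L$ is locally free of rank one on $C'$, and $h^0(C,L)=h^0(C',\pi_*L)$. -/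

import Mathlib

open Filter Topology

universe u v

noncomputable section

/-! ### Spaces with a sheaf of holomorphic functions -/

/-- A topological space with a sheaf of `ℂ`-algebras of complex valued functions (the structure
sheaf of a reduced complex space).  The sheaf is recorded through its germs: `HolAt f x` says that
the function `f` is holomorphic in a neighbourhood of `x`; a function is a section of the structure
sheaf over an open set `U` if it is `HolAt` every point of `U`. -/
class HolSpace (X : Type u) [TopologicalSpace X] where
  HolAt : (X → ℂ) → X → Prop
  congr : ∀ {f g : X → ℂ} {x : X}, HolAt f x → f =ᶠ[𝓝 x] g → HolAt g x
  eventually : ∀ {f : X → ℂ} {x : X}, HolAt f x → ∀ᶠ y in 𝓝 x, HolAt f y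
  const : ∀ (c : ℂ) (x : X), HolAt (fun _ => c) x
  add : ∀ {f g : X → ℂ} {x : X}, HolAt f x → HolAt g x → HolAt (fun y => f y + g y) x
  mul : ∀ {f g : X → ℂ} {x : X}, HolAt f x → HolAt g x → HolAt (fun y => f y * g y) x

open HolSpace (HolAt)

/-- The complex plane with its usual holomorphic functions. -/
instance instHolSpaceComplex : HolSpace ℂ where
  HolAt f x := AnalyticAt ℂ f x
  congr h e := h.congr e
  eventually h := h.eventually_analyticAt
  const _ _ := analyticAt_const
  add h h' := h.add h'
  mul h h' := h.mul h'

/-- The plane `ℂ²` with its usual holomorphic functions. -/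
instance instHolSpaceComplexProd : HolSpace (ℂ × ℂ) where
  HolAt f x := AnalyticAt ℂ f x
  congr h e := h.congr e
  eventually h := h.eventually_analyticAt
  const _ _ := analyticAt_const
  add h h' := h.add h'
  mul h h' := h.mul h'

/-- The reduced structure on a subset (open or closed in all uses): holomorphic functions are
locally the restrictions of holomorphic functions of the ambient space. -/
instance instHolSpaceSubset {X : Type u} [TopologicalSpace X] [HolSpace X] (S : Set X) :
    HolSpace S where
  HolAt f x := ∃ F : X → ℂ, HolAt F x.1 ∧ ∀ᶠ y in 𝓝 x, f y = F y.1
  congr := by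
    rintro f g x ⟨F, hF, h⟩ e
    refine ⟨F, hF, ?_⟩
    filter_upwards [h, e] with y h1 h2
    rw [← h2, h1]
  eventually := by
    rintro f x ⟨F, hF, h⟩
    have h1 : ∀ᶠ y : S in 𝓝 x, HolAt F y.1 :=
      continuous_subtype_val.continuousAt.eventually (HolSpace.eventually hF)
    filter_upwards [h1, eventually_eventually_nhds.2 h] with y h2 h3
    exact ⟨F, h2, h3⟩
  const c x := ⟨fun _ => c, HolSpace.const c _, Eventually.of_forall fun _ => rfl⟩
  add := by
    rintro f g x ⟨F, hF, h⟩ ⟨G, hG, h'⟩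
    refine ⟨_, HolSpace.add hF hG, ?_⟩
    filter_upwards [h, h'] with y h1 h2
    rw [h1, h2]
  mul := by
    rintro f g x ⟨F, hF, h⟩ ⟨G, hG, h'⟩
    refine ⟨_, HolSpace.mul hF hG, ?_⟩
    filter_upwards [h, h'] with y h1 h2
    rw [h1, h2]

/-! ### The projective line -/

/-- The coordinate of the Riemann sphere `ℂ ∪ {∞}` around `∞`: `w ↦ 1 / w`, with `0 ↦ ∞`. -/
def sphereAtInfty (w : ℂ) : OnePoint ℂ :=
  if w = 0 then OnePoint.infty else ((w⁻¹ : ℂ) : OnePoint ℂ)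

/-- Holomorphic germs on the Riemann sphere `ℂ ∪ {∞}`. -/
def SphereHolAt (f : OnePoint ℂ → ℂ) : OnePoint ℂ → Prop
  | OnePoint.some z => AnalyticAt ℂ (fun w : ℂ => f (w : OnePoint ℂ)) z
  | OnePoint.infty => AnalyticAt ℂ (fun w : ℂ => f (sphereAtInfty w)) 0

theorem tendsto_sphereAtInfty : Tendsto sphereAtInfty (𝓝 0) (𝓝 OnePoint.infty) := by
  have h : Tendsto sphereAtInfty (𝓝[≠] (0 : ℂ)) (𝓝 OnePoint.infty) := by
    have h1 : Tendsto (fun w : ℂ => ((w⁻¹ : ℂ) : OnePoint ℂ)) (𝓝[≠] (0 : ℂ))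
        (𝓝 OnePoint.infty) := by
      have h2 : Tendsto (fun w : ℂ => w⁻¹) (𝓝[≠] (0 : ℂ)) (coclosedCompact ℂ) := by
        rw [coclosedCompact_eq_cocompact, ← Metric.cobounded_eq_cocompact]
        exact tendsto_inv₀_nhdsNE_zero
      rw [OnePoint.nhds_infty_eq]
      exact (tendsto_map.comp h2).mono_right le_sup_left
    refine h1.congr' ?_
    filter_upwards [self_mem_nhdsWithin] with w hw
    have hw' : w ≠ 0 := hw
    simp [sphereAtInfty, hw']
  rw [← nhdsNE_sup_pure]
  refine h.sup ?_
  have : sphereAtInfty 0 = OnePoint.infty := by simp [sphereAtInfty]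
  rw [← this]
  exact (tendsto_pure_pure _ _).mono_right (pure_le_nhds _)

/-- The complex projective line, as the Riemann sphere. -/
instance instHolSpaceSphere : HolSpace (OnePoint ℂ) where
  HolAt := SphereHolAt
  congr := by
    intro f g x h e
    induction x using OnePoint.rec with
    | infty =>
      have h' : AnalyticAt ℂ (fun w : ℂ => f (sphereAtInfty w)) 0 := h
      exact h'.congr (tendsto_sphereAtInfty.eventually e)
    | coe z =>
      have h' : AnalyticAt ℂ (fun w : ℂ => f (w : OnePoint ℂ)) z := h
      exact h'.congr (OnePoint.continuous_coe.continuousAt.eventually e)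
  eventually := by
    intro f x h
    induction x using OnePoint.rec with
    | infty =>
      have h' : AnalyticAt ℂ (fun w : ℂ => f (sphereAtInfty w)) 0 := h
      rw [OnePoint.nhds_infty_eq, eventually_sup, eventually_map, eventually_pure]
      refine ⟨?_, h⟩
      rw [coclosedCompact_eq_cocompact, ← Metric.cobounded_eq_cocompact]
      have h1 := tendsto_inv₀_cobounded.eventually h'.eventually_analyticAt
      filter_upwards [h1, Bornology.eventually_ne_cobounded (0 : ℂ)] with z hz hz0
      have h2 : AnalyticAt ℂ (fun w : ℂ => f (sphereAtInfty w⁻¹)) z :=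
        AnalyticAt.fun_comp (f := fun w : ℂ => w⁻¹) hz (analyticAt_inv hz0)
      refine h2.congr ?_
      filter_upwards [isOpen_ne.mem_nhds hz0] with w hw
      have hw' : w ≠ 0 := hw
      simp [sphereAtInfty, hw']
    | coe z =>
      have h' : AnalyticAt ℂ (fun w : ℂ => f (w : OnePoint ℂ)) z := h
      rw [OnePoint.nhds_coe_eq, eventually_map]
      exact h'.eventually_analyticAt
  const := by
    intro c x
    induction x using OnePoint.rec with
    | infty => exact (analyticAt_const : AnalyticAt ℂ (fun _ : ℂ => c) 0)
    | coe z => exact (analyticAt_const : AnalyticAt ℂ (fun _ : ℂ => c) z)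
  add := by
    intro f g x h h'
    induction x using OnePoint.rec with
    | infty =>
      have h1 : AnalyticAt ℂ (fun w : ℂ => f (sphereAtInfty w)) 0 := h
      have h2 : AnalyticAt ℂ (fun w : ℂ => g (sphereAtInfty w)) 0 := h'
      exact h1.add h2
    | coe z =>
      have h1 : AnalyticAt ℂ (fun w : ℂ => f (w : OnePoint ℂ)) z := h
      have h2 : AnalyticAt ℂ (fun w : ℂ => g (w : OnePoint ℂ)) z := h'
      exact h1.add h2
  mul := by
    intro f g x h h'
    induction x using OnePoint.rec with
    | infty =>
      have h1 : AnalyticAt ℂ (fun w : ℂ => f (sphereAtInfty w)) 0 := h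
      have h2 : AnalyticAt ℂ (fun w : ℂ => g (sphereAtInfty w)) 0 := h'
      exact h1.mul h2
    | coe z =>
      have h1 : AnalyticAt ℂ (fun w : ℂ => f (w : OnePoint ℂ)) z := h
      have h2 : AnalyticAt ℂ (fun w : ℂ => g (w : OnePoint ℂ)) z := h'
      exact h1.mul h2

/-! ### Holomorphic maps and nodal curves -/

/-- Holomorphic maps: continuous maps that pull holomorphic functions back to holomorphic
functions. -/
def IsHolMap {X : Type u} {Y : Type v} [TopologicalSpace X] [HolSpace X] [TopologicalSpace Y]
    [HolSpace Y] (π : X → Y) : Prop :=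
  Continuous π ∧ ∀ (x : X) (f : Y → ℂ), HolAt f (π x) → HolAt (f ∘ π) x

/-- Two spaces are biholomorphic if some homeomorphism identifies their structure sheaves. -/
def Biholomorphic (X : Type u) (Y : Type v) [TopologicalSpace X] [HolSpace X]
    [TopologicalSpace Y] [HolSpace Y] : Prop :=
  ∃ e : X ≃ₜ Y, ∀ (x : X) (f : Y → ℂ), HolAt (f ∘ e) x ↔ HolAt f (e x)

/-- `φ` is a biholomorphic map from the open set `φ.source` of `X` onto the open set `φ.target`
of `Y`. -/
def IsBiholChart {X : Type u} {Y : Type v} [TopologicalSpace X] [HolSpace X]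
    [TopologicalSpace Y] [HolSpace Y] (φ : OpenPartialHomeomorph X Y) : Prop :=
  ∀ x ∈ φ.source, ∀ f : Y → ℂ, HolAt (f ∘ φ) x ↔ HolAt f (φ x)

/-- The local model of a node: the union `{(z, w) | z w = 0}` of the two axes in `ℂ²`. -/
def nodeModel : Set (ℂ × ℂ) := {z | z.1 * z.2 = 0}

/-- The node of the local model. -/
def nodeOrigin : nodeModel := ⟨(0, 0), by simp [nodeModel]⟩

/-- `x` is a smooth point of the curve `X`: near `x`, the space `X` is biholomorphic to an open
subset of `ℂ`. -/
def IsSmoothPoint {X : Type u} [TopologicalSpace X] [HolSpace X] (x : X) : Prop :=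
  ∃ φ : OpenPartialHomeomorph X ℂ, x ∈ φ.source ∧ IsBiholChart φ

/-- `x` is a node of the curve `X`: near `x`, the space `X` is biholomorphic to a neighbourhood of
the origin in `{(z, w) | z w = 0}`. -/
def IsNode {X : Type u} [TopologicalSpace X] [HolSpace X] (x : X) : Prop :=
  ∃ φ : OpenPartialHomeomorph X nodeModel, x ∈ φ.source ∧ φ x = nodeOrigin ∧ IsBiholChart φ

/-- A (possibly disconnected) nodal curve over `ℂ`: a compact Hausdorff reduced complex space all
of whose points are smooth points of dimension one or nodes. -/
structure IsNodalCurve (X : Type u) [TopologicalSpace X] [HolSpace X] : Prop where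
  compact : CompactSpace X
  t2 : T2Space X
  smooth_or_node : ∀ x : X, IsSmoothPoint x ∨ IsNode x

/-- The irreducible components of a nodal curve: the closures of the connected components of its
smooth locus. -/
def IsIrredComponent {X : Type u} [TopologicalSpace X] [HolSpace X] (K : Set X) : Prop :=
  ∃ x : X, IsSmoothPoint x ∧ K = closure (connectedComponentIn {y | IsSmoothPoint y} x)

/-- `K` is a smooth rational component which is attached to the component `K₁` at the node `p₁` and
to the component `K₂` at the node `p₂`, and which does not meet the rest of the curve elsewhere.
The components `K₁` and `K₂` may coincide. -/
structure IsInteriorEdge {X : Type u} [TopologicalSpace X] [HolSpace X] (K K₁ K₂ : Set X)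
    (p₁ p₂ : X) : Prop where
  component : IsIrredComponent K
  rational : Biholomorphic K (OnePoint ℂ)
  component₁ : IsIrredComponent K₁
  component₂ : IsIrredComponent K₂
  ne₁ : K₁ ≠ K
  ne₂ : K₂ ≠ K
  node₁ : IsNode p₁
  node₂ : IsNode p₂
  mem₁ : p₁ ∈ K ∩ K₁
  mem₂ : p₂ ∈ K ∩ K₂
  nodes_ne : p₁ ≠ p₂
  inter_rest : K ∩ closure Kᶜ = {p₁, p₂}

/-! ### Sheaves of modules and line bundles -/

/-- A sheaf of modules over the structure sheaf of `X`, whose sections are families of elements of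
given complex vector spaces `fiber x`.  As for functions, the sheaf is recorded through its germs:
`HolAt s x` says that `s` is a section of the sheaf in a neighbourhood of `x`. -/
structure ModuleSheaf (X : Type u) [TopologicalSpace X] [HolSpace X] where
  fiber : X → Type v
  [addCommGroup : ∀ x, AddCommGroup (fiber x)]
  [module : ∀ x, Module ℂ (fiber x)]
  HolAt : (∀ x, fiber x) → X → Prop
  congr : ∀ {s t : ∀ x, fiber x} {x : X}, HolAt s x → (∀ᶠ y in 𝓝 x, s y = t y) → HolAt t x
  eventually : ∀ {s : ∀ x, fiber x} {x : X}, HolAt s x → ∀ᶠ y in 𝓝 x, HolAt s y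
  zero : ∀ x : X, HolAt (fun _ => 0) x
  add : ∀ {s t : ∀ x, fiber x} {x : X}, HolAt s x → HolAt t x → HolAt (fun y => s y + t y) x
  smul : ∀ {f : X → ℂ} {s : ∀ x, fiber x} {x : X}, HolSpace.HolAt f x → HolAt s x →
    HolAt (fun y => f y • s y) x

attribute [instance] ModuleSheaf.addCommGroup ModuleSheaf.module

namespace ModuleSheaf

variable {X : Type u} [TopologicalSpace X] [HolSpace X]

/-- The complex vector space of global sections. -/
def globalSections (M : ModuleSheaf.{u, v} X) : Submodule ℂ (∀ x, M.fiber x) where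
  carrier := {s | ∀ x, M.HolAt s x}
  add_mem' h h' x := M.add (h x) (h' x)
  zero_mem' x := M.zero x
  smul_mem' c _ h x := M.smul (HolSpace.const c x) (h x)

/-- The number `h⁰` of independent global sections: the dimension of the space of global sections,
as a cardinal number, so that no finiteness has to be presupposed. -/
def h0 (M : ModuleSheaf.{u, v} X) : Cardinal.{max u v} :=
  Module.rank ℂ M.globalSections

/-- `e` is a local frame of the line bundle `M` around `x`: it vanishes nowhere near `x`, and the
sections of `M` near `x` are the multiples of `e` with holomorphic functions. -/
def IsFrameAt (M : ModuleSheaf.{u, v} X) (e : ∀ x, M.fiber x) (x : X) : Prop :=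
  ∀ᶠ y in 𝓝 x, e y ≠ 0 ∧ ∀ s : ∀ x, M.fiber x, M.HolAt s y ↔
    ∃ f : X → ℂ, HolSpace.HolAt f y ∧ ∀ᶠ z in 𝓝 y, s z = f z • e z

/-- `M` is the sheaf of sections of a holomorphic line bundle, given as a family of complex lines
`M.fiber x` with local frames. -/
def IsLineBundle (M : ModuleSheaf.{u, v} X) : Prop :=
  (∀ x, Module.finrank ℂ (M.fiber x) = 1) ∧ ∀ x, ∃ e : ∀ x, M.fiber x, M.IsFrameAt e x

/-- `M` is locally free of rank one: near every point there is a section `e` such that `f ↦ f e`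
is an isomorphism from the structure sheaf to `M` (on germs at all points near `x`). -/
def IsLocallyFreeRankOne (M : ModuleSheaf.{u, v} X) : Prop :=
  ∀ x, ∃ e : ∀ x, M.fiber x, ∀ᶠ y in 𝓝 x,
    (∀ s : ∀ x, M.fiber x, M.HolAt s y ↔
      ∃ f : X → ℂ, HolSpace.HolAt f y ∧ ∀ᶠ z in 𝓝 y, s z = f z • e z) ∧
    ∀ f : X → ℂ, HolSpace.HolAt f y → (∀ᶠ z in 𝓝 y, f z • e z = 0) → ∀ᶠ z in 𝓝 y, f z = 0

/-- The restriction of a line bundle to a subspace with its reduced structure: the fibres are those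
of `M`, and the sections are locally the restrictions of sections of `M`. -/
def restrict (M : ModuleSheaf.{u, v} X) (S : Set X) : ModuleSheaf.{u, v} S where
  fiber x := M.fiber x.1
  HolAt s x := ∃ t : ∀ x, M.fiber x, M.HolAt t x.1 ∧ ∀ᶠ y in 𝓝 x, s y = t y.1
  congr := by
    rintro s s' x ⟨t, ht, h⟩ e
    refine ⟨t, ht, ?_⟩
    filter_upwards [h, e] with y h1 h2
    rw [← h2, h1]
  eventually := by
    rintro s x ⟨t, ht, h⟩
    have h1 : ∀ᶠ y : S in 𝓝 x, M.HolAt t y.1 :=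
      continuous_subtype_val.continuousAt.eventually (M.eventually ht)
    filter_upwards [h1, eventually_eventually_nhds.2 h] with y h2 h3
    exact ⟨t, h2, h3⟩
  zero x := ⟨fun _ => 0, M.zero _, Eventually.of_forall fun _ => rfl⟩
  add := by
    rintro s s' x ⟨t, ht, h⟩ ⟨t', ht', h'⟩
    refine ⟨_, M.add ht ht', ?_⟩
    filter_upwards [h, h'] with y h1 h2
    rw [h1, h2]
  smul := by
    rintro f s x ⟨F, hF, h⟩ ⟨t, ht, h'⟩
    refine ⟨_, M.smul hF ht, ?_⟩
    filter_upwards [h, h'] with y h1 h2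
    rw [h1, h2]

/-- The subsheaf of the sections that vanish on `S`.  For a line bundle `M` on a curve and a
finite set `S` of smooth points this is the twist `M ⊗ 𝒪(-S)` of `M`. -/
def twistNeg (M : ModuleSheaf.{u, v} X) (S : Set X) : ModuleSheaf.{u, v} X where
  fiber := M.fiber
  HolAt s x := M.HolAt s x ∧ ∀ᶠ y in 𝓝 x, y ∈ S → s y = 0
  congr := by
    rintro s t x ⟨h, h'⟩ e
    refine ⟨M.congr h e, ?_⟩
    filter_upwards [h', e] with y h1 h2 hy
    rw [← h2, h1 hy]
  eventually := by
    rintro s x ⟨h, h'⟩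
    exact (M.eventually h).and (eventually_eventually_nhds.2 h')
  zero x := ⟨M.zero x, Eventually.of_forall fun _ _ => rfl⟩
  add := by
    rintro s t x ⟨h, h'⟩ ⟨k, k'⟩
    refine ⟨M.add h k, ?_⟩
    filter_upwards [h', k'] with y h1 h2 hy
    rw [h1 hy, h2 hy, add_zero]
  smul := by
    rintro f s x hf ⟨h, h'⟩
    refine ⟨M.smul hf h, ?_⟩
    filter_upwards [h'] with y h1 hy
    rw [h1 hy, smul_zero]

/-- The direct image `π_* M` along a holomorphic map `π : X → Y`: its sections over an open set
`V` of `Y` are the sections of `M` over `π⁻¹ V`.  (A section over `V` assigns to `y` the values of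
a section of `M` at the points of `π⁻¹ {y}`.) -/
def directImage {Y : Type u} [TopologicalSpace Y] [HolSpace Y] (M : ModuleSheaf.{u, v} X)
    (π : X → Y) (hπ : IsHolMap π) : ModuleSheaf.{u, max u v} Y where
  fiber y := ∀ x : {x : X // π x = y}, M.fiber x.1
  HolAt s y := ∀ᶠ y' in 𝓝 y, ∀ x, π x = y' → M.HolAt (fun z => s (π z) ⟨z, rfl⟩) x
  congr := by
    intro s t y h e
    filter_upwards [h, eventually_eventually_nhds.2 e] with y' h1 h2 x hx
    subst hx
    refine M.congr (h1 x rfl) ?_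
    filter_upwards [hπ.1.continuousAt.eventually h2] with z hz
    rw [hz]
  eventually h := eventually_eventually_nhds.2 h
  zero y := Eventually.of_forall fun _ x _ => M.zero x
  add := by
    intro s t y h h'
    filter_upwards [h, h'] with y' h1 h2 x hx
    exact M.add (h1 x hx) (h2 x hx)
  smul := by
    intro f s y hf h
    filter_upwards [h, HolSpace.eventually hf] with y' h1 h2 x hx
    subst hx
    exact M.smul (hπ.2 x f h2) (h1 x rfl)

/-- The meromorphic section `s` of the line bundle `M` has order `n` at the smooth point `x`:
`s = tⁿ e` near `x`, for a local coordinate `t` centred at `x` and a local frame `e`. -/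
def HasOrderAt (M : ModuleSheaf.{u, v} X) (s : ∀ x, M.fiber x) (x : X) (n : ℤ) : Prop :=
  ∃ t : OpenPartialHomeomorph X ℂ, x ∈ t.source ∧ t x = 0 ∧ IsBiholChart t ∧
    ∃ e : ∀ x, M.fiber x, M.IsFrameAt e x ∧ ∀ᶠ y in 𝓝[≠] x, s y = t y ^ n • e y

/-- The line bundle `M` on the smooth compact connected curve `X` has degree `d`: it has a nonzero
meromorphic section whose divisor has degree `d`. -/
def HasDegree (M : ModuleSheaf.{u, v} X) (d : ℤ) : Prop :=
  ∃ (s : ∀ x, M.fiber x) (D : X →₀ ℤ),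
    (∀ x, M.HasOrderAt s x (D x)) ∧ (D.sum fun _ n => n) = d

end ModuleSheaf

/-! ### Contraction of a component -/

/-- Two points are identified if they are equal or both lie in `K`. -/
def contractSetoid {X : Type u} (K : Set X) : Setoid X where
  r x y := x = y ∨ (x ∈ K ∧ y ∈ K)
  iseqv :=
    { refl := fun _ => Or.inl rfl
      symm := by
        rintro x y (h | h)
        · exact Or.inl h.symm
        · exact Or.inr h.symm
      trans := by
        rintro x y z (rfl | h) (rfl | h')
        · exact Or.inl rfl
        · exact Or.inr h'
        · exact Or.inr h
        · exact Or.inr ⟨h.1, h'.2⟩ }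

/-- The topological space `X / K` in which the subset `K` is collapsed to one point. -/
def Contraction {X : Type u} (K : Set X) : Type u := Quotient (contractSetoid K)

/-- The collapsing map `X → X / K`. -/
def contractMap {X : Type u} (K : Set X) : X → Contraction K := Quotient.mk (contractSetoid K)

instance instTopologicalSpaceContraction {X : Type u} [TopologicalSpace X] (K : Set X) :
    TopologicalSpace (Contraction K) :=
  TopologicalSpace.coinduced (contractMap K) inferInstance

theorem continuous_contractMap {X : Type u} [TopologicalSpace X] (K : Set X) :
    Continuous (contractMap K) :=
  continuous_coinduced_rng

/-- The structure sheaf of `X / K` is the direct image of that of `X`: a function on an open set `V`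
is holomorphic if its pullback to the preimage of `V` in `X` is. -/
instance instHolSpaceContraction {X : Type u} [TopologicalSpace X] [HolSpace X] (K : Set X) :
    HolSpace (Contraction K) where
  HolAt f q := ∀ᶠ q' in 𝓝 q, ∀ x, contractMap K x = q' → HolAt (f ∘ contractMap K) x
  congr := by
    intro f g q h e
    filter_upwards [h, eventually_eventually_nhds.2 e] with q' h1 h2 x hx
    subst hx
    exact HolSpace.congr (h1 x rfl) ((continuous_contractMap K).continuousAt.eventually h2)
  eventually h := eventually_eventually_nhds.2 h
  const c q := Eventually.of_forall fun _ x _ => HolSpace.const c x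
  add := by
    intro f g q h h'
    filter_upwards [h, h'] with q' h1 h2 x hx
    exact HolSpace.add (h1 x hx) (h2 x hx)
  mul := by
    intro f g q h h'
    filter_upwards [h, h'] with q' h1 h2 x hx
    exact HolSpace.mul (h1 x hx) (h2 x hx)

theorem isHolMap_contractMap {X : Type u} [TopologicalSpace X] [HolSpace X] (K : Set X) :
    IsHolMap (contractMap K) :=
  ⟨continuous_contractMap K, fun x _ h => h.self_of_nhds x rfl⟩

end

/-!
Write `K` for the rational component and `Z` for the closure of its complement; they
meet in the two nodes.

*Local structure.*  A punctured branch at a node is connected and avoids the boundary of `K`, so it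
lies in `K` or misses it.  As the node is neither an interior nor an isolated point of `K`, exactly
one of the two branches lies in `K` (`exists_isBranchChart`), and `Z` is the other one; hence `Z` is
smooth there.  A function on the model `z w = 0` is holomorphic at the origin as soon as its
restrictions to the two axes are (`holAt_nodeOrigin`).  Consequently a section of `L` is the same as
a section over `K` and a section over `Z` that agree at the two nodes
(`ModuleSheaf.IsLineBundle.exists_glue`).

*The projective line.*  Dividing a meromorphic section by the rational function with the same zeros
and poles on the affine line identifies a bundle of degree `d` with `𝒪(d)`
(`ModuleSheaf.IsLineBundle.exists_frames_of_hasDegree`), and by Liouville's theorem its sections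
are the polynomials of degree at most `d` (`exists_polynomial_of_differentiable`).  They vanish if
`d < 0`, are the multiples of a global frame if `d = 0`, and if `d > 0` they form a space of
dimension `d + 1` and take arbitrary values at two given points.

*Conclusion.*  If `d > 0`, restriction to `Z` is onto, and its kernel is the space of sections over
`K` that vanish at the two nodes, of dimension `d - 1` (`ModuleSheaf.IsLineBundle.h0_eq_add`).  If
`d < 0`, sections are zero on `K`, so they are the sections over `Z` that vanish at the two nodes
(`ModuleSheaf.IsLineBundle.h0_eq_twistNeg`).  If `d = 0`, the second axes of the two node charts
together form a chart of the contraction at the image of `K` (`isNode_contractMap`), a global frame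
over `K` extends to a frame of `L` around `K`, and the coefficient functions of sections with
respect to it are constant on `K`, hence descend to the contraction
(`ModuleSheaf.IsLineBundle.frame_contract`).
-/

open HolSpace (HolAt)

/-! ### Germs of holomorphic functions -/

section Germs

variable {X : Type u} [TopologicalSpace X] [HolSpace X]

theorem HolSpace.holAt_congr {f g : X → ℂ} {x : X} (h : f =ᶠ[𝓝 x] g) : HolAt f x ↔ HolAt g x :=
  ⟨fun H => HolSpace.congr H h, fun H => HolSpace.congr H h.symm⟩

/-- The germs at `x` are germs of continuous functions, and those that do not vanish at `x` are
units.  Every point of a nodal curve has this property (`IsNodalCurve.localAt`), but the axioms of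
a `HolSpace` do not provide it. -/
def HolSpace.LocalAt (x : X) : Prop :=
  ∀ f : X → ℂ, HolAt f x → ContinuousAt f x ∧ (f x ≠ 0 → HolAt (fun y => (f y)⁻¹) x)

theorem holSpace_localAt_complex (z : ℂ) : HolSpace.LocalAt z := fun f hf =>
  have hf' : AnalyticAt ℂ f z := hf
  ⟨hf'.continuousAt, fun h => hf'.inv h⟩

theorem holSpace_localAt_complexProd (z : ℂ × ℂ) : HolSpace.LocalAt z := fun f hf =>
  have hf' : AnalyticAt ℂ f z := hf
  ⟨hf'.continuousAt, fun h => hf'.inv h⟩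

theorem HolSpace.LocalAt.subset {S : Set X} {x : S} (hx : HolSpace.LocalAt x.1) :
    HolSpace.LocalAt x := by
  rintro f ⟨F, hF, h⟩
  obtain ⟨h1, h2⟩ := hx F hF
  refine ⟨?_, fun h0 => ⟨_, h2 ?_, ?_⟩⟩
  · exact ContinuousAt.congr (f := fun y : S => F y.1)
      (h1.comp continuous_subtype_val.continuousAt) (h.mono fun y hy => hy.symm)
  · rwa [← h.self_of_nhds]
  · filter_upwards [h] with y hy
    rw [hy]

omit [HolSpace X] in
theorem eventually_subtype_of_mem_nhds {S : Set X} {x : S} (hS : S ∈ 𝓝 x.1) {p : X → Prop} :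
    (∀ᶠ y : S in 𝓝 x, p y.1) ↔ ∀ᶠ y in 𝓝 x.1, p y := by
  rw [← map_nhds_subtype_coe_eq_nhds x.2 hS, eventually_map]

theorem holAt_restrict {S : Set X} {x : S} {f : X → ℂ} (hf : HolAt f x.1) :
    HolAt (fun y : S => f y.1) x :=
  ⟨f, hf, Eventually.of_forall fun _ => rfl⟩

theorem holAt_restrict_iff_of_mem_nhds {S : Set X} {x : S} (hS : S ∈ 𝓝 x.1) {f : X → ℂ} :
    HolAt (fun y : S => f y.1) x ↔ HolAt f x.1 := by
  refine ⟨?_, holAt_restrict⟩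
  rintro ⟨F, hF, h⟩
  rw [eventually_subtype_of_mem_nhds (p := fun y => f y = F y) hS] at h
  exact HolSpace.congr hF (h.mono fun y hy => hy.symm)

end Germs

/-! ### Biholomorphic charts -/

section Charts

variable {X : Type*} [TopologicalSpace X] [HolSpace X] {Y : Type*} [TopologicalSpace Y]
  [HolSpace Y] {Z : Type*} [TopologicalSpace Z] [HolSpace Z]

theorem IsBiholChart.holAt_iff {φ : OpenPartialHomeomorph X Y} (hφ : IsBiholChart φ) {x : X}
    (hx : x ∈ φ.source) (g : X → ℂ) : HolAt g x ↔ HolAt (g ∘ φ.symm) (φ x) := by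
  rw [← hφ x hx]
  refine HolSpace.holAt_congr ?_
  filter_upwards [φ.open_source.mem_nhds hx] with y hy
  simp [φ.left_inv hy]

theorem IsBiholChart.symm {φ : OpenPartialHomeomorph X Y} (hφ : IsBiholChart φ) :
    IsBiholChart φ.symm := by
  intro y hy f
  rw [hφ.holAt_iff (φ.map_target hy) f, φ.right_inv hy]

theorem IsBiholChart.trans {φ : OpenPartialHomeomorph X Y} (hφ : IsBiholChart φ)
    {ψ : OpenPartialHomeomorph Y Z} (hψ : IsBiholChart ψ) : IsBiholChart (φ.trans ψ) := by
  intro x hx f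
  rw [OpenPartialHomeomorph.trans_source] at hx
  exact (hφ x hx.1 (f ∘ ψ)).trans (hψ (φ x) hx.2 f)

theorem IsBiholChart.restrOpen {φ : OpenPartialHomeomorph X Y} (hφ : IsBiholChart φ) {s : Set X}
    (hs : IsOpen s) : IsBiholChart (φ.restrOpen s hs) := by
  intro x hx f
  exact hφ x (by simpa using hx.1) f

theorem IsBiholChart.isSmoothPoint {φ : OpenPartialHomeomorph X Y} (hφ : IsBiholChart φ)
    {x : X} (hx : x ∈ φ.source) (h : IsSmoothPoint x) : IsSmoothPoint (φ x) := by
  obtain ⟨ψ, hψx, hψ⟩ := h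
  exact ⟨φ.symm.trans ψ, by simp [φ.left_inv hx, φ.map_source hx, hψx], hφ.symm.trans hψ⟩

theorem IsBiholChart.isNode {φ : OpenPartialHomeomorph X Y} (hφ : IsBiholChart φ)
    {x : X} (hx : x ∈ φ.source) (h : IsNode x) : IsNode (φ x) := by
  obtain ⟨ψ, hψx, h0, hψ⟩ := h
  exact ⟨φ.symm.trans ψ, by simp [φ.left_inv hx, φ.map_source hx, hψx],
    by simp [φ.left_inv hx, h0], hφ.symm.trans hψ⟩

theorem IsBiholChart.localAt {φ : OpenPartialHomeomorph X Y} (hφ : IsBiholChart φ) {x : X}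
    (hx : x ∈ φ.source) (h : HolSpace.LocalAt (φ x)) : HolSpace.LocalAt x := by
  intro f hf
  rw [hφ.holAt_iff hx] at hf
  obtain ⟨h1, h2⟩ := h _ hf
  have h3 : (f ∘ φ.symm) ∘ φ =ᶠ[𝓝 x] f := by
    filter_upwards [φ.open_source.mem_nhds hx] with y hy
    simp [φ.left_inv hy]
  refine ⟨(h1.comp (φ.continuousAt hx)).congr h3, fun h0 => ?_⟩
  rw [hφ.holAt_iff hx]
  exact h2 (by simpa [φ.left_inv hx] using h0)

theorem IsNodalCurve.localAt (hX : IsNodalCurve X) (x : X) : HolSpace.LocalAt x := by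
  rcases hX.smooth_or_node x with ⟨φ, hx, hφ⟩ | ⟨φ, hx, -, hφ⟩
  · exact hφ.localAt hx (holSpace_localAt_complex _)
  · exact hφ.localAt hx (holSpace_localAt_complexProd _).subset

/-- A map that is continuous, injective and open on an open set `U`, and matches holomorphic germs
there, is a biholomorphic chart with source `U`. -/
theorem exists_isBiholChart {U : Set X} (hU : IsOpen U) (hne : U.Nonempty) {f : X → Y}
    (hc : ContinuousOn f U)
    (hi : Set.InjOn f U) (ho : ∀ W ⊆ U, IsOpen W → IsOpen (f '' W))
    (hf : ∀ x ∈ U, ∀ g : Y → ℂ, HolAt (g ∘ f) x ↔ HolAt g (f x)) :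
    ∃ φ : OpenPartialHomeomorph X Y, φ.source = U ∧ (∀ x, φ x = f x) ∧ IsBiholChart φ := by
  have : Nonempty X := hne.to_type
  refine ⟨OpenPartialHomeomorph.ofContinuousOpenRestrict (hi.toPartialEquiv) hc ?_ hU,
    rfl, fun _ => rfl, fun x hx g => hf x hx g⟩
  intro W hW
  have h := ho (Subtype.val '' W) (by rintro _ ⟨y, _, rfl⟩; exact y.2)
    (hU.isOpenMap_subtype_val W hW)
  rw [Set.image_image] at h
  exact h

end Charts

/-! ### The model of a node -/

section NodeModel

/-- The first axis of the model of a node. -/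
def nodeAxis₁ (z : ℂ) : nodeModel := ⟨(z, 0), by simp [nodeModel]⟩

/-- The second axis of the model of a node. -/
def nodeAxis₂ (z : ℂ) : nodeModel := ⟨(0, z), by simp [nodeModel]⟩

@[simp] theorem nodeAxis₁_fst (z : ℂ) : (nodeAxis₁ z).1.1 = z := rfl
@[simp] theorem nodeAxis₁_snd (z : ℂ) : (nodeAxis₁ z).1.2 = 0 := rfl
@[simp] theorem nodeAxis₂_fst (z : ℂ) : (nodeAxis₂ z).1.1 = 0 := rfl
@[simp] theorem nodeAxis₂_snd (z : ℂ) : (nodeAxis₂ z).1.2 = z := rfl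
@[simp] theorem nodeAxis₁_zero : nodeAxis₁ 0 = nodeOrigin := rfl
@[simp] theorem nodeAxis₂_zero : nodeAxis₂ 0 = nodeOrigin := rfl

theorem continuous_nodeAxis₁ : Continuous nodeAxis₁ :=
  Continuous.subtype_mk (by fun_prop) _

theorem continuous_nodeAxis₂ : Continuous nodeAxis₂ :=
  Continuous.subtype_mk (by fun_prop) _

theorem nodeModel_mul_eq_zero (x : nodeModel) : x.1.1 * x.1.2 = 0 := x.2

theorem eq_nodeAxis₁ {x : nodeModel} (h : x.1.2 = 0) : x = nodeAxis₁ x.1.1 :=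
  Subtype.ext (Prod.ext rfl h)

theorem eq_nodeAxis₂ {x : nodeModel} (h : x.1.1 = 0) : x = nodeAxis₂ x.1.2 :=
  Subtype.ext (Prod.ext h rfl)

theorem nodeModel_cases (x : nodeModel) : x = nodeAxis₁ x.1.1 ∨ x = nodeAxis₂ x.1.2 := by
  rcases mul_eq_zero.1 (nodeModel_mul_eq_zero x) with h | h
  · exact Or.inr (eq_nodeAxis₂ h)
  · exact Or.inl (eq_nodeAxis₁ h)

theorem eq_nodeOrigin_iff {x : nodeModel} : x = nodeOrigin ↔ x.1.1 = 0 ∧ x.1.2 = 0 := by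
  constructor
  · rintro rfl; exact ⟨rfl, rfl⟩
  · rintro ⟨h, h'⟩; exact Subtype.ext (Prod.ext h h')

/-- The model of a node has the topology of two lines glued at a point. -/
theorem isOpen_nodeModel_iff {O : Set nodeModel} :
    IsOpen O ↔ IsOpen (nodeAxis₁ ⁻¹' O) ∧ IsOpen (nodeAxis₂ ⁻¹' O) := by
  refine ⟨fun h => ⟨h.preimage continuous_nodeAxis₁, h.preimage continuous_nodeAxis₂⟩, ?_⟩
  rintro ⟨h1, h2⟩
  have e : Oᶜ = ((fun x : nodeModel => x.1.1) ⁻¹' (nodeAxis₁ ⁻¹' O)ᶜ ∩ {x | x.1.2 = 0}) ∪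
      ((fun x : nodeModel => x.1.2) ⁻¹' (nodeAxis₂ ⁻¹' O)ᶜ ∩ {x | x.1.1 = 0}) := by
    ext x
    simp only [Set.mem_compl_iff, Set.mem_union, Set.mem_inter_iff, Set.mem_preimage,
      Set.mem_ofPred_eq]
    constructor
    · intro hx
      rcases mul_eq_zero.1 (nodeModel_mul_eq_zero x) with h | h
      · exact Or.inr ⟨by rwa [← eq_nodeAxis₂ h], h⟩
      · exact Or.inl ⟨by rwa [← eq_nodeAxis₁ h], h⟩
    · rintro (⟨hx, h⟩ | ⟨hx, h⟩)
      · rwa [← eq_nodeAxis₁ h] at hx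
      · rwa [← eq_nodeAxis₂ h] at hx
  have c1 : Continuous fun x : nodeModel => x.1.1 := by fun_prop
  have c2 : Continuous fun x : nodeModel => x.1.2 := by fun_prop
  rw [← isClosed_compl_iff, e]
  exact ((h1.isClosed_compl.preimage c1).inter (isClosed_eq c2 continuous_const)).union
    ((h2.isClosed_compl.preimage c2).inter (isClosed_eq c1 continuous_const))

/-- A self-map of the model of a node that is induced by an analytic map of `ℂ²` is holomorphic. -/
theorem holAt_nodeModel_comp {m : ℂ × ℂ → ℂ × ℂ} (hm : ∀ z, AnalyticAt ℂ m z)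
    {n : nodeModel → nodeModel} (hn : ∀ x, (n x).1 = m x.1) {f : nodeModel → ℂ} {x : nodeModel}
    (hf : HolAt f (n x)) : HolAt (f ∘ n) x := by
  obtain ⟨F, hF, h⟩ := hf
  have hF' : AnalyticAt ℂ F (n x).1 := hF
  rw [hn] at hF'
  have hcn : Continuous n := by
    refine continuous_induced_rng.2 ?_
    have : (Subtype.val ∘ n) = m ∘ Subtype.val := funext hn
    rw [this]
    exact (continuous_iff_continuousAt.2 fun z => (hm z).continuousAt).comp continuous_subtype_val
  refine ⟨F ∘ m, hF'.comp (hm _), ?_⟩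
  filter_upwards [hcn.continuousAt.eventually h] with y hy
  simp [hy, hn]

theorem analyticAt_nodeAxis₁ {f : nodeModel → ℂ} {z : ℂ} (hf : HolAt f (nodeAxis₁ z)) :
    AnalyticAt ℂ (fun u => f (nodeAxis₁ u)) z := by
  obtain ⟨F, hF, h⟩ := hf
  have hF' : AnalyticAt ℂ F (z, 0) := hF
  have h1 : AnalyticAt ℂ (fun u : ℂ => F (u, 0)) z :=
    AnalyticAt.fun_comp (g := F) (f := fun u : ℂ => (u, (0 : ℂ))) hF'
      (analyticAt_id.prod analyticAt_const)
  refine h1.congr ?_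
  filter_upwards [continuous_nodeAxis₁.continuousAt.eventually h] with u hu
  exact hu.symm

theorem analyticAt_nodeAxis₂ {f : nodeModel → ℂ} {z : ℂ} (hf : HolAt f (nodeAxis₂ z)) :
    AnalyticAt ℂ (fun u => f (nodeAxis₂ u)) z := by
  obtain ⟨F, hF, h⟩ := hf
  have hF' : AnalyticAt ℂ F (0, z) := hF
  have h1 : AnalyticAt ℂ (fun u : ℂ => F (0, u)) z :=
    AnalyticAt.fun_comp (g := F) (f := fun u : ℂ => ((0 : ℂ), u)) hF'
      (analyticAt_const.prod analyticAt_id)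
  refine h1.congr ?_
  filter_upwards [continuous_nodeAxis₂.continuousAt.eventually h] with u hu
  exact hu.symm

theorem holAt_comp_fst {g : ℂ → ℂ} {x : nodeModel} (hg : AnalyticAt ℂ g x.1.1) :
    HolAt (fun y : nodeModel => g y.1.1) x :=
  holAt_restrict (S := nodeModel) (f := fun z : ℂ × ℂ => g z.1)
    (show AnalyticAt ℂ (fun z : ℂ × ℂ => g z.1) x.1 from AnalyticAt.fun_comp hg analyticAt_fst)

theorem holAt_comp_snd {g : ℂ → ℂ} {x : nodeModel} (hg : AnalyticAt ℂ g x.1.2) :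
    HolAt (fun y : nodeModel => g y.1.2) x :=
  holAt_restrict (S := nodeModel) (f := fun z : ℂ × ℂ => g z.2)
    (show AnalyticAt ℂ (fun z : ℂ × ℂ => g z.2) x.1 from AnalyticAt.fun_comp hg analyticAt_snd)

/-- Holomorphic functions on the two axes that agree at the origin glue: they are the restrictions
of `(z, w) ↦ f (z, 0) + f (0, w) - f (0, 0)`. -/
theorem holAt_nodeOrigin {f : nodeModel → ℂ}
    (h1 : AnalyticAt ℂ (fun u => f (nodeAxis₁ u)) 0)
    (h2 : AnalyticAt ℂ (fun u => f (nodeAxis₂ u)) 0) : HolAt f nodeOrigin := by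
  have h3 := HolSpace.add (HolSpace.add (holAt_comp_fst (x := nodeOrigin) h1)
    (holAt_comp_snd (x := nodeOrigin) h2)) (HolSpace.const (-f nodeOrigin) nodeOrigin)
  refine HolSpace.congr h3 (Eventually.of_forall fun y => ?_)
  rcases nodeModel_cases y with h | h <;> rw [h] <;> simp

/-- Away from the origin, the model of a node is locally one of its axes. -/
theorem holAt_nodeAxis₁ {f : nodeModel → ℂ} {z : ℂ} (hz : z ≠ 0)
    (h : AnalyticAt ℂ (fun u => f (nodeAxis₁ u)) z) : HolAt f (nodeAxis₁ z) := by
  refine HolSpace.congr (holAt_comp_fst (x := nodeAxis₁ z) h) ?_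
  have c1 : Continuous fun x : nodeModel => x.1.1 := by fun_prop
  filter_upwards [(isOpen_ne.preimage c1).mem_nhds (show (nodeAxis₁ z).1.1 ≠ 0 from hz)] with y hy
  rw [← eq_nodeAxis₁ ((mul_eq_zero.1 (nodeModel_mul_eq_zero y)).resolve_left hy)]

theorem holAt_nodeAxis₂ {f : nodeModel → ℂ} {z : ℂ} (hz : z ≠ 0)
    (h : AnalyticAt ℂ (fun u => f (nodeAxis₂ u)) z) : HolAt f (nodeAxis₂ z) := by
  refine HolSpace.congr (holAt_comp_snd (x := nodeAxis₂ z) h) ?_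
  have c1 : Continuous fun x : nodeModel => x.1.2 := by fun_prop
  filter_upwards [(isOpen_ne.preimage c1).mem_nhds (show (nodeAxis₂ z).1.2 ≠ 0 from hz)] with y hy
  rw [← eq_nodeAxis₂ ((mul_eq_zero.1 (nodeModel_mul_eq_zero y)).resolve_right hy)]

/-- The exchange of the two axes. -/
def nodeSwap : nodeModel ≃ₜ nodeModel where
  toFun x := ⟨x.1.swap, (mul_comm _ _).trans (nodeModel_mul_eq_zero x)⟩
  invFun x := ⟨x.1.swap, (mul_comm _ _).trans (nodeModel_mul_eq_zero x)⟩
  left_inv _ := rfl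
  right_inv _ := rfl
  continuous_toFun := Continuous.subtype_mk (by fun_prop) _
  continuous_invFun := Continuous.subtype_mk (by fun_prop) _

theorem isBiholChart_nodeSwap : IsBiholChart nodeSwap.toOpenPartialHomeomorph := by
  have hm : ∀ z : ℂ × ℂ, AnalyticAt ℂ (fun z : ℂ × ℂ => (z.2, z.1)) z := fun z =>
    analyticAt_snd.prod analyticAt_fst
  intro x _ f
  refine ⟨fun h => ?_, fun h => holAt_nodeModel_comp hm (n := nodeSwap) (fun _ => rfl) h⟩
  exact holAt_nodeModel_comp hm (n := nodeSwap) (fun _ => rfl) (x := nodeSwap x) h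

end NodeModel

/-! ### Frames of line bundles -/

namespace ModuleSheaf

variable {X : Type u} [TopologicalSpace X] [HolSpace X] {M : ModuleSheaf.{u, v} X}
  {e : ∀ x, M.fiber x} {x : X}

theorem IsFrameAt.eventually (he : M.IsFrameAt e x) : ∀ᶠ y in 𝓝 x, M.IsFrameAt e y :=
  eventually_eventually_nhds.2 he

theorem IsFrameAt.eventually_ne_zero (he : M.IsFrameAt e x) : ∀ᶠ y in 𝓝 x, e y ≠ 0 :=
  he.mono fun _ h => h.1

theorem IsFrameAt.ne_zero (he : M.IsFrameAt e x) : e x ≠ 0 := he.self_of_nhds.1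

theorem holAt_congr {s t : ∀ x, M.fiber x} (h : ∀ᶠ y in 𝓝 x, s y = t y) :
    M.HolAt s x ↔ M.HolAt t x :=
  ⟨fun H => M.congr H h, fun H => M.congr H (h.mono fun _ hy => hy.symm)⟩

/-- A section is holomorphic if and only if its coefficient with respect to a frame is. -/
theorem IsFrameAt.holAt_iff (he : M.IsFrameAt e x) {s : ∀ x, M.fiber x} {g : X → ℂ}
    (h : ∀ᶠ y in 𝓝 x, s y = g y • e y) : M.HolAt s x ↔ HolSpace.HolAt g x := by
  rw [he.self_of_nhds.2 s]
  refine ⟨?_, fun hg => ⟨g, hg, h⟩⟩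
  rintro ⟨f, hf, hs⟩
  refine HolSpace.congr hf ?_
  filter_upwards [h, hs, he.eventually_ne_zero] with y h1 h2 h3
  exact smul_left_injective ℂ h3 (h2.symm.trans h1)

theorem IsFrameAt.holAt (he : M.IsFrameAt e x) : M.HolAt e x :=
  (he.holAt_iff (g := fun _ => 1) (Eventually.of_forall fun _ => (one_smul _ _).symm)).2
    (HolSpace.const 1 x)

/-- The coefficient function of a section with respect to a family of vectors of the fibres,
wherever the latter does not vanish. -/
theorem IsLineBundle.exists_coeff (hM : M.IsLineBundle) (e s : ∀ x, M.fiber x) :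
    ∃ g : X → ℂ, ∀ y, e y ≠ 0 → s y = g y • e y := by
  have h : ∀ y, ∃ c : ℂ, e y ≠ 0 → s y = c • e y := by
    intro y
    by_cases hy : e y = 0
    · exact ⟨0, fun h => absurd hy h⟩
    · obtain ⟨c, hc⟩ := (finrank_eq_one_iff_of_nonzero' (e y) hy).1 (hM.1 y) (s y)
      exact ⟨c, fun _ => hc.symm⟩
  choose g hg using h
  exact ⟨g, hg⟩

theorem IsFrameAt.smul (he : M.IsFrameAt e x) {g : X → ℂ} (hg : HolSpace.HolAt g x)
    (hx : HolSpace.LocalAt x) (h0 : g x ≠ 0) : M.IsFrameAt (fun y => g y • e y) x := by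
  obtain ⟨hc, hinv⟩ := hx g hg
  filter_upwards [he.eventually, HolSpace.eventually hg, HolSpace.eventually (hinv h0),
    (hc.eventually_ne h0).eventually_nhds] with y h1 h2 h3 h4
  refine ⟨smul_ne_zero h4.self_of_nhds h1.ne_zero, fun s => ?_⟩
  rw [h1.self_of_nhds.2 s]
  constructor
  · rintro ⟨f, hf, hs⟩
    refine ⟨_, HolSpace.mul hf h3, ?_⟩
    filter_upwards [hs, h4] with z hz hz0
    rw [hz, smul_smul, inv_mul_cancel_right₀ hz0]
  · rintro ⟨f, hf, hs⟩
    refine ⟨_, HolSpace.mul hf h2, ?_⟩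
    filter_upwards [hs] with z hz
    rw [hz, smul_smul]

/-- A section of a line bundle that does not vanish at `x` is a frame around `x`. -/
theorem IsLineBundle.isFrameAt (hM : M.IsLineBundle) (hx : HolSpace.LocalAt x)
    (hs : M.HolAt e x) (h0 : e x ≠ 0) : M.IsFrameAt e x := by
  obtain ⟨ε, hε⟩ := hM.2 x
  obtain ⟨g, hg⟩ := hM.exists_coeff ε e
  have h1 : ∀ᶠ y in 𝓝 x, e y = g y • ε y := hε.eventually_ne_zero.mono fun y hy => hg y hy
  have h2 : M.IsFrameAt (fun y => g y • ε y) x := by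
    refine hε.smul ((hε.holAt_iff h1).1 hs) hx fun h => h0 ?_
    rw [h1.self_of_nhds, h, zero_smul]
  filter_upwards [h2, h1.eventually_nhds] with y h3 h4
  refine ⟨h4.self_of_nhds ▸ h3.1, fun s => (h3.2 s).trans ?_⟩
  refine exists_congr fun f => and_congr_right fun _ => ?_
  refine ⟨fun h => ?_, fun h => ?_⟩ <;> filter_upwards [h, h4] with z hz hz'
  · rw [hz, hz']
  · rw [hz, hz']

theorem restrict_holAt {S : Set X} {x : S} {s : ∀ x, M.fiber x} (hs : M.HolAt s x.1) :
    (M.restrict S).HolAt (fun y => s y.1) x :=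
  ⟨s, hs, Eventually.of_forall fun _ => rfl⟩

theorem IsFrameAt.restrict {S : Set X} {x : S} (he : M.IsFrameAt e x.1) :
    (M.restrict S).IsFrameAt (fun y => e y.1) x := by
  have h1 : ∀ᶠ y : S in 𝓝 x, M.IsFrameAt e y.1 :=
    continuous_subtype_val.continuousAt.eventually he.eventually
  filter_upwards [h1] with y hy
  refine ⟨hy.ne_zero, fun s => ⟨?_, ?_⟩⟩
  · rintro ⟨t, ht, h⟩
    obtain ⟨f, hf, h'⟩ := (hy.self_of_nhds.2 t).1 ht
    refine ⟨fun z => f z.1, holAt_restrict hf, ?_⟩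
    filter_upwards [h, continuous_subtype_val.continuousAt.eventually h'] with z hz hz'
    exact hz.trans hz'
  · rintro ⟨f, ⟨F, hF, h⟩, h'⟩
    refine ⟨fun z => F z • e z, M.smul hF hy.holAt, ?_⟩
    filter_upwards [h, h'] with z hz hz'
    exact hz'.trans (congrArg (fun c : ℂ => c • e z.1) hz)

theorem IsLineBundle.restrict (hM : M.IsLineBundle) (S : Set X) :
    (M.restrict S).IsLineBundle := by
  refine ⟨fun x => hM.1 x.1, fun x => ?_⟩
  obtain ⟨e, he⟩ := hM.2 x.1
  exact ⟨fun y => e y.1, he.restrict⟩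

theorem eventually_eq_zero_of_smul_frame (he : ∀ᶠ y in 𝓝 x, e y ≠ 0) {f : X → ℂ}
    (h : ∀ᶠ y in 𝓝 x, f y • e y = 0) : ∀ᶠ y in 𝓝 x, f y = 0 := by
  filter_upwards [he, h] with y h1 h2
  exact (smul_eq_zero.1 h2).resolve_right h1

/-! ### Sections vanishing at finitely many points -/

/-- Dividing by a local coordinate: a holomorphic function that vanishes at the smooth point `x` is
a multiple of the coordinate. -/
theorem _root_.IsBiholChart.exists_eq_coord_mul {φ : OpenPartialHomeomorph X ℂ}
    (hφ : IsBiholChart φ) (hx : x ∈ φ.source) {f : X → ℂ} (hf : HolSpace.HolAt f x)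
    (h0 : f x = 0) :
    ∃ g : X → ℂ, HolSpace.HolAt g x ∧ ∀ᶠ y in 𝓝 x, f y = (φ y - φ x) * g y := by
  have hF : AnalyticAt ℂ (f ∘ φ.symm) (φ x) := (hφ.holAt_iff hx f).1 hf
  obtain ⟨p, hp⟩ := hF
  have hd : AnalyticAt ℂ (dslope (f ∘ φ.symm) (φ x)) (φ x) :=
    ⟨_, hp.has_fpower_series_dslope_fslope⟩
  refine ⟨_, (hφ x hx (dslope (f ∘ φ.symm) (φ x))).2 hd, ?_⟩
  filter_upwards [φ.open_source.mem_nhds hx] with y hy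
  have h1 := sub_smul_dslope (f ∘ φ.symm) (φ x) (φ y)
  simp only [Function.comp_apply, φ.left_inv hy, φ.left_inv hx, h0, sub_zero, smul_eq_mul] at h1
  exact h1.symm

theorem _root_.HolSpace.LocalAt.eq_of_eventuallyEq_nhdsNE (hx : HolSpace.LocalAt x)
    [(𝓝[≠] x).NeBot] {f g : X → ℂ} (hf : HolSpace.HolAt f x) (hg : HolSpace.HolAt g x)
    (h : f =ᶠ[𝓝[≠] x] g) : f x = g x :=
  tendsto_nhds_unique_of_eventuallyEq ((hx f hf).1.tendsto.mono_left nhdsWithin_le_nhds)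
    ((hx g hg).1.tendsto.mono_left nhdsWithin_le_nhds) h

theorem _root_.IsSmoothPoint.neBot_nhdsNE (hx : IsSmoothPoint x) : (𝓝[≠] x).NeBot := by
  obtain ⟨φ, hφx, -⟩ := hx
  by_contra h
  rw [not_neBot, ← isOpen_singleton_iff_punctured_nhds] at h
  have h2 := φ.isOpen_image_of_subset_source h (by simpa using hφx)
  rw [Set.image_singleton] at h2
  exact not_isOpen_singleton _ h2

/-- For a finite set `S` of smooth points, the sections of a line bundle that vanish on `S` form a
locally free sheaf: near a point of `S`, a frame of the bundle times a coordinate is a frame. -/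
theorem IsLineBundle.isLocallyFreeRankOne_twistNeg [T1Space X] (hM : M.IsLineBundle)
    (hX : ∀ x : X, HolSpace.LocalAt x) {S : Set X} (hS : S.Finite)
    (hsm : ∀ x ∈ S, IsSmoothPoint x) : (M.twistNeg S).IsLocallyFreeRankOne := by
  -- away from `S` the two sheaves coincide
  have key : ∀ (e : ∀ x, M.fiber x) (y : X), y ∉ S → M.IsFrameAt e y →
      (∀ s : ∀ x, M.fiber x, (M.twistNeg S).HolAt s y ↔
        ∃ f : X → ℂ, HolSpace.HolAt f y ∧ ∀ᶠ z in 𝓝 y, s z = f z • e z) ∧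
      ∀ f : X → ℂ, HolSpace.HolAt f y → (∀ᶠ z in 𝓝 y, f z • e z = 0) →
        ∀ᶠ z in 𝓝 y, f z = 0 := by
    intro e y hy he
    refine ⟨fun s => ?_, fun f _ h => eventually_eq_zero_of_smul_frame he.eventually_ne_zero h⟩
    rw [← he.self_of_nhds.2 s]
    refine ⟨fun h => h.1, fun h => ⟨h, ?_⟩⟩
    filter_upwards [hS.isClosed.isOpen_compl.mem_nhds hy] with z hz hz'
    exact absurd hz' hz
  intro x
  obtain ⟨e, he⟩ := hM.2 x
  by_cases hx : x ∈ S
  · obtain ⟨φ, hφx, hφ⟩ := hsm x hx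
    set t : X → ℂ := fun y => φ y - φ x with ht
    have htH : ∀ y ∈ φ.source, HolSpace.HolAt t y := fun y hy =>
      (hφ y hy (fun z => z - φ x)).2 (analyticAt_id.sub analyticAt_const)
    have ht0 : ∀ y ∈ φ.source, y ≠ x → t y ≠ 0 := fun y hy hyx h =>
      hyx (φ.injOn hy hφx (sub_eq_zero.1 h))
    have hS' : ∀ᶠ y in 𝓝 x, y ∈ S → y = x := by
      filter_upwards [(hS.subset (Set.sdiff_subset (t := {x}))).isClosed.isOpen_compl.mem_nhds
        (show x ∈ (S \ {x})ᶜ by simp)] with y hy hyS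
      by_contra hne
      exact hy ⟨hyS, hne⟩
    refine ⟨fun y => t y • e y, ?_⟩
    suffices h : ∀ᶠ y in 𝓝 x, (∀ s : ∀ x, M.fiber x, (M.twistNeg S).HolAt s y ↔
        ∃ f : X → ℂ, HolSpace.HolAt f y ∧ ∀ᶠ z in 𝓝 y, s z = f z • t z • e z) ∧
        ∀ f : X → ℂ, HolSpace.HolAt f y → (∀ᶠ z in 𝓝 y, f z • t z • e z = 0) →
          ∀ᶠ z in 𝓝 y, f z = 0 from h
    filter_upwards [he.eventually, φ.open_source.mem_nhds hφx, hS'] with y hey hys hyS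
    by_cases hyx : y = x
    · subst hyx
      have := (hsm y hx).neBot_nhdsNE
      refine ⟨fun s => ⟨?_, ?_⟩, fun f hf h => ?_⟩
      · rintro ⟨hs, hs0⟩
        obtain ⟨f, hf, hsf⟩ := (hey.self_of_nhds.2 s).1 hs
        have hf0 : f y = 0 := by
          have h1 := hs0.self_of_nhds hx
          rw [hsf.self_of_nhds] at h1
          exact (smul_eq_zero.1 h1).resolve_right hey.ne_zero
        obtain ⟨g, hg, hfg⟩ := hφ.exists_eq_coord_mul hys hf hf0
        refine ⟨g, hg, ?_⟩
        filter_upwards [hsf, hfg] with z h1 h2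
        rw [h1, h2, smul_smul, mul_comm]
      · rintro ⟨g, hg, hsg⟩
        refine ⟨M.congr (M.smul hg (M.smul (htH y hys) hey.holAt))
          (hsg.mono fun z hz => hz.symm), ?_⟩
        filter_upwards [hsg, hS'] with z h1 h2 hzS
        rw [h1, h2 hzS]
        simp [ht]
      -- `f` vanishes off the point, hence by continuity also there
      · have h1 : f =ᶠ[𝓝[≠] y] fun _ => 0 := by
          filter_upwards [nhdsWithin_le_nhds h, nhdsWithin_le_nhds hey.eventually_ne_zero,
            nhdsWithin_le_nhds (φ.open_source.mem_nhds hys), self_mem_nhdsWithin] with z h1 h2 h3 h4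
          rw [smul_smul] at h1
          exact (mul_eq_zero.1 ((smul_eq_zero.1 h1).resolve_right h2)).resolve_right (ht0 z h3 h4)
        have h2 := (hX y).eq_of_eventuallyEq_nhdsNE hf (HolSpace.const 0 y) h1
        filter_upwards [eventually_nhdsWithin_iff.1 h1] with z hz
        by_cases hzy : z = y
        · exact hzy ▸ h2
        · exact hz hzy
    · exact key _ y (fun h => hyx (hyS h)) (hey.smul (htH y hys) (hX y) (ht0 y hys hyx))
  · refine ⟨e, ?_⟩
    filter_upwards [he.eventually, hS.isClosed.isOpen_compl.mem_nhds hx] with y hy hyS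
    exact key e y hyS hy

end ModuleSheaf

/-! ### Local coordinates -/

section Coordinates

variable {X : Type u} [TopologicalSpace X] [HolSpace X]

/-- `c` parametrizes a neighbourhood of `x` by a neighbourhood of `0`, and `κ` is the corresponding
local coordinate, both as total functions of which only the germs matter. -/
structure IsCoordAt (c : ℂ → X) (κ : X → ℂ) (x : X) : Prop where
  apply_zero : c 0 = x
  map_nhds : map c (𝓝 0) = 𝓝 x
  left_inv : ∀ᶠ u in 𝓝 0, κ (c u) = u
  holAt_iff : ∀ f : X → ℂ, HolAt f x ↔ AnalyticAt ℂ (fun u => f (c u)) 0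

namespace IsCoordAt

variable {c : ℂ → X} {κ : X → ℂ} {x : X}

theorem eventually_iff (h : IsCoordAt c κ x) {p : X → Prop} :
    (∀ᶠ y in 𝓝 x, p y) ↔ ∀ᶠ u in 𝓝 0, p (c u) := by
  rw [← h.map_nhds, eventually_map]

theorem coord_self (h : IsCoordAt c κ x) : κ x = 0 := by
  have := h.left_inv.self_of_nhds
  rwa [h.apply_zero] at this

theorem eventually_eq_iff (h : IsCoordAt c κ x) : ∀ᶠ u in 𝓝 0, c u = x ↔ u = 0 := by
  filter_upwards [h.left_inv] with u hu
  refine ⟨fun hx => ?_, fun hx => hx ▸ h.apply_zero⟩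
  rw [← hu, hx, h.coord_self]

theorem eventually_nhdsNE_iff (h : IsCoordAt c κ x) {p : X → Prop} :
    (∀ᶠ y in 𝓝[≠] x, p y) ↔ ∀ᶠ u in 𝓝[≠] 0, p (c u) := by
  rw [eventually_nhdsWithin_iff, eventually_nhdsWithin_iff, h.eventually_iff]
  refine eventually_congr ?_
  filter_upwards [h.eventually_eq_iff] with u hu
  simp [hu]

theorem neBot_nhdsNE (h : IsCoordAt c κ x) : (𝓝[≠] x).NeBot := by
  refine ⟨fun h0 => ?_⟩
  have h1 : ∀ᶠ _ in 𝓝[≠] x, False := by rw [h0]; exact eventually_bot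
  rw [h.eventually_nhdsNE_iff] at h1
  exact h1.exists.elim fun _ h => h

theorem holAt_comp (h : IsCoordAt c κ x) {g : ℂ → ℂ} (hg : AnalyticAt ℂ g 0) :
    HolAt (fun y => g (κ y)) x := by
  rw [h.holAt_iff]
  refine hg.congr ?_
  filter_upwards [h.left_inv] with u hu
  rw [hu]

/-- A local coordinate in the sense of biholomorphic charts is a unit times the given one. -/
theorem exists_chart_eq_mul (h : IsCoordAt c κ x) {t : OpenPartialHomeomorph X ℂ}
    (hx : x ∈ t.source) (h0 : t x = 0) (ht : IsBiholChart t) :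
    ∃ v : ℂ → ℂ, AnalyticAt ℂ v 0 ∧ v 0 ≠ 0 ∧ ∀ u, t (c u) = u * v u := by
  have hτ : AnalyticAt ℂ (fun u => t (c u)) 0 :=
    (h.holAt_iff t).1 ((ht x hx id).2 analyticAt_id)
  have hκ : HolAt κ x := h.holAt_comp (g := id) analyticAt_id
  have hG : AnalyticAt ℂ (κ ∘ t.symm) (t x) := (ht.holAt_iff hx κ).1 hκ
  have hτ0 : t (c 0) = 0 := by rw [h.apply_zero, h0]
  rw [h0, ← hτ0] at hG
  have hGτ : ∀ᶠ u in 𝓝 0, (κ ∘ t.symm) (t (c u)) = u := by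
    filter_upwards [h.left_inv, h.eventually_iff.1 (t.open_source.mem_nhds hx)] with u hu hs
    simp [t.left_inv hs, hu]
  -- the two coordinates are analytic functions of each other, so the derivatives do not vanish
  have hd := (hG.differentiableAt.hasDerivAt.comp (0 : ℂ) hτ.differentiableAt.hasDerivAt)
  have hd' : HasDerivAt (fun u : ℂ => u) (1 : ℂ) 0 := hasDerivAt_id _
  have hu := hd.unique (hd'.congr_of_eventuallyEq hGτ)
  have hv0 : dslope (fun u => t (c u)) 0 0 ≠ 0 := by
    rw [dslope_same]
    exact right_ne_zero_of_mul (hu ▸ one_ne_zero)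
  obtain ⟨p, hp⟩ := hτ
  refine ⟨dslope (fun u => t (c u)) 0, ⟨_, hp.has_fpower_series_dslope_fslope⟩, hv0, fun u => ?_⟩
  have := sub_smul_dslope (fun u => t (c u)) 0 u
  simp only [hτ0, sub_zero, smul_eq_mul] at this
  exact this.symm

/-- The order of a meromorphic section can be read off in any local coordinate. -/
theorem exists_frame_of_hasOrderAt (h : IsCoordAt c κ x) (hx : HolSpace.LocalAt x)
    {M : ModuleSheaf.{u, v} X} {s : ∀ x, M.fiber x} {n : ℤ} (hs : M.HasOrderAt s x n) :
    ∃ ε : ∀ x, M.fiber x, M.IsFrameAt ε x ∧ ∀ᶠ u in 𝓝[≠] 0, s (c u) = u ^ n • ε (c u) := by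
  obtain ⟨t, hxt, h0, ht, e, he, hse⟩ := hs
  obtain ⟨v, hv, hv0, htv⟩ := h.exists_chart_eq_mul hxt h0 ht
  refine ⟨fun y => v (κ y) ^ n • e y, he.smul (h.holAt_comp (g := fun u => v u ^ n)
    (hv.zpow hv0)) hx (by rw [h.coord_self]; exact zpow_ne_zero _ hv0), ?_⟩
  filter_upwards [h.eventually_nhdsNE_iff.1 hse, nhdsWithin_le_nhds h.left_inv] with u hu hκ
  rw [hu, hκ, htv, mul_zpow, smul_smul]

end IsCoordAt

/-- Removing singularities: if `σ` agrees near every point of the open set `U`, except perhaps at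
the point itself, with a section of `M`, then changing the values of `σ` makes it a section. -/
theorem ModuleSheaf.IsLineBundle.exists_extension [T1Space X] {M : ModuleSheaf.{u, v} X}
    (hM : M.IsLineBundle) (hX : ∀ x : X, HolSpace.LocalAt x) (hne : ∀ x : X, (𝓝[≠] x).NeBot)
    {U : Set X} (hU : IsOpen U) (σ : ∀ x, M.fiber x)
    (h : ∀ x ∈ U, ∃ τ, M.HolAt τ x ∧ ∀ᶠ y in 𝓝[≠] x, σ y = τ y) :
    ∃ σ' : ∀ x, M.fiber x, ∀ x ∈ U, ∀ τ, M.HolAt τ x → (∀ᶠ y in 𝓝[≠] x, σ y = τ y) →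
      ∀ᶠ y in 𝓝 x, σ' y = τ y := by
  have h' : ∀ x, ∃ τ : ∀ x, M.fiber x, x ∈ U → M.HolAt τ x ∧ ∀ᶠ y in 𝓝[≠] x, σ y = τ y := by
    intro x
    by_cases hx : x ∈ U
    · obtain ⟨τ, hτ⟩ := h x hx
      exact ⟨τ, fun _ => hτ⟩
    · exact ⟨σ, fun h => absurd h hx⟩
  choose T hT using h'
  -- two sections that agree on a punctured neighbourhood agree at the point, by continuity
  have key : ∀ x ∈ U, ∀ τ, M.HolAt τ x → (∀ᶠ y in 𝓝[≠] x, σ y = τ y) → T x x = τ x := by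
    intro x hx τ hτ hστ
    obtain ⟨ε, hε⟩ := hM.2 x
    obtain ⟨g, hg⟩ := hM.exists_coeff ε (T x)
    obtain ⟨g', hg'⟩ := hM.exists_coeff ε τ
    have h1 : HolSpace.HolAt g x :=
      (hε.holAt_iff (hε.eventually_ne_zero.mono fun y hy => hg y hy)).1 (hT x hx).1
    have h2 : HolSpace.HolAt g' x :=
      (hε.holAt_iff (hε.eventually_ne_zero.mono fun y hy => hg' y hy)).1 hτ
    have := hne x
    have h3 : g x = g' x := by
      refine (hX x).eq_of_eventuallyEq_nhdsNE h1 h2 ?_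
      filter_upwards [(hT x hx).2, hστ, nhdsWithin_le_nhds hε.eventually_ne_zero] with y h4 h5 h6
      refine smul_left_injective ℂ h6 ?_
      change g y • ε y = g' y • ε y
      rw [← hg y h6, ← hg' y h6, ← h4, ← h5]
    rw [hg x hε.ne_zero, hg' x hε.ne_zero, h3]
  refine ⟨fun x => T x x, fun x hx τ hτ hστ => ?_⟩
  have h1 := eventually_eventually_nhdsWithin.2 hστ
  filter_upwards [hU.mem_nhds hx, M.eventually hτ, eventually_nhdsWithin_iff.1 h1] with y h2 h3 h4
  by_cases hyx : y = x
  · subst hyx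
    exact key y hx τ hτ hστ
  · refine key y h2 τ h3 (nhdsWithin_le_nhds ?_)
    have h5 := h4 hyx
    rwa [isOpen_compl_singleton.nhdsWithin_eq hyx] at h5

end Coordinates

/-! ### Coordinates on the projective line -/

section Sphere

variable {X : Type u} [TopologicalSpace X] {e : X ≃ₜ OnePoint ℂ}

/-- The affine coordinate on a space identified with the projective line, with the junk value `0`
at infinity. -/
noncomputable def affineCoord (e : X ≃ₜ OnePoint ℂ) (x : X) : ℂ := (e x).elim 0 id

@[simp] theorem affineCoord_coe (z : ℂ) : affineCoord e (e.symm (z : OnePoint ℂ)) = z := by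
  simp [affineCoord]

@[simp] theorem affineCoord_infty : affineCoord e (e.symm OnePoint.infty) = 0 := by
  simp [affineCoord]

theorem symm_affineCoord {x : X} (hx : x ≠ e.symm OnePoint.infty) :
    e.symm ((affineCoord e x : ℂ) : OnePoint ℂ) = x := by
  obtain ⟨y, rfl⟩ := e.symm.surjective x
  induction y using OnePoint.rec with
  | infty => exact absurd rfl hx
  | coe z => simp

theorem symm_sphereAtInfty {w : ℂ} (hw : w ≠ 0) :
    e.symm (sphereAtInfty w) = e.symm ((w⁻¹ : ℂ) : OnePoint ℂ) := by
  simp [sphereAtInfty, hw]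

theorem symm_sphereAtInfty_zero : e.symm (sphereAtInfty 0) = e.symm OnePoint.infty := by
  simp [sphereAtInfty]

@[simp] theorem affineCoord_sphereAtInfty (w : ℂ) :
    affineCoord e (e.symm (sphereAtInfty w)) = w⁻¹ := by
  by_cases hw : w = 0
  · subst hw
    rw [symm_sphereAtInfty_zero, affineCoord_infty, inv_zero]
  · rw [symm_sphereAtInfty hw, affineCoord_coe]

variable [HolSpace X] (he : ∀ (x : X) (f : OnePoint ℂ → ℂ), HolAt (f ∘ e) x ↔ HolAt f (e x))

include he

theorem holAt_affine_iff (f : X → ℂ) (a : ℂ) :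
    HolAt f (e.symm (a : OnePoint ℂ)) ↔
      AnalyticAt ℂ (fun z : ℂ => f (e.symm (z : OnePoint ℂ))) a := by
  have h := he (e.symm (a : OnePoint ℂ)) (f ∘ e.symm)
  rw [e.apply_symm_apply, Function.comp_assoc, e.symm_comp_self] at h
  exact h

theorem isCoordAt_affine (a : ℂ) :
    IsCoordAt (fun u : ℂ => e.symm ((a + u : ℂ) : OnePoint ℂ)) (fun x => affineCoord e x - a)
      (e.symm (a : OnePoint ℂ)) where
  apply_zero := by simp
  map_nhds := by
    have h1 : map (fun u : ℂ => a + u) (𝓝 0) = 𝓝 a := by simp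
    have h2 : (fun u : ℂ => e.symm ((a + u : ℂ) : OnePoint ℂ)) =
        e.symm ∘ (fun z : ℂ => (z : OnePoint ℂ)) ∘ fun u => a + u := rfl
    rw [h2, ← map_map, ← map_map, h1, ← OnePoint.nhds_coe_eq, e.symm.map_nhds_eq]
  left_inv := Eventually.of_forall fun u => by simp
  holAt_iff f := by
    rw [holAt_affine_iff he]
    constructor
    · intro h
      refine AnalyticAt.fun_comp_of_eq (g := fun z : ℂ => f (e.symm (z : OnePoint ℂ))) h
        (f := fun u => a + u) (by fun_prop) (by simp)
    · intro h
      have h1 := AnalyticAt.fun_comp_of_eq h (f := fun z : ℂ => z - a) (x := a)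
        (by fun_prop) (by simp)
      simpa using h1

theorem isCoordAt_infty :
    IsCoordAt (fun w : ℂ => e.symm (sphereAtInfty w)) (fun x => (affineCoord e x)⁻¹)
      (e.symm OnePoint.infty) where
  apply_zero := symm_sphereAtInfty_zero
  map_nhds := by
    have h1 : map sphereAtInfty (𝓝[≠] (0 : ℂ)) =
        map (fun z : ℂ => (z : OnePoint ℂ)) (coclosedCompact ℂ) := by
      have h2 : map (fun w : ℂ => w⁻¹) (𝓝[≠] (0 : ℂ)) = coclosedCompact ℂ := by
        rw [coclosedCompact_eq_cocompact, ← Metric.cobounded_eq_cocompact, ← inv_nhdsNE_zero]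
        rfl
      rw [← h2, map_map]
      refine Filter.map_congr ?_
      filter_upwards [self_mem_nhdsWithin] with w hw
      have hw' : w ≠ 0 := hw
      simp [sphereAtInfty, hw']
    have h3 : map sphereAtInfty (𝓝 0) = 𝓝 OnePoint.infty := by
      rw [← nhdsNE_sup_pure, Filter.map_sup, h1, OnePoint.nhds_infty_eq, map_pure]
      simp [sphereAtInfty]
    have h2 : (fun w : ℂ => e.symm (sphereAtInfty w)) = e.symm ∘ sphereAtInfty := rfl
    rw [h2, ← map_map, h3, e.symm.map_nhds_eq]
  left_inv := Eventually.of_forall fun u => by simp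
  holAt_iff f := by
    have h := he (e.symm OnePoint.infty) (f ∘ e.symm)
    rw [e.apply_symm_apply, Function.comp_assoc, e.symm_comp_self] at h
    exact h

theorem neBot_nhdsNE_sphere (x : X) : (𝓝[≠] x).NeBot := by
  obtain ⟨y, rfl⟩ := e.symm.surjective x
  induction y using OnePoint.rec with
  | infty => exact (isCoordAt_infty he).neBot_nhdsNE
  | coe z => exact (isCoordAt_affine he z).neBot_nhdsNE

end Sphere

/-! ### Line bundles on the projective line -/

section SphereBundle

variable {X : Type u} [TopologicalSpace X] [HolSpace X] {e : X ≃ₜ OnePoint ℂ}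

/-- A line bundle of degree `d` on the projective line is `𝒪(d)`: it has a frame `e₀` over the
affine line and a frame `e₁` at infinity with `e₀ = w ^ d • e₁`, where `w` is the coordinate at
infinity.  If `s` is a meromorphic section with divisor `D`, then `e₀` is `s` divided by
`∏ (z - a) ^ D a`, the product over the points `a` of the affine line. -/
theorem ModuleSheaf.IsLineBundle.exists_frames_of_hasDegree [T1Space X]
    (he : ∀ (x : X) (f : OnePoint ℂ → ℂ), HolSpace.HolAt (f ∘ e) x ↔ HolSpace.HolAt f (e x))
    (hX : ∀ x : X, HolSpace.LocalAt x) {M : ModuleSheaf.{u, v} X} (hM : M.IsLineBundle) {d : ℤ}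
    (hd : M.HasDegree d) :
    ∃ e₀ e₁ : ∀ x, M.fiber x, (∀ a : ℂ, M.IsFrameAt e₀ (e.symm (a : OnePoint ℂ))) ∧
      M.IsFrameAt e₁ (e.symm OnePoint.infty) ∧
      ∀ᶠ w in 𝓝[≠] (0 : ℂ), e₀ (e.symm (sphereAtInfty w)) =
        w ^ d • e₁ (e.symm (sphereAtInfty w)) := by
  classical
  obtain ⟨s, D, hs, hD⟩ := hd
  set q : X := e.symm OnePoint.infty with hq
  set T : Finset X := D.support.erase q with hT
  set R : ℂ → ℂ := fun z => ∏ b ∈ T, (z - affineCoord e b) ^ (-D b) with hR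
  set σ : ∀ x, M.fiber x := fun x => R (affineCoord e x) • s x with hσ
  have hTq : ∀ b ∈ T, b ≠ q := fun b hb => Finset.ne_of_mem_erase hb
  -- the punctured germs of `σ` at the points of the affine line extend to frames
  have haff : ∀ a : ℂ, ∃ τ, M.IsFrameAt τ (e.symm (a : OnePoint ℂ)) ∧
      ∀ᶠ y in 𝓝[≠] (e.symm (a : OnePoint ℂ)), σ y = τ y := by
    intro a
    set x : X := e.symm (a : OnePoint ℂ) with hx
    have hc := isCoordAt_affine he a
    obtain ⟨ε, hε, hsε⟩ := hc.exists_frame_of_hasOrderAt (hX x) (hs x)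
    set v : ℂ → ℂ := fun u => ∏ b ∈ T.erase x, (a + u - affineCoord e b) ^ (-D b) with hv
    have hne : ∀ b ∈ T.erase x, a + 0 - affineCoord e b ≠ 0 := by
      intro b hb h0
      have h1 := Finset.ne_of_mem_erase hb
      have h2 := symm_affineCoord (e := e) (hTq b (Finset.mem_of_mem_erase hb))
      rw [add_zero, sub_eq_zero] at h0
      exact h1 (by rw [hx, h0, h2])
    have hva : AnalyticAt ℂ v 0 := by
      refine Finset.analyticAt_fun_prod _ fun b hb => ?_
      exact AnalyticAt.fun_zpow (by fun_prop) (hne b hb)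
    have hv0 : v 0 ≠ 0 := Finset.prod_ne_zero_iff.2 fun b hb => zpow_ne_zero _ (hne b hb)
    refine ⟨fun y => v (affineCoord e y - a) • ε y,
      hε.smul (hc.holAt_comp hva) (hX x) (by simpa [hx] using hv0), ?_⟩
    rw [hc.eventually_nhdsNE_iff]
    filter_upwards [hsε, self_mem_nhdsWithin] with u hu hu0
    have hu0' : u ≠ 0 := hu0
    have hRv : R (a + u) = u ^ (-D x) * v u := by
      by_cases hxT : x ∈ T
      · simp only [hR]
        rw [← Finset.mul_prod_erase _ _ hxT]
        simp [hx, hv]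
      · have hDx : D x = 0 := by
          have hxq : x ≠ q := by simp [hx, hq]
          by_contra h
          exact hxT (Finset.mem_erase.2 ⟨hxq, Finsupp.mem_support_iff.2 h⟩)
        rw [hDx, neg_zero, zpow_zero, one_mul, hR, hv, Finset.erase_eq_of_notMem hxT]
    simp only [hσ, affineCoord_coe, add_sub_cancel_left]
    rw [hu, hRv, smul_smul, mul_right_comm, ← zpow_add₀ hu0', neg_add_cancel, zpow_zero, one_mul]
  -- the punctured germ of `σ` at infinity is `w ^ d` times a frame
  obtain ⟨e₁, he₁, hσ₁⟩ : ∃ e₁, M.IsFrameAt e₁ q ∧ ∀ᶠ w in 𝓝[≠] (0 : ℂ),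
      σ (e.symm (sphereAtInfty w)) = w ^ d • e₁ (e.symm (sphereAtInfty w)) := by
    have hc := isCoordAt_infty he
    obtain ⟨ε, hε, hsε⟩ := hc.exists_frame_of_hasOrderAt (hX q) (hs q)
    set v : ℂ → ℂ := fun w => ∏ b ∈ T, (1 - affineCoord e b * w) ^ (-D b) with hv
    have hva : AnalyticAt ℂ v 0 := by
      refine Finset.analyticAt_fun_prod _ fun b _ => ?_
      exact AnalyticAt.fun_zpow (by fun_prop) (by simp)
    have hv0 : v 0 ≠ 0 := by simp [hv]
    refine ⟨fun y => v (affineCoord e y)⁻¹ • ε y,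
      hε.smul (hc.holAt_comp hva) (hX q) (by simpa [hq] using hv0), ?_⟩
    filter_upwards [hsε, self_mem_nhdsWithin] with w hw hw0
    have hw0' : w ≠ 0 := hw0
    have hsum : ∑ b ∈ T, D b + D q = d := by
      rw [← hD, Finsupp.sum]
      by_cases hqD : q ∈ D.support
      · exact Finset.sum_erase_add _ _ hqD
      · rw [hT, Finset.erase_eq_of_notMem hqD, Finsupp.notMem_support_iff.1 hqD, add_zero]
    have hRv : R w⁻¹ = w ^ (∑ b ∈ T, D b) * v w := by
      have hpow : w ^ (∑ b ∈ T, D b) = ∏ b ∈ T, w ^ D b := by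
        induction T using Finset.induction_on with
        | empty => simp
        | insert b T hb ih => rw [Finset.sum_insert hb, Finset.prod_insert hb, zpow_add₀ hw0', ih]
      rw [hpow, hv, hR, ← Finset.prod_mul_distrib]
      refine Finset.prod_congr rfl fun b _ => ?_
      have : w⁻¹ - affineCoord e b = w⁻¹ * (1 - affineCoord e b * w) := by
        field_simp
      rw [this, mul_zpow, inv_zpow', neg_neg]
    simp only [hσ, affineCoord_sphereAtInfty, inv_inv]
    rw [hw, hRv, smul_smul, smul_smul, mul_right_comm, ← zpow_add₀ hw0', hsum]
  -- the germs on the affine line are the germs of one section `e₀`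
  have hU : IsOpen {q}ᶜ := isOpen_compl_singleton
  have hcoe : ∀ x ∈ ({q}ᶜ : Set X), e.symm ((affineCoord e x : ℂ) : OnePoint ℂ) = x :=
    fun x hx => symm_affineCoord hx
  obtain ⟨e₀, he₀⟩ := hM.exists_extension hX (neBot_nhdsNE_sphere he) hU σ (fun x hx => by
    obtain ⟨τ, hτ, h⟩ := haff (affineCoord e x)
    rw [hcoe x hx] at hτ h
    exact ⟨τ, hτ.holAt, h⟩)
  refine ⟨e₀, e₁, fun a => ?_, he₁, ?_⟩
  · obtain ⟨τ, hτ, h⟩ := haff a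
    have h1 := he₀ _ (by simp [hq]) τ hτ.holAt h
    exact hM.isFrameAt (hX _) ((ModuleSheaf.holAt_congr h1).2 hτ.holAt)
      (by rw [h1.self_of_nhds]; exact hτ.ne_zero)
  · have hc := isCoordAt_infty he
    have h1 : ∀ᶠ y in 𝓝[≠] q, σ y = ((affineCoord e y)⁻¹) ^ d • e₁ y := by
      rw [hc.eventually_nhdsNE_iff]
      filter_upwards [hσ₁] with w hw
      rw [hw, affineCoord_sphereAtInfty, inv_inv]
    have h2 := hc.eventually_nhdsNE_iff.1 (eventually_eventually_nhdsWithin.2 h1)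
    have h3 := hc.eventually_nhdsNE_iff.1 (nhdsWithin_le_nhds he₁.eventually)
    filter_upwards [h2, h3, self_mem_nhdsWithin] with w hw1 hw2 hw3
    have hw0 : w ≠ 0 := hw3
    have hyq : e.symm (sphereAtInfty w) ∈ ({q}ᶜ : Set X) := by
      rw [symm_sphereAtInfty hw0]
      simp [hq]
    rw [isOpen_compl_singleton.nhdsWithin_eq hyq] at hw1
    have h4 : HolSpace.HolAt (fun y : X => ((affineCoord e y)⁻¹) ^ d)
        (e.symm (sphereAtInfty w)) := by
      rw [symm_sphereAtInfty hw0, holAt_affine_iff he]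
      simp only [affineCoord_coe]
      exact (analyticAt_id.inv (inv_ne_zero hw0)).fun_zpow
        (inv_ne_zero (inv_ne_zero hw0))
    have h5 := he₀ _ hyq _ (M.smul h4 hw2.holAt) (nhdsWithin_le_nhds hw1)
    rw [h5.self_of_nhds, affineCoord_sphereAtInfty, inv_inv]

/-- An entire function `g` for which `w ^ n * g (1 / w)` is analytic at `w = 0` is a polynomial of
degree at most `n`, and the value at `w = 0` is its coefficient of degree `n`. -/
theorem exists_polynomial_of_differentiable (n : ℕ) {g h : ℂ → ℂ} (hg : Differentiable ℂ g)
    (hh : AnalyticAt ℂ h 0) (hgh : ∀ᶠ w in 𝓝[≠] (0 : ℂ), g w⁻¹ * w ^ n = h w) :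
    ∃ P : Polynomial ℂ, P ∈ Polynomial.degreeLT ℂ (n + 1) ∧ (∀ z, g z = P.eval z) ∧
      h 0 = P.coeff n := by
  induction n generalizing g h with
  | zero =>
    have h1 : Tendsto g (cocompact ℂ) (𝓝 (h 0)) := by
      have h2 : Tendsto (fun w => g w⁻¹) (𝓝[≠] (0 : ℂ)) (𝓝 (h 0)) := by
        refine (hh.continuousAt.tendsto.mono_left nhdsWithin_le_nhds).congr' ?_
        filter_upwards [hgh] with w hw
        rw [← hw, pow_zero, mul_one]
      rw [← Metric.cobounded_eq_cocompact]
      have h3 := h2.comp tendsto_inv₀_cobounded'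
      simpa [Function.comp_def] using h3
    refine ⟨Polynomial.C (h 0), ?_, fun z => ?_, by simp⟩
    · rw [Polynomial.mem_degreeLT]
      exact Polynomial.degree_C_le.trans_lt (by simp)
    · rw [hg.apply_eq_of_tendsto_cocompact z h1, Polynomial.eval_C]
  | succ n ih =>
    -- `(g z - g 0) / z` is entire with a pole of order at most `n`
    have hg1 : Differentiable ℂ (dslope g 0) := by
      rw [← differentiableOn_univ] at hg ⊢
      exact (Complex.differentiableOn_dslope univ_mem).2 hg
    obtain ⟨P, hP, hgP, hhP⟩ := ih hg1 (h := fun w => h w - g 0 * w ^ (n + 1))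
      (hh.sub (by fun_prop)) (by
        filter_upwards [hgh, self_mem_nhdsWithin] with w hw hw0
        have hw0' : w ≠ 0 := hw0
        rw [← hw, dslope_of_ne _ (inv_ne_zero hw0'), slope_def_field]
        field_simp
        ring)
    refine ⟨Polynomial.C (g 0) + Polynomial.X * P, ?_, fun z => ?_, ?_⟩
    · rw [Polynomial.mem_degreeLT] at hP ⊢
      refine (Polynomial.degree_add_le _ _).trans_lt (max_lt ?_ ?_)
      · exact Polynomial.degree_C_le.trans_lt (by exact_mod_cast Nat.succ_pos _)
      · rw [Polynomial.degree_lt_iff_coeff_zero] at hP ⊢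
        intro m hm
        obtain ⟨m, rfl⟩ : ∃ k, m = k + 1 := ⟨m - 1, by omega⟩
        rw [Polynomial.coeff_X_mul]
        exact hP m (by omega)
    · have := sub_smul_dslope g 0 z
      simp only [sub_zero, smul_eq_mul] at this
      rw [Polynomial.eval_add, Polynomial.eval_C, Polynomial.eval_mul, Polynomial.eval_X, ← hgP,
        this]
      ring
    · simpa [Polynomial.coeff_C] using hhP

/-- A polynomial of degree at most `n` has a pole of order at most `n` at infinity, with leading
coefficient that of degree `n`. -/
theorem analyticAt_eval_inv_mul_pow {n : ℕ} {P : Polynomial ℂ}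
    (hP : P ∈ Polynomial.degreeLT ℂ (n + 1)) :
    ∃ h : ℂ → ℂ, AnalyticAt ℂ h 0 ∧ h 0 = P.coeff n ∧
      ∀ w, w ≠ 0 → P.eval w⁻¹ * w ^ n = h w := by
  have hdeg : P.natDegree ≤ n := by
    rw [Polynomial.mem_degreeLT] at hP
    exact Polynomial.natDegree_le_iff_degree_le.2 (Order.lt_succ_iff.1 (by exact_mod_cast hP))
  refine ⟨fun w => (P.reflect n).eval w, ?_, ?_, fun w hw => ?_⟩
  · exact (Polynomial.differentiable _).analyticAt 0
  · change (P.reflect n).eval 0 = _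
    rw [← Polynomial.coeff_zero_eq_eval_zero, Polynomial.coeff_reflect]
    simp
  · have : Invertible w⁻¹ := invertibleOfNonzero (inv_ne_zero hw)
    have h := Polynomial.eval₂_reflect_mul_pow (RingHom.id ℂ) w⁻¹ n P hdeg
    simp only [invOf_eq_inv, inv_inv] at h
    rw [Polynomial.eval₂_id, Polynomial.eval₂_id] at h
    rw [← h, mul_assoc, ← mul_pow, inv_mul_cancel₀ hw, one_pow, mul_one]

end SphereBundle

/-! ### Sections over the projective line -/

section SphereSections

variable {X : Type u} [TopologicalSpace X] [HolSpace X] {e : X ≃ₜ OnePoint ℂ}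

namespace ModuleSheaf

/-- The values of a global section at two points. -/
def evalPair (M : ModuleSheaf.{u, v} X) (a b : X) :
    M.globalSections →ₗ[ℂ] M.fiber a × M.fiber b :=
  ((LinearMap.proj a).prod (LinearMap.proj b)).comp (Submodule.subtype _)

@[simp] theorem evalPair_apply (M : ModuleSheaf.{u, v} X) (a b : X) (s : M.globalSections) :
    M.evalPair a b s = (s.1 a, s.1 b) := rfl

variable (he : ∀ (x : X) (f : OnePoint ℂ → ℂ), HolSpace.HolAt (f ∘ e) x ↔ HolSpace.HolAt f (e x))
  {M : ModuleSheaf.{u, v} X} (hM : M.IsLineBundle) {d : ℤ} {e₀ e₁ : ∀ x, M.fiber x}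
  (h₀ : ∀ a : ℂ, M.IsFrameAt e₀ (e.symm (a : OnePoint ℂ)))
  (h₁ : M.IsFrameAt e₁ (e.symm OnePoint.infty))
  (h₀₁ : ∀ᶠ w in 𝓝[≠] (0 : ℂ), e₀ (e.symm (sphereAtInfty w)) =
        w ^ d • e₁ (e.symm (sphereAtInfty w)))

include he hM h₀ h₁ h₀₁

/-- A global section of `𝒪(d)` is an entire function `g` such that `w ^ d * g (1 / w)` extends
analytically to a function `h` at `w = 0`. -/
theorem exists_coeff_of_mem_globalSections {s : ∀ x, M.fiber x} (hs : s ∈ M.globalSections) :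
    ∃ g h : ℂ → ℂ, Differentiable ℂ g ∧ AnalyticAt ℂ h 0 ∧
      (∀ z : ℂ, s (e.symm z) = g z • e₀ (e.symm z)) ∧
      s (e.symm OnePoint.infty) = h 0 • e₁ (e.symm OnePoint.infty) ∧
      ∀ᶠ w in 𝓝[≠] (0 : ℂ), g w⁻¹ * w ^ d = h w := by
  obtain ⟨γ, hγ⟩ := hM.exists_coeff e₀ s
  obtain ⟨η, hη⟩ := hM.exists_coeff e₁ s
  have hc := isCoordAt_infty he
  have hη1 : HolSpace.HolAt η (e.symm OnePoint.infty) :=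
    (h₁.holAt_iff (h₁.eventually_ne_zero.mono fun y hy => hη y hy)).1 (hs _)
  refine ⟨fun z => γ (e.symm z), fun w => η (e.symm (sphereAtInfty w)), fun z => ?_,
    (hc.holAt_iff η).1 hη1, fun z => hγ _ (h₀ z).ne_zero, ?_, ?_⟩
  · exact ((holAt_affine_iff he γ z).1 (((h₀ z).holAt_iff
      ((h₀ z).eventually_ne_zero.mono fun y hy => hγ y hy)).1 (hs _))).differentiableAt
  · beta_reduce
    rw [symm_sphereAtInfty_zero]
    exact hη _ h₁.ne_zero
  · filter_upwards [h₀₁, nhdsWithin_le_nhds (hc.eventually_iff.1 h₁.eventually_ne_zero),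
      self_mem_nhdsWithin] with w hw hw1 hw0
    have hw0' : w ≠ 0 := hw0
    refine smul_left_injective ℂ hw1 ?_
    change (γ (e.symm ((w⁻¹ : ℂ) : OnePoint ℂ)) * w ^ d) • e₁ (e.symm (sphereAtInfty w)) =
      η (e.symm (sphereAtInfty w)) • e₁ (e.symm (sphereAtInfty w))
    have h2 := hγ _ (h₀ w⁻¹).ne_zero
    rw [← symm_sphereAtInfty hw0'] at h2 ⊢
    rw [mul_smul, ← hw, ← h2, ← hη _ hw1]

theorem eq_zero_of_degree_neg (hd : d < 0) {s : ∀ x, M.fiber x} (hs : s ∈ M.globalSections) :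
    s = 0 := by
  obtain ⟨g, h, hg, hh, hsg, hsh, hgh⟩ :=
    exists_coeff_of_mem_globalSections he hM h₀ h₁ h₀₁ hs
  obtain ⟨n, hn⟩ : ∃ n : ℕ, d = -((n : ℤ) + 1) := ⟨(-d - 1).toNat, by omega⟩
  -- `g` extends to infinity with the value `0`, so it is the constant `0`
  have h1 : ∀ᶠ w in 𝓝[≠] (0 : ℂ), g w⁻¹ * w ^ 0 = h w * w ^ (n + 1) := by
    filter_upwards [hgh, self_mem_nhdsWithin] with w hw hw0
    have hw0' : w ≠ 0 := hw0
    rw [← hw, hn, pow_zero, mul_one, zpow_neg, mul_assoc]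
    norm_cast
    rw [inv_mul_cancel₀ (pow_ne_zero _ hw0'), mul_one]
  obtain ⟨P, hP, hgP, hP0⟩ := exists_polynomial_of_differentiable 0 hg
    (h := fun w => h w * w ^ (n + 1)) (hh.mul (by fun_prop)) h1
  have hg0 : ∀ z, g z = 0 := by
    intro z
    rw [hgP, Polynomial.eq_C_of_degree_le_zero (p := P), ← hP0]
    · simp
    · rw [Polynomial.mem_degreeLT] at hP
      exact Order.lt_succ_iff.1 (by exact_mod_cast hP)
  have hh0 : h 0 = 0 := by
    refine tendsto_nhds_unique_of_eventuallyEq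
      (hh.continuousAt.tendsto.mono_left nhdsWithin_le_nhds)
      (tendsto_const_nhds (x := (0 : ℂ)) (f := 𝓝[≠] (0 : ℂ))) ?_
    filter_upwards [hgh] with w hw
    rw [← hw, hg0, zero_mul]
  funext x
  obtain ⟨y, rfl⟩ := e.symm.surjective x
  induction y using OnePoint.rec with
  | infty => rw [hsh, hh0, zero_smul]; rfl
  | coe z => rw [hsg, hg0, zero_smul]; rfl

end ModuleSheaf

end SphereSections

section SphereSectionsNat

variable {X : Type u} [TopologicalSpace X] [HolSpace X] {e : X ≃ₜ OnePoint ℂ}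

namespace ModuleSheaf

open Classical in
/-- The section of `𝒪(n)` given by a polynomial of degree at most `n`, in terms of the frames `e₀`
over the affine line and `e₁` at infinity; it has a meaning for all polynomials, but is holomorphic
at infinity only for those of degree at most `n`. -/
noncomputable def polySection {M : ModuleSheaf.{u, v} X} (e : X ≃ₜ OnePoint ℂ)
    (e₀ e₁ : ∀ x, M.fiber x) (n : ℕ) : Polynomial ℂ →ₗ[ℂ] (∀ x, M.fiber x) where
  toFun P x := if x = e.symm OnePoint.infty then P.coeff n • e₁ x
    else P.eval (affineCoord e x) • e₀ x
  map_add' P Q := by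
    funext x
    simp only [Pi.add_apply]
    split_ifs
    · rw [Polynomial.coeff_add, add_smul]
    · rw [Polynomial.eval_add, add_smul]
  map_smul' c P := by
    funext x
    simp only [Pi.smul_apply, RingHom.id_apply]
    split_ifs
    · rw [Polynomial.coeff_smul, smul_eq_mul, mul_smul]
    · rw [Polynomial.eval_smul, smul_eq_mul, mul_smul]

variable {M : ModuleSheaf.{u, v} X} {e₀ e₁ : ∀ x, M.fiber x} {n : ℕ}

@[simp] theorem polySection_infty (P : Polynomial ℂ) :
    polySection e e₀ e₁ n P (e.symm OnePoint.infty) =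
      P.coeff n • e₁ (e.symm OnePoint.infty) := by
  simp [polySection]

@[simp] theorem polySection_coe (P : Polynomial ℂ) (z : ℂ) :
    polySection e e₀ e₁ n P (e.symm (z : OnePoint ℂ)) =
      P.eval z • e₀ (e.symm (z : OnePoint ℂ)) := by
  simp [polySection]

variable [T1Space X]
  (he : ∀ (x : X) (f : OnePoint ℂ → ℂ), HolSpace.HolAt (f ∘ e) x ↔ HolSpace.HolAt f (e x))
  (hM : M.IsLineBundle)
  (h₀ : ∀ a : ℂ, M.IsFrameAt e₀ (e.symm (a : OnePoint ℂ)))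
  (h₁ : M.IsFrameAt e₁ (e.symm OnePoint.infty))
  (h₀₁ : ∀ᶠ w in 𝓝[≠] (0 : ℂ), e₀ (e.symm (sphereAtInfty w)) =
        w ^ (n : ℤ) • e₁ (e.symm (sphereAtInfty w)))

include he h₀ h₁ h₀₁

theorem polySection_mem {P : Polynomial ℂ} (hP : P ∈ Polynomial.degreeLT ℂ (n + 1)) :
    polySection e e₀ e₁ n P ∈ M.globalSections := by
  intro x
  obtain ⟨y, rfl⟩ := e.symm.surjective x
  induction y using OnePoint.rec with
  | infty =>
    obtain ⟨h, hh, hh0, hPh⟩ := analyticAt_eval_inv_mul_pow hP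
    have hc := isCoordAt_infty he
    refine (h₁.holAt_iff ?_).2 (hc.holAt_comp hh)
    have h3 : ∀ᶠ y in 𝓝[≠] (e.symm OnePoint.infty : X),
        polySection e e₀ e₁ n P y = h (affineCoord e y)⁻¹ • e₁ y := by
      rw [hc.eventually_nhdsNE_iff]
      filter_upwards [h₀₁, self_mem_nhdsWithin] with w hw hw0
      have hw0' : w ≠ 0 := hw0
      rw [affineCoord_sphereAtInfty, inv_inv, ← hPh w hw0', mul_smul]
      rw [zpow_natCast] at hw
      rw [← hw, symm_sphereAtInfty hw0', polySection_coe]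
    filter_upwards [eventually_nhdsWithin_iff.1 h3] with y hy
    by_cases hyq : y = e.symm OnePoint.infty
    · subst hyq
      simp [hh0]
    · exact hy hyq
  | coe z =>
    have h3 : HolSpace.HolAt (fun x => P.eval (affineCoord e x)) (e.symm (z : OnePoint ℂ)) := by
      rw [holAt_affine_iff he]
      simp only [affineCoord_coe]
      exact (Polynomial.differentiable _).analyticAt z
    refine ((h₀ z).holAt_iff ?_).2 h3
    filter_upwards [isOpen_compl_singleton.mem_nhds
      (show e.symm (z : OnePoint ℂ) ∈ ({e.symm OnePoint.infty}ᶜ : Set X) by simp)] with y hy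
    simp only [polySection, LinearMap.coe_mk, AddHom.coe_mk]
    exact if_neg hy

include hM

omit [T1Space X] in
theorem exists_polySection_eq {s : ∀ x, M.fiber x} (hs : s ∈ M.globalSections) :
    ∃ P ∈ Polynomial.degreeLT ℂ (n + 1), polySection e e₀ e₁ n P = s := by
  obtain ⟨g, h, hg, hh, hsg, hsh, hgh⟩ :=
    exists_coeff_of_mem_globalSections he hM h₀ h₁ h₀₁ hs
  simp only [zpow_natCast] at hgh
  obtain ⟨P, hP, hgP, hP0⟩ := exists_polynomial_of_differentiable n hg hh hgh
  refine ⟨P, hP, ?_⟩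
  funext x
  obtain ⟨y, rfl⟩ := e.symm.surjective x
  induction y using OnePoint.rec with
  | infty => rw [hsh, polySection_infty, hP0]
  | coe z => rw [hsg, polySection_coe, hgP]

/-- The sections of `𝒪(n)` on the projective line are the polynomials of degree at most `n`. -/
theorem nonempty_linearEquiv_degreeLT :
    Nonempty (Polynomial.degreeLT ℂ (n + 1) ≃ₗ[ℂ] M.globalSections) := by
  let Ψ : Polynomial.degreeLT ℂ (n + 1) →ₗ[ℂ] M.globalSections :=
    ((polySection e e₀ e₁ n).comp (Submodule.subtype _)).codRestrict _
      fun P => polySection_mem he h₀ h₁ h₀₁ P.2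
  have hinj : Function.Injective Ψ := by
    rw [← LinearMap.ker_eq_bot, LinearMap.ker_eq_bot']
    intro P hP
    refine Subtype.ext (Polynomial.funext fun z => ?_)
    have h1 : polySection e e₀ e₁ n P.1 (e.symm (z : OnePoint ℂ)) = 0 :=
      congrFun (congrArg Subtype.val hP) _
    rw [polySection_coe] at h1
    simpa using (smul_eq_zero.1 h1).resolve_right (h₀ z).ne_zero
  have hsurj : Function.Surjective Ψ := by
    rintro ⟨s, hs⟩
    obtain ⟨P, hP, h⟩ := exists_polySection_eq he hM h₀ h₁ h₀₁ hs
    exact ⟨⟨P, hP⟩, Subtype.ext h⟩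
  exact ⟨LinearEquiv.ofBijective Ψ ⟨hinj, hsurj⟩⟩

omit hM in
theorem exists_section_eq_zero_ne_zero (hn : 0 < n) {a b : X} (hab : a ≠ b) :
    ∃ s ∈ M.globalSections, s a = 0 ∧ s b ≠ 0 := by
  obtain ⟨a, rfl⟩ := e.symm.surjective a
  obtain ⟨b, rfl⟩ := e.symm.surjective b
  have mem : ∀ P : Polynomial ℂ, P.natDegree ≤ n →
      polySection e e₀ e₁ n P ∈ M.globalSections := by
    intro P hP
    refine polySection_mem he h₀ h₁ h₀₁ (Polynomial.mem_degreeLT.2 ?_)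
    exact (Polynomial.natDegree_le_iff_degree_le.1 hP).trans_lt
      (by exact_mod_cast Nat.lt_succ_self n)
  induction a using OnePoint.rec with
  | infty =>
    induction b using OnePoint.rec with
    | infty => exact absurd rfl hab
    | coe b =>
      refine ⟨_, mem 1 (by simp), ?_, ?_⟩
      · rw [polySection_infty, Polynomial.coeff_one, if_neg hn.ne', zero_smul]
      · rw [polySection_coe, Polynomial.eval_one, one_smul]
        exact (h₀ b).ne_zero
  | coe a =>
    induction b using OnePoint.rec with
    | infty =>
      obtain ⟨m, rfl⟩ : ∃ m, n = m + 1 := ⟨n - 1, by omega⟩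
      refine ⟨_, mem (Polynomial.X ^ m * (Polynomial.X - Polynomial.C a)) ?_, ?_, ?_⟩
      · refine Polynomial.natDegree_mul_le.trans ?_
        rw [Polynomial.natDegree_X_pow, Polynomial.natDegree_X_sub_C]
      · simp
      · rw [polySection_infty, mul_sub, ← pow_succ, Polynomial.coeff_sub, Polynomial.coeff_X_pow,
          if_pos rfl, Polynomial.coeff_mul_C, Polynomial.coeff_X_pow, if_neg (by omega), zero_mul,
          sub_zero, one_smul]
        exact h₁.ne_zero
    | coe b =>
      refine ⟨_, mem (Polynomial.X - Polynomial.C a) ?_, ?_, ?_⟩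
      · rw [Polynomial.natDegree_X_sub_C]
        exact hn
      · simp
      · rw [polySection_coe]
        refine smul_ne_zero ?_ (h₀ b).ne_zero
        simp only [Polynomial.eval_sub, Polynomial.eval_X, Polynomial.eval_C, sub_ne_zero]
        rintro rfl
        exact hab rfl

theorem evalPair_surjective (hn : 0 < n) {a b : X} (hab : a ≠ b) :
    Function.Surjective (M.evalPair a b) := by
  obtain ⟨s, hs, hsa, hsb⟩ := exists_section_eq_zero_ne_zero he h₀ h₁ h₀₁ hn hab
  obtain ⟨t, ht, htb, hta⟩ := exists_section_eq_zero_ne_zero he h₀ h₁ h₀₁ hn hab.symm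
  rintro ⟨x, y⟩
  obtain ⟨c, hc⟩ := (finrank_eq_one_iff_of_nonzero' (t a) hta).1 (hM.1 a) x
  obtain ⟨c', hc'⟩ := (finrank_eq_one_iff_of_nonzero' (s b) hsb).1 (hM.1 b) y
  refine ⟨c • ⟨t, ht⟩ + c' • ⟨s, hs⟩, ?_⟩
  simp [hsa, htb, hc, hc']

/-- The sections of `𝒪(n)` that vanish at two points form a space of dimension `n - 1`. -/
theorem rank_ker_evalPair (hn : 0 < n) {a b : X} (hab : a ≠ b) :
    Module.rank ℂ (LinearMap.ker (M.evalPair a b)) = ((n - 1 : ℕ) : Cardinal) := by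
  obtain ⟨Φ⟩ := nonempty_linearEquiv_degreeLT he hM h₀ h₁ h₀₁
  let E := (Polynomial.degreeLTEquiv ℂ (n + 1)).symm.trans Φ
  have : Module.Finite ℂ M.globalSections := Module.Finite.equiv E
  have hfin : Module.finrank ℂ M.globalSections = n + 1 := by
    rw [← E.finrank_eq, Module.finrank_fin_fun]
  have hfa : Module.Finite ℂ (M.fiber a) := Module.finite_of_finrank_eq_succ (hM.1 a)
  have hfb : Module.Finite ℂ (M.fiber b) := Module.finite_of_finrank_eq_succ (hM.1 b)
  have h := LinearMap.finrank_range_add_finrank_ker (M.evalPair a b)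
  rw [LinearMap.range_eq_top.2 (evalPair_surjective he hM h₀ h₁ h₀₁ hn hab), finrank_top,
    Module.finrank_prod, hM.1, hM.1, hfin] at h
  rw [← Module.finrank_eq_rank]
  congr 1
  omega

omit h₀₁ in
/-- A line bundle of degree `0` on the projective line is trivial, and its sections are the constant
multiples of a global frame. -/
theorem exists_global_frame (h₀₁ : ∀ᶠ w in 𝓝[≠] (0 : ℂ), e₀ (e.symm (sphereAtInfty w)) =
        w ^ (0 : ℤ) • e₁ (e.symm (sphereAtInfty w))) :
    ∃ ε ∈ M.globalSections, (∀ x, ε x ≠ 0) ∧ ∀ s ∈ M.globalSections, ∃ c : ℂ, s = c • ε := by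
  have h₀₁' : ∀ᶠ w in 𝓝[≠] (0 : ℂ), e₀ (e.symm (sphereAtInfty w)) =
        w ^ ((0 : ℕ) : ℤ) • e₁ (e.symm (sphereAtInfty w)) := h₀₁
  refine ⟨polySection e e₀ e₁ 0 1, polySection_mem he h₀ h₁ h₀₁'
    (Polynomial.mem_degreeLT.2 (by simp)), fun x => ?_, fun s hs => ?_⟩
  · obtain ⟨y, rfl⟩ := e.symm.surjective x
    induction y using OnePoint.rec with
    | infty => simpa using h₁.ne_zero
    | coe z => simpa using (h₀ z).ne_zero
  · obtain ⟨P, hP, rfl⟩ := exists_polySection_eq he hM h₀ h₁ h₀₁' hs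
    have h1 : P = P.coeff 0 • 1 := by
      rw [Polynomial.mem_degreeLT] at hP
      rw [← Polynomial.C_mul', mul_one]
      exact Polynomial.eq_C_of_degree_le_zero (Order.lt_succ_iff.1 (by exact_mod_cast hP))
    exact ⟨P.coeff 0, by rw [← map_smul, ← h1]⟩

end ModuleSheaf

end SphereSectionsNat

/-! ### Closed subsets that pass through nodes along one branch -/

section Branch

variable {X : Type u} [TopologicalSpace X] [HolSpace X] {K : Set X} {p : X}
  {φ : OpenPartialHomeomorph X nodeModel}

/-- The chart `φ` at the node `p` takes the set `K` to the first axis. -/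
structure IsBranchChart (K : Set X) (φ : OpenPartialHomeomorph X nodeModel) (p : X) : Prop where
  mem_source : p ∈ φ.source
  map_eq : φ p = nodeOrigin
  isBiholChart : IsBiholChart φ
  mem_iff : ∀ x ∈ φ.source, x ∈ K ↔ (φ x).1.2 = 0

namespace IsBranchChart

theorem origin_mem_target (h : IsBranchChart K φ p) : nodeOrigin ∈ φ.target :=
  h.map_eq ▸ φ.map_source h.mem_source

theorem symm_origin (h : IsBranchChart K φ p) : φ.symm nodeOrigin = p := by
  rw [← h.map_eq, φ.left_inv h.mem_source]

theorem symm_axis₁_mem (h : IsBranchChart K φ p) {u : ℂ} (hu : nodeAxis₁ u ∈ φ.target) :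
    φ.symm (nodeAxis₁ u) ∈ K := by
  rw [h.mem_iff _ (φ.map_target hu), φ.right_inv hu, nodeAxis₁_snd]

theorem symm_axis₂_notMem (h : IsBranchChart K φ p) {u : ℂ} (hu : nodeAxis₂ u ∈ φ.target)
    (h0 : u ≠ 0) : φ.symm (nodeAxis₂ u) ∉ K := by
  rwa [h.mem_iff _ (φ.map_target hu), φ.right_inv hu, nodeAxis₂_snd]

theorem eventually_axis₁_mem (h : IsBranchChart K φ p) : ∀ᶠ u in 𝓝 (0 : ℂ),
    nodeAxis₁ u ∈ φ.target :=
  continuous_nodeAxis₁.continuousAt.eventually (φ.open_target.mem_nhds h.origin_mem_target)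

theorem eventually_axis₂_mem (h : IsBranchChart K φ p) : ∀ᶠ u in 𝓝 (0 : ℂ),
    nodeAxis₂ u ∈ φ.target :=
  continuous_nodeAxis₂.continuousAt.eventually (φ.open_target.mem_nhds h.origin_mem_target)

theorem tendsto_symm_axis₁ (h : IsBranchChart K φ p) :
    Tendsto (fun u => φ.symm (nodeAxis₁ u)) (𝓝 0) (𝓝[K] p) := by
  refine tendsto_nhdsWithin_iff.2 ⟨?_, h.eventually_axis₁_mem.mono fun u hu => h.symm_axis₁_mem hu⟩
  have h1 : Tendsto φ.symm (𝓝 nodeOrigin) (𝓝 p) := by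
    have := φ.symm.continuousAt (x := nodeOrigin) h.origin_mem_target
    rwa [ContinuousAt, h.symm_origin] at this
  exact h1.comp (continuous_nodeAxis₁.tendsto 0)

theorem tendsto_symm_axis₂_nhds (h : IsBranchChart K φ p) :
    Tendsto (fun u => φ.symm (nodeAxis₂ u)) (𝓝 0) (𝓝 p) := by
  have h1 : Tendsto φ.symm (𝓝 nodeOrigin) (𝓝 p) := by
    have := φ.symm.continuousAt (x := nodeOrigin) h.origin_mem_target
    rwa [ContinuousAt, h.symm_origin] at this
  exact h1.comp (continuous_nodeAxis₂.tendsto 0)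

theorem self_mem (h : IsBranchChart K φ p) : p ∈ K := by
  rw [h.mem_iff p h.mem_source, h.map_eq]
  rfl

theorem self_mem_closure_compl (h : IsBranchChart K φ p) : p ∈ closure Kᶜ := by
  refine mem_closure_of_tendsto (b := 𝓝[≠] (0 : ℂ))
    (h.tendsto_symm_axis₂_nhds.mono_left nhdsWithin_le_nhds) ?_
  filter_upwards [nhdsWithin_le_nhds h.eventually_axis₂_mem, self_mem_nhdsWithin] with u hu h0
  exact h.symm_axis₂_notMem hu h0

theorem mem_closure_compl_iff (h : IsBranchChart K φ p) {x : X} (hx : x ∈ φ.source) :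
    x ∈ closure Kᶜ ↔ (φ x).1.1 = 0 := by
  constructor
  · intro hxZ
    by_contra h0
    have c1 : Continuous fun x : nodeModel => x.1.1 := by fun_prop
    obtain ⟨y, ⟨hy1, hy2⟩, hyK⟩ := mem_closure_iff.1 hxZ _
      (φ.isOpen_inter_preimage (isOpen_ne.preimage c1)) ⟨hx, h0⟩
    exact hyK ((h.mem_iff y hy1).2
      ((mul_eq_zero.1 (nodeModel_mul_eq_zero (φ y))).resolve_left hy2))
  · intro h0
    by_cases h1 : (φ x).1.2 = 0
    · have h2 : x = p := φ.injOn hx h.mem_source (by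
        rw [h.map_eq, eq_nodeOrigin_iff]
        exact ⟨h0, h1⟩)
      exact h2 ▸ h.self_mem_closure_compl
    · exact subset_closure fun hxK => h1 ((h.mem_iff x hx).1 hxK)

theorem tendsto_symm_axis₂ (h : IsBranchChart K φ p) :
    Tendsto (fun u => φ.symm (nodeAxis₂ u)) (𝓝 0) (𝓝[closure Kᶜ] p) := by
  refine tendsto_nhdsWithin_iff.2 ⟨h.tendsto_symm_axis₂_nhds,
    h.eventually_axis₂_mem.mono fun u hu => ?_⟩
  rw [h.mem_closure_compl_iff (φ.map_target hu), φ.right_inv hu, nodeAxis₂_fst]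

/-- A function whose restrictions to the two branches at a node are holomorphic is holomorphic. -/
theorem holAt (h : IsBranchChart K φ p) {f : X → ℂ}
    (h1 : HolSpace.HolAt (fun y : K => f y) ⟨p, h.self_mem⟩)
    (h2 : HolSpace.HolAt (fun y : ↥(closure Kᶜ) => f y) ⟨p, h.self_mem_closure_compl⟩) :
    HolSpace.HolAt f p := by
  obtain ⟨F, hF, hfF⟩ := h1
  obtain ⟨G, hG, hfG⟩ := h2
  rw [h.isBiholChart.holAt_iff h.mem_source, h.map_eq] at hF hG ⊢
  refine holAt_nodeOrigin ?_ ?_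
  · refine (analyticAt_nodeAxis₁ hF).congr ?_
    filter_upwards [h.tendsto_symm_axis₁.eventually
      ((eventually_nhds_subtype_iff K ⟨p, h.self_mem⟩ (fun y => f y = F y)).1 hfF)] with u hu
    exact hu.symm
  · refine (analyticAt_nodeAxis₂ hG).congr ?_
    filter_upwards [h.tendsto_symm_axis₂.eventually ((eventually_nhds_subtype_iff (closure Kᶜ)
      ⟨p, h.self_mem_closure_compl⟩ (fun y => f y = G y)).1 hfG)] with u hu
    exact hu.symm

/-- The closure of the complement of `K` is the other branch; it is smooth at the node. -/
theorem isSmoothPoint_closure_compl (h : IsBranchChart K φ p) :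
    IsSmoothPoint (⟨p, h.self_mem_closure_compl⟩ : ↥(closure Kᶜ)) := by
  have hax : ∀ z : ↥(closure Kᶜ), z.1 ∈ φ.source → φ z.1 = nodeAxis₂ (φ z.1).1.2 := fun z hz =>
    eq_nodeAxis₂ ((h.mem_closure_compl_iff hz).1 z.2)
  have c2 : Continuous fun x : nodeModel => x.1.2 := by fun_prop
  have hmain := exists_isBiholChart (X := ↥(closure Kᶜ)) (Y := ℂ)
    (U := Subtype.val ⁻¹' φ.source) (f := fun z => (φ z.1).1.2)
    (φ.open_source.preimage continuous_subtype_val)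
    ⟨⟨p, h.self_mem_closure_compl⟩, h.mem_source⟩
    (c2.comp_continuousOn (φ.continuousOn.comp continuous_subtype_val.continuousOn
      fun z hz => hz))
  obtain ⟨ψ, hψs, -, hψ⟩ := hmain (by
    intro z hz z' hz' hzz'
    refine Subtype.ext (φ.injOn hz hz' ?_)
    rw [hax z hz, hax z' hz']
    exact congrArg nodeAxis₂ hzz') (by
    intro W hW hWo
    obtain ⟨W', hW', rfl⟩ := isOpen_induced_iff.1 hWo
    have himg : (fun z : ↥(closure Kᶜ) => (φ z.1).1.2) '' (Subtype.val ⁻¹' W') =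
        nodeAxis₂ ⁻¹' (φ.target ∩ φ.symm ⁻¹' W') := by
      ext u
      constructor
      · rintro ⟨z, hz, rfl⟩
        have hzs : z.1 ∈ φ.source := hW hz
        simp only [Set.mem_preimage, ← hax z hzs]
        exact ⟨φ.map_source hzs, by simpa [φ.left_inv hzs] using hz⟩
      · rintro ⟨hu, huW⟩
        refine ⟨⟨φ.symm (nodeAxis₂ u), ?_⟩, huW, ?_⟩
        · rw [h.mem_closure_compl_iff (φ.map_target hu), φ.right_inv hu, nodeAxis₂_fst]
        · simp [φ.right_inv hu]
    rw [himg]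
    exact (φ.isOpen_inter_preimage_symm hW').preimage continuous_nodeAxis₂) (by
    intro z hz g
    have hzs : z.1 ∈ φ.source := hz
    constructor
    · rintro ⟨F, hF, hgF⟩
      rw [h.isBiholChart.holAt_iff hzs, hax z hzs] at hF
      refine (analyticAt_nodeAxis₂ hF).congr ?_
      have hz' : nodeAxis₂ (φ z.1).1.2 ∈ φ.target := hax z hzs ▸ φ.map_source hzs
      have ht : Tendsto (fun u => φ.symm (nodeAxis₂ u)) (𝓝 (φ z.1).1.2)
          (𝓝[closure Kᶜ] z.1) := by
        refine tendsto_nhdsWithin_iff.2 ⟨?_, ?_⟩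
        · have h1 := (φ.symm.continuousAt (x := nodeAxis₂ (φ z.1).1.2) hz').tendsto
          rw [← hax z hzs, φ.left_inv hzs] at h1
          have h2 := continuous_nodeAxis₂.tendsto (φ z.1).1.2
          rw [← hax z hzs] at h2
          exact h1.comp h2
        · filter_upwards [continuous_nodeAxis₂.continuousAt.eventually
            (φ.open_target.mem_nhds hz')] with u hu
          rw [h.mem_closure_compl_iff (φ.map_target hu), φ.right_inv hu, nodeAxis₂_fst]
      filter_upwards [ht.eventually ((eventually_nhds_subtype_iff (closure Kᶜ) z
          (fun y => g (φ y).1.2 = F y)).1 hgF), continuous_nodeAxis₂.continuousAt.eventually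
            (φ.open_target.mem_nhds hz')] with u hu hut
      rw [φ.right_inv hut] at hu
      exact hu.symm
    · intro hg
      refine holAt_restrict (f := fun x : X => g (φ x).1.2) ?_
      exact (h.isBiholChart z.1 hzs (fun y => g y.1.2)).2 (holAt_comp_snd hg))
  exact ⟨ψ, hψs ▸ h.mem_source, hψ⟩

end IsBranchChart

/-- A punctured disc is the image of a half plane under the exponential map. -/
theorem isPreconnected_punctured_disc (r : ℝ) :
    IsPreconnected {z : ℂ | z ≠ 0 ∧ ‖z‖ < r} := by
  have h : {z : ℂ | z ≠ 0 ∧ ‖z‖ < r} = Complex.exp '' {z : ℂ | Real.exp z.re < r} := by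
    ext z
    simp only [Set.mem_ofPred_eq, Set.mem_image]
    constructor
    · rintro ⟨h0, hr⟩
      refine ⟨Complex.log z, ?_, Complex.exp_log h0⟩
      rwa [← Complex.norm_exp, Complex.exp_log h0]
    · rintro ⟨w, hw, rfl⟩
      exact ⟨Complex.exp_ne_zero w, by rwa [Complex.norm_exp]⟩
  rw [h]
  refine IsPreconnected.image ?_ _ Complex.continuous_exp.continuousOn
  rcases le_or_gt r 0 with hr | hr
  · have : {z : ℂ | Real.exp z.re < r} = ∅ := by
      ext z
      simp only [Set.mem_ofPred_eq, Set.mem_empty_iff_false, iff_false, not_lt]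
      exact hr.trans (Real.exp_pos _).le
    rw [this]
    exact isPreconnected_empty
  · have : {z : ℂ | Real.exp z.re < r} = {z : ℂ | z.re < Real.log r} := by
      ext z
      exact (Real.lt_log_iff_exp_lt hr).symm
    rw [this]
    exact (convex_halfSpace_re_lt _).isPreconnected

/-- A closed set `K` that has the node `p` as an isolated point of its boundary, but not as an
isolated point, is near `p` one of the two branches: its trace on each punctured branch is open and
closed, hence empty or everything. -/
theorem exists_isBranchChart (hK : IsClosed K) (hp : IsNode p) (hpZ : p ∈ closure Kᶜ)
    (hacc : AccPt p (𝓟 K)) {U : Set X} (hU : IsOpen U) (hpU : p ∈ U)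
    (hUK : ∀ x ∈ U, x ∈ K → x ∈ closure Kᶜ → x = p) :
    ∃ φ : OpenPartialHomeomorph X nodeModel, IsBranchChart K φ p ∧ φ.source ⊆ U := by
  have hpK : p ∈ K := hK.closure_eq ▸ hacc.clusterPt.mem_closure
  obtain ⟨φ₀, hp₀, h0, hφ₀⟩ := hp
  have h0' : nodeOrigin ∈ φ₀.target ∩ φ₀.symm ⁻¹' U :=
    ⟨h0 ▸ φ₀.map_source hp₀, by rw [← h0, Set.mem_preimage, φ₀.left_inv hp₀]; exact hpU⟩
  have hV : IsOpen (φ₀.target ∩ φ₀.symm ⁻¹' U) := φ₀.isOpen_inter_preimage_symm hU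
  obtain ⟨r₁, hr₁, h₁⟩ := Metric.mem_nhds_iff.1
    ((hV.preimage continuous_nodeAxis₁).mem_nhds (x := 0) h0')
  obtain ⟨r₂, hr₂, h₂⟩ := Metric.mem_nhds_iff.1
    ((hV.preimage continuous_nodeAxis₂).mem_nhds (x := 0) h0')
  set r := min r₁ r₂ with hr
  have hr0 : 0 < r := lt_min hr₁ hr₂
  have hax₁ : ∀ z : ℂ, ‖z‖ < r → nodeAxis₁ z ∈ φ₀.target ∩ φ₀.symm ⁻¹' U := fun z hz =>
    h₁ (mem_ball_zero_iff.2 (hz.trans_le (min_le_left _ _)))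
  have hax₂ : ∀ z : ℂ, ‖z‖ < r → nodeAxis₂ z ∈ φ₀.target ∩ φ₀.symm ⁻¹' U := fun z hz =>
    h₂ (mem_ball_zero_iff.2 (hz.trans_le (min_le_right _ _)))
  have c1 : Continuous fun x : nodeModel => ‖x.1.1‖ := by fun_prop
  have c2 : Continuous fun x : nodeModel => ‖x.1.2‖ := by fun_prop
  set B : Set nodeModel := {x | ‖x.1.1‖ < r} ∩ {x | ‖x.1.2‖ < r} with hB
  have hBo : IsOpen B := (isOpen_lt c1 continuous_const).inter (isOpen_lt c2 continuous_const)
  set φ := φ₀.restrOpen _ (φ₀.isOpen_inter_preimage hBo) with hφ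
  have hsrc : ∀ x, x ∈ φ.source ↔ x ∈ φ₀.source ∧ φ₀ x ∈ B := by
    intro x
    rw [hφ, OpenPartialHomeomorph.restrOpen_source]
    exact ⟨fun h => h.2, fun h => ⟨h.1, h⟩⟩
  have hφx : ∀ x, φ x = φ₀ x := fun _ => rfl
  have hφb : IsBiholChart φ := hφ₀.restrOpen _
  have hps : p ∈ φ.source := (hsrc p).2 ⟨hp₀, by rw [h0]; exact ⟨by simpa [nodeOrigin] using hr0,
    by simpa [nodeOrigin] using hr0⟩⟩
  have hsU : φ.source ⊆ U := by
    intro x hx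
    obtain ⟨hx0, hxB⟩ := (hsrc x).1 hx
    rw [← φ₀.left_inv hx0]
    rcases nodeModel_cases (φ₀ x) with h | h
    · rw [h]; exact (hax₁ _ hxB.1).2
    · rw [h]; exact (hax₂ _ hxB.2).2
  -- the trace of `K` on a punctured branch is empty or everything
  have key : ∀ ax : ℂ → nodeModel, Continuous ax → (∀ z, ax z = nodeOrigin → z = 0) →
      (∀ z, ‖z‖ < r → ax z ∈ φ₀.target ∩ φ₀.symm ⁻¹' U) →
      (∀ z, z ≠ 0 → ‖z‖ < r → φ₀.symm (ax z) ∈ K) ∨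
        ∀ z, z ≠ 0 → ‖z‖ < r → φ₀.symm (ax z) ∉ K := by
    intro ax hc hax0 hax
    have hpre : IsPreconnected ((fun z => φ₀.symm (ax z)) '' {z : ℂ | z ≠ 0 ∧ ‖z‖ < r}) :=
      (isPreconnected_punctured_disc r).image _
        (φ₀.symm.continuousOn.comp hc.continuousOn fun z hz => (hax z hz.2).1)
    have hdisj : Disjoint (closure Kᶜ)ᶜ Kᶜ :=
      Set.disjoint_left.2 fun x hx hx' => hx (subset_closure hx')
    have hcov : (fun z => φ₀.symm (ax z)) '' {z : ℂ | z ≠ 0 ∧ ‖z‖ < r} ⊆ (closure Kᶜ)ᶜ ∪ Kᶜ := by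
      rintro _ ⟨z, ⟨hz, hzr⟩, rfl⟩
      by_contra hcon
      rw [Set.mem_union, not_or, Set.notMem_compl_iff, Set.notMem_compl_iff] at hcon
      have h3 := hUK _ (hax z hzr).2 hcon.2 hcon.1
      refine hz (hax0 z ?_)
      rw [← φ₀.right_inv (hax z hzr).1]
      exact (congrArg φ₀ h3).trans h0
    rcases hpre.subset_or_subset isClosed_closure.isOpen_compl hK.isOpen_compl hdisj hcov with h | h
    · refine Or.inl fun z hz hzr => ?_
      have := h ⟨z, ⟨hz, hzr⟩, rfl⟩
      by_contra hK'
      exact this (subset_closure hK')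
    · exact Or.inr fun z hz hzr => h ⟨z, ⟨hz, hzr⟩, rfl⟩
  have hcase : ∀ x ∈ φ.source, x ≠ p →
      (∃ z, z ≠ 0 ∧ ‖z‖ < r ∧ φ₀ x = nodeAxis₁ z) ∨ ∃ z, z ≠ 0 ∧ ‖z‖ < r ∧ φ₀ x = nodeAxis₂ z := by
    intro x hx hxp
    obtain ⟨hx0, hxB⟩ := (hsrc x).1 hx
    have hne : φ₀ x ≠ nodeOrigin := fun h => hxp (φ₀.injOn hx0 hp₀ (h.trans h0.symm))
    rcases nodeModel_cases (φ₀ x) with h | h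
    · refine Or.inl ⟨_, fun h' => hne ?_, hxB.1, h⟩
      rw [h, h', nodeAxis₁_zero]
    · refine Or.inr ⟨_, fun h' => hne ?_, hxB.2, h⟩
      rw [h, h', nodeAxis₂_zero]
  have hleft : ∀ x ∈ φ.source, φ₀.symm (φ₀ x) = x := fun x hx => φ₀.left_inv ((hsrc x).1 hx).1
  have k1 := key nodeAxis₁ continuous_nodeAxis₁ (fun z hz => (eq_nodeOrigin_iff.1 hz).1) hax₁
  have k2 := key nodeAxis₂ continuous_nodeAxis₂ (fun z hz => (eq_nodeOrigin_iff.1 hz).2) hax₂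
  rcases k1 with k1 | k1 <;> rcases k2 with k2 | k2
  -- both branches lie in `K`: then `p` is an interior point of `K`
  · exfalso
    obtain ⟨y, hy, hyK⟩ := mem_closure_iff.1 hpZ _ φ.open_source hps
    have hyp : y ≠ p := fun h => hyK (h ▸ hpK)
    rcases hcase y hy hyp with ⟨z, hz, hzr, h⟩ | ⟨z, hz, hzr, h⟩
    · exact hyK (by rw [← hleft y hy, h]; exact k1 z hz hzr)
    · exact hyK (by rw [← hleft y hy, h]; exact k2 z hz hzr)
  · refine ⟨φ, ⟨hps, h0, hφb, fun x hx => ?_⟩, hsU⟩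
    by_cases hxp : x = p
    · subst hxp
      rw [hφx, h0]
      exact ⟨fun _ => rfl, fun _ => hpK⟩
    rw [hφx, ← hleft x hx]
    rcases hcase x hx hxp with ⟨z, hz, hzr, h⟩ | ⟨z, hz, hzr, h⟩
    · rw [h, φ₀.right_inv (hax₁ z hzr).1]
      exact ⟨fun _ => rfl, fun _ => k1 z hz hzr⟩
    · rw [h, φ₀.right_inv (hax₂ z hzr).1]
      exact ⟨fun h => absurd h (k2 z hz hzr), fun h => absurd h hz⟩
  -- the second branch lies in `K`: the axes have to be exchanged
  · refine ⟨φ.trans nodeSwap.toOpenPartialHomeomorph, ⟨by simpa using hps, ?_,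
      hφb.trans isBiholChart_nodeSwap, fun x hx => ?_⟩, by simpa using hsU⟩
    · change nodeSwap (φ₀ p) = _
      rw [h0]
      rfl
    have hx' : x ∈ φ.source := by simpa using hx
    change _ ↔ (φ₀ x).1.1 = 0
    by_cases hxp : x = p
    · subst hxp
      rw [h0]
      exact ⟨fun _ => rfl, fun _ => hpK⟩
    rw [← hleft x hx']
    rcases hcase x hx' hxp with ⟨z, hz, hzr, h⟩ | ⟨z, hz, hzr, h⟩
    · rw [h, φ₀.right_inv (hax₁ z hzr).1]
      exact ⟨fun h => absurd h (k1 z hz hzr), fun h => absurd h hz⟩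
    · rw [h, φ₀.right_inv (hax₂ z hzr).1]
      exact ⟨fun _ => rfl, fun _ => k2 z hz hzr⟩
  -- no branch lies in `K`: then `p` is an isolated point of `K`
  · exfalso
    obtain ⟨y, ⟨hy, hyK⟩, hyp⟩ := accPt_iff_nhds.1 hacc _ (φ.open_source.mem_nhds hps)
    rcases hcase y hy hyp with ⟨z, hz, hzr, h⟩ | ⟨z, hz, hzr, h⟩
    · exact k1 z hz hzr (by rw [← h, hleft y hy]; exact hyK)
    · exact k2 z hz hzr (by rw [← h, hleft y hy]; exact hyK)

end Branch

/-! ### Gluing along the nodes -/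

section Glue

variable {X : Type u} [TopologicalSpace X] [HolSpace X] {K : Set X}

omit [HolSpace X] in
theorem mem_nhds_of_notMem_closure_compl {x : X} (hx : x ∉ closure Kᶜ) : K ∈ 𝓝 x := by
  rw [← compl_compl K]
  exact mem_of_superset (isClosed_closure.isOpen_compl.mem_nhds hx)
    (Set.compl_subset_compl.2 subset_closure)

omit [HolSpace X] in
theorem closure_compl_mem_nhds (hK : IsClosed K) {x : X} (hx : x ∉ K) : closure Kᶜ ∈ 𝓝 x :=
  mem_of_superset (hK.isOpen_compl.mem_nhds hx) subset_closure

/-- A function is holomorphic if its restrictions to `K` and to the closure of its complement are,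
provided that `K` is a branch at each of its boundary points. -/
theorem holAt_of_restrict (hK : IsClosed K)
    (hb : ∀ p ∈ K, p ∈ closure Kᶜ → ∃ φ, IsBranchChart K φ p) {f : X → ℂ} {x : X}
    (h1 : ∀ hx : x ∈ K, HolAt (fun y : K => f y) ⟨x, hx⟩)
    (h2 : ∀ hx : x ∈ closure Kᶜ, HolAt (fun y : ↥(closure Kᶜ) => f y) ⟨x, hx⟩) : HolAt f x := by
  by_cases hxK : x ∈ K
  · by_cases hxZ : x ∈ closure Kᶜ
    · obtain ⟨φ, hφ⟩ := hb x hxK hxZ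
      exact hφ.holAt (h1 hxK) (h2 hxZ)
    · exact (holAt_restrict_iff_of_mem_nhds (x := (⟨x, hxK⟩ : K))
        (mem_nhds_of_notMem_closure_compl hxZ)).1 (h1 hxK)
  · exact (holAt_restrict_iff_of_mem_nhds (x := (⟨x, subset_closure hxK⟩ : ↥(closure Kᶜ)))
      (closure_compl_mem_nhds hK hxK)).1 (h2 (subset_closure hxK))

theorem ModuleSheaf.IsLineBundle.holAt_of_restrict {M : ModuleSheaf.{u, v} X}
    (hM : M.IsLineBundle) (hK : IsClosed K)
    (hb : ∀ p ∈ K, p ∈ closure Kᶜ → ∃ φ, IsBranchChart K φ p) {s : ∀ x, M.fiber x} {x : X}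
    (h1 : ∀ hx : x ∈ K, (M.restrict K).HolAt (fun y => s y.1) ⟨x, hx⟩)
    (h2 : ∀ hx : x ∈ closure Kᶜ, (M.restrict (closure Kᶜ)).HolAt (fun y => s y.1) ⟨x, hx⟩) :
    M.HolAt s x := by
  obtain ⟨e, he⟩ := hM.2 x
  obtain ⟨g, hg⟩ := hM.exists_coeff e s
  have hS : ∀ (S : Set X) (hx : x ∈ S), (M.restrict S).HolAt (fun y => s y.1) ⟨x, hx⟩ →
      HolSpace.HolAt (fun y : S => g y) ⟨x, hx⟩ := by
    intro S hx h
    have hr : (M.restrict S).IsFrameAt (fun y => e y.1) ⟨x, hx⟩ :=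
      ModuleSheaf.IsFrameAt.restrict (x := (⟨x, hx⟩ : S)) he
    exact (hr.holAt_iff (hr.eventually_ne_zero.mono fun y hy => hg y.1 hy)).1 h
  exact (he.holAt_iff (he.eventually_ne_zero.mono fun y hy => hg y hy)).2
    (_root_.holAt_of_restrict hK hb (fun hx => hS K hx (h1 hx)) fun hx => hS _ hx (h2 hx))

/-- If `K` is a branch at each of its boundary points, the closure of its complement is again a
nodal curve, smooth at these points. -/
theorem IsNodalCurve.closure_compl (hX : IsNodalCurve X) (hK : IsClosed K)
    (hb : ∀ p ∈ K, p ∈ closure Kᶜ → ∃ φ, IsBranchChart K φ p) :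
    IsNodalCurve ↥(closure Kᶜ) := by
  have := hX.compact
  have := hX.t2
  refine ⟨isCompact_iff_compactSpace.1 isClosed_closure.isCompact, inferInstance, fun x => ?_⟩
  by_cases hxK : x.1 ∈ K
  · obtain ⟨φ, hφ⟩ := hb x.1 hxK x.2
    exact Or.inl hφ.isSmoothPoint_closure_compl
  · obtain ⟨ψ, hψs, hψx, hψ⟩ := exists_isBiholChart (X := ↥(closure Kᶜ)) (Y := X)
      (U := Subtype.val ⁻¹' Kᶜ) (f := Subtype.val)
      (hK.isOpen_compl.preimage continuous_subtype_val) ⟨x, hxK⟩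
      continuous_subtype_val.continuousOn Subtype.val_injective.injOn
      (by
        intro W hW hWo
        obtain ⟨W', hW', rfl⟩ := isOpen_induced_iff.1 hWo
        have : Subtype.val '' (Subtype.val ⁻¹' W' : Set ↥(closure Kᶜ)) = W' ∩ Kᶜ := by
          ext y
          constructor
          · rintro ⟨z, hz, rfl⟩
            exact ⟨hz, hW hz⟩
          · rintro ⟨hy, hyK⟩
            exact ⟨⟨y, subset_closure hyK⟩, hy, rfl⟩
        rw [this]
        exact hW'.inter hK.isOpen_compl)
      (fun y hy g => holAt_restrict_iff_of_mem_nhds (closure_compl_mem_nhds hK hy))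
    have hxt : ψ x ∈ ψ.target := ψ.map_source (hψs ▸ hxK)
    have hxs : ψ.symm (ψ x) = x := ψ.left_inv (hψs ▸ hxK)
    rw [← hxs]
    rcases hX.smooth_or_node (ψ x) with h | h
    · exact Or.inl (hψ.symm.isSmoothPoint hxt h)
    · exact Or.inr (hψ.symm.isNode hxt h)

namespace ModuleSheaf

variable {M : ModuleSheaf.{u, v} X}

/-- Restriction of global sections to a subspace. -/
def restrictSections (M : ModuleSheaf.{u, v} X) (S : Set X) :
    M.globalSections →ₗ[ℂ] (M.restrict S).globalSections where
  toFun s := ⟨fun y => s.1 y.1, fun y => restrict_holAt (s.2 y.1)⟩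
  map_add' _ _ := rfl
  map_smul' _ _ := rfl

/-- Sections over `K` and over the closure of its complement that agree on the intersection come
from a section over `X`. -/
theorem IsLineBundle.exists_glue (hM : M.IsLineBundle) (hK : IsClosed K)
    (hb : ∀ p ∈ K, p ∈ closure Kᶜ → ∃ φ, IsBranchChart K φ p)
    (s : (M.restrict K).globalSections) (t : (M.restrict (closure Kᶜ)).globalSections)
    (hst : ∀ x (hx : x ∈ K) (hx' : x ∈ closure Kᶜ), s.1 ⟨x, hx⟩ = t.1 ⟨x, hx'⟩) :
    ∃ r : M.globalSections, M.restrictSections K r = s ∧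
      M.restrictSections (closure Kᶜ) r = t := by
  classical
  let r : ∀ x, M.fiber x := fun x =>
    if hx : x ∈ K then s.1 ⟨x, hx⟩ else t.1 ⟨x, subset_closure hx⟩
  have hrK : (fun y : K => r y.1) = s.1 := by
    funext y
    exact dif_pos y.2
  have hrZ : (fun y : ↥(closure Kᶜ) => r y.1) = t.1 := by
    funext y
    by_cases hy : y.1 ∈ K
    · exact (dif_pos hy).trans (hst y.1 hy y.2)
    · exact dif_neg hy
  refine ⟨⟨r, fun x => ?_⟩, Subtype.ext hrK, Subtype.ext hrZ⟩
  refine hM.holAt_of_restrict hK hb (fun hx => ?_) fun hx => ?_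
  · have := s.2 ⟨x, hx⟩
    rwa [← hrK] at this
  · have := t.2 ⟨x, hx⟩
    rwa [← hrZ] at this

theorem eq_of_restrictSections_eq {s t : M.globalSections}
    (h1 : M.restrictSections K s = M.restrictSections K t)
    (h2 : M.restrictSections (closure Kᶜ) s = M.restrictSections (closure Kᶜ) t) : s = t := by
  refine Subtype.ext (funext fun x => ?_)
  by_cases hx : x ∈ K
  · exact congrFun (congrArg Subtype.val h1) ⟨x, hx⟩
  · exact congrFun (congrArg Subtype.val h2) ⟨x, subset_closure hx⟩

/-- If the sections over `K` take all values at the two boundary points of `K`, then restriction to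
the closure of the complement of `K` is onto, and its kernel consists of the sections over `K` that
vanish at the two points. -/
theorem IsLineBundle.h0_eq_add (hM : M.IsLineBundle) (hK : IsClosed K)
    (hb : ∀ p ∈ K, p ∈ closure Kᶜ → ∃ φ, IsBranchChart K φ p) {p₁ p₂ : X}
    (hp₁ : p₁ ∈ K) (hp₂ : p₂ ∈ K) (hKZ : K ∩ closure Kᶜ = {p₁, p₂})
    (hsurj : Function.Surjective ((M.restrict K).evalPair ⟨p₁, hp₁⟩ ⟨p₂, hp₂⟩)) :
    M.h0 = (M.restrict (closure Kᶜ)).h0 + Module.rank ℂ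
      (LinearMap.ker ((M.restrict K).evalPair ⟨p₁, hp₁⟩ ⟨p₂, hp₂⟩)) := by
  have hp₁Z : p₁ ∈ closure Kᶜ := (hKZ.symm ▸ Or.inl rfl : p₁ ∈ K ∩ closure Kᶜ).2
  have hp₂Z : p₂ ∈ closure Kᶜ := (hKZ.symm ▸ Or.inr rfl : p₂ ∈ K ∩ closure Kᶜ).2
  have hcases : ∀ x, x ∈ K → x ∈ closure Kᶜ → x = p₁ ∨ x = p₂ := by
    intro x hx hx'
    have : x ∈ ({p₁, p₂} : Set X) := hKZ ▸ ⟨hx, hx'⟩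
    simpa using this
  have hres : Function.Surjective (M.restrictSections (closure Kᶜ)) := by
    intro t
    obtain ⟨s, hs⟩ := hsurj (t.1 ⟨p₁, hp₁Z⟩, t.1 ⟨p₂, hp₂Z⟩)
    rw [evalPair_apply] at hs
    obtain ⟨r, -, hr⟩ := hM.exists_glue hK hb s t fun x hx hx' => by
      rcases hcases x hx hx' with rfl | rfl
      · exact congrArg Prod.fst hs
      · exact congrArg Prod.snd hs
    exact ⟨r, hr⟩
  let Ψ : LinearMap.ker (M.restrictSections (closure Kᶜ)) →ₗ[ℂ]
      LinearMap.ker ((M.restrict K).evalPair ⟨p₁, hp₁⟩ ⟨p₂, hp₂⟩) :=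
    ((M.restrictSections K).comp (Submodule.subtype _)).codRestrict _ fun s => by
      have hs : M.restrictSections (closure Kᶜ) s.1 = 0 := s.2
      have h1 := congrFun (congrArg Subtype.val hs) ⟨p₁, hp₁Z⟩
      have h2 := congrFun (congrArg Subtype.val hs) ⟨p₂, hp₂Z⟩
      exact Prod.ext h1 h2
  have hΨ : Function.Bijective Ψ := by
    constructor
    · intro s t hst
      have h1 : M.restrictSections K s.1 = M.restrictSections K t.1 := congrArg Subtype.val hst
      exact Subtype.ext (eq_of_restrictSections_eq h1
        ((show M.restrictSections (closure Kᶜ) s.1 = 0 from s.2).trans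
          (show M.restrictSections (closure Kᶜ) t.1 = 0 from t.2).symm))
    · rintro ⟨s, hs⟩
      have hs' : (M.restrict K).evalPair ⟨p₁, hp₁⟩ ⟨p₂, hp₂⟩ s = 0 := hs
      obtain ⟨r, hr, hr0⟩ := hM.exists_glue hK hb s 0 fun x hx hx' => by
        rcases hcases x hx hx' with rfl | rfl
        · exact congrArg Prod.fst hs'
        · exact congrArg Prod.snd hs'
      exact ⟨⟨r, hr0⟩, Subtype.ext hr⟩
  have h := LinearMap.rank_range_add_rank_ker (M.restrictSections (closure Kᶜ))
  rw [LinearMap.range_eq_top.2 hres, rank_top, (LinearEquiv.ofBijective Ψ hΨ).rank_eq] at h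
  exact h.symm

/-- If there are no sections over `K`, then sections over `X` are sections over the closure of the
complement of `K` that vanish on the boundary of `K`. -/
theorem IsLineBundle.h0_eq_twistNeg (hM : M.IsLineBundle) (hK : IsClosed K)
    (hb : ∀ p ∈ K, p ∈ closure Kᶜ → ∃ φ, IsBranchChart K φ p)
    (h0 : ∀ s : (M.restrict K).globalSections, s = 0) {S : Set X} (hS : K ∩ closure Kᶜ = S) :
    M.h0 = ((M.restrict (closure Kᶜ)).twistNeg (Subtype.val ⁻¹' S)).h0 := by
  subst hS
  set N := (M.restrict (closure Kᶜ)).twistNeg (Subtype.val ⁻¹' (K ∩ closure Kᶜ)) with hN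
  have hzero : ∀ (s : M.globalSections) (x : X), x ∈ K → s.1 x = 0 := fun s x hx =>
    congrFun (congrArg Subtype.val (h0 (M.restrictSections K s))) ⟨x, hx⟩
  let Ψ : M.globalSections →ₗ[ℂ] N.globalSections :=
    { toFun := fun s => ⟨(M.restrictSections (closure Kᶜ) s).1, fun y =>
        ⟨(M.restrictSections (closure Kᶜ) s).2 y, Eventually.of_forall fun z hz =>
          hzero s z.1 hz.1⟩⟩
      map_add' := fun _ _ => rfl
      map_smul' := fun _ _ => rfl }
  have hΨ : Function.Bijective Ψ := by
    constructor
    · intro s t hst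
      refine eq_of_restrictSections_eq (K := K) ((h0 _).trans (h0 _).symm) (Subtype.ext ?_)
      have h1 := congrArg Subtype.val hst
      exact h1
    · rintro ⟨t, ht⟩
      obtain ⟨r, -, hr⟩ := hM.exists_glue hK hb 0 ⟨t, fun y => (ht y).1⟩ fun x hx hx' =>
        ((ht ⟨x, hx'⟩).2.self_of_nhds ⟨hx, hx'⟩).symm
      have h1 := congrArg Subtype.val hr
      exact ⟨r, Subtype.ext h1⟩
  exact (LinearEquiv.ofBijective Ψ hΨ).rank_eq

end ModuleSheaf

end Glue

/-! ### The contraction of a closed subset -/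

section Contract

variable {X : Type u} {K : Set X}

theorem contractMap_eq_iff {x y : X} :
    contractMap K x = contractMap K y ↔ x = y ∨ (x ∈ K ∧ y ∈ K) :=
  Quotient.eq (r := contractSetoid K)

theorem contractMap_surjective : Function.Surjective (contractMap K) := Quotient.mk_surjective

theorem preimage_image_contractMap {U : Set X} (h : (∃ x ∈ U, x ∈ K) → K ⊆ U) :
    contractMap K ⁻¹' (contractMap K '' U) = U := by
  refine Set.Subset.antisymm ?_ (Set.subset_preimage_image _ _)
  rintro x ⟨y, hy, hyx⟩
  rcases contractMap_eq_iff.1 hyx with rfl | ⟨hyK, hxK⟩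
  · exact hy
  · exact h ⟨y, hy, hyK⟩ hxK

variable [TopologicalSpace X]

/-- The hypothesis says that `U` is saturated: it contains `K` or is disjoint from it. -/
theorem isOpen_image_contractMap {U : Set X} (hU : IsOpen U) (h : (∃ x ∈ U, x ∈ K) → K ⊆ U) :
    IsOpen (contractMap K '' U) := by
  refine isOpen_coinduced.2 ?_
  rwa [preimage_image_contractMap h]

theorem t2Space_contraction [CompactSpace X] [T2Space X] (hK : IsClosed K) :
    T2Space (Contraction K) := by
  -- points off `K` are separated from the image of `K` because the space is normal
  have key : ∀ x y : X, x ∉ K → x ≠ y →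
      ∃ U V : Set (Contraction K), IsOpen U ∧ IsOpen V ∧ contractMap K x ∈ U ∧
        contractMap K y ∈ V ∧ Disjoint U V := by
    intro x y hx hxy
    have hd : Disjoint {x} (K ∪ {y}) := by
      rw [Set.disjoint_singleton_left]
      rintro (h | h)
      · exact hx h
      · exact hxy h
    obtain ⟨U, V, hU, hV, hxU, hKV, hUV⟩ :=
      normal_separation (isClosed_singleton (x := x))
        (hK.union (isClosed_singleton (x := y))) hd
    have hKV' : K ⊆ V := Set.subset_union_left.trans hKV
    have hUK : (∃ x ∈ U, x ∈ K) → K ⊆ U := by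
      rintro ⟨z, hz, hzK⟩
      exact absurd (hKV' hzK) (Set.disjoint_left.1 hUV hz)
    refine ⟨_, _, isOpen_image_contractMap hU hUK, isOpen_image_contractMap hV fun _ => hKV',
      ⟨x, hxU rfl, rfl⟩, ⟨y, hKV (Or.inr rfl), rfl⟩, ?_⟩
    rw [Set.disjoint_left]
    rintro _ ⟨a, ha, rfl⟩ ⟨b, hb, hba⟩
    have : a ∈ contractMap K ⁻¹' (contractMap K '' V) := ⟨b, hb, hba⟩
    rw [preimage_image_contractMap fun _ => hKV'] at this
    exact Set.disjoint_left.1 hUV ha this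
  refine ⟨fun a b hab => ?_⟩
  obtain ⟨x, rfl⟩ := contractMap_surjective a
  obtain ⟨y, rfl⟩ := contractMap_surjective b
  have hne : x ≠ y ∧ ¬(x ∈ K ∧ y ∈ K) := not_or.1 fun h => hab (contractMap_eq_iff.2 h)
  by_cases hx : x ∈ K
  · obtain ⟨U, V, hU, hV, h1, h2, h3⟩ := key y x (fun hy => hne.2 ⟨hx, hy⟩) hne.1.symm
    exact ⟨V, U, hV, hU, h2, h1, h3.symm⟩
  · exact key x y hx hne.1

variable [HolSpace X]

/-- Holomorphy on the contraction can be checked on a saturated open set. -/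
theorem holAt_contraction {U : Set X} (hU : IsOpen U) (h : (∃ x ∈ U, x ∈ K) → K ⊆ U)
    {f : Contraction K → ℂ} (hf : ∀ x ∈ U, HolAt (f ∘ contractMap K) x) {x : X} (hx : x ∈ U) :
    HolAt f (contractMap K x) := by
  change ∀ᶠ q in 𝓝 (contractMap K x), ∀ x, contractMap K x = q → HolAt (f ∘ contractMap K) x
  filter_upwards [(isOpen_image_contractMap hU h).mem_nhds ⟨x, hx, rfl⟩] with q hq y hy
  have hy' : y ∈ contractMap K ⁻¹' (contractMap K '' U) := by rw [Set.mem_preimage, hy]; exact hq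
  rw [preimage_image_contractMap h] at hy'
  exact hf y hy'

theorem isOpen_setOf_holAt {Y : Type*} [TopologicalSpace Y] [HolSpace Y] (f : Y → ℂ) :
    IsOpen {y | HolAt f y} :=
  isOpen_iff_eventually.2 fun _ hy => HolSpace.eventually hy

/-- Off `K`, the contraction map is a biholomorphic chart. -/
theorem exists_contractMap_chart (hK : IsClosed K) (hne : Kᶜ.Nonempty) :
    ∃ ψ : OpenPartialHomeomorph X (Contraction K), ψ.source = Kᶜ ∧
      (∀ x, ψ x = contractMap K x) ∧ IsBiholChart ψ := by
  have hsat : ∀ W ⊆ Kᶜ, (∃ x ∈ W, x ∈ K) → K ⊆ W := by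
    rintro W hW ⟨x, hx, hxK⟩
    exact absurd hxK (hW hx)
  refine exists_isBiholChart hK.isOpen_compl hne (continuous_contractMap K).continuousOn ?_
    (fun W hW hWo => isOpen_image_contractMap hWo (hsat W hW)) fun x hx g => ⟨fun h => ?_, fun h =>
      h.self_of_nhds x rfl⟩
  · intro x hx y _ hxy
    rcases contractMap_eq_iff.1 hxy with h | h
    · exact h
    · exact absurd h.1 hx
  · exact holAt_contraction (hK.isOpen_compl.inter (isOpen_setOf_holAt (g ∘ contractMap K)))
      (hsat _ Set.inter_subset_left) (fun y hy => hy.2) ⟨hx, h⟩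

end Contract

/-! ### Contracting a component that meets the rest in two nodes -/

section ContractNode

variable {X : Type u} [TopologicalSpace X] {K : Set X}
  {φ₁ φ₂ : OpenPartialHomeomorph X nodeModel}

open Classical in
/-- The map to the model of a node that contracts the branches lying in `K` at two nodes with
charts `φ₁` and `φ₂`, and uses the other branches as the two axes. -/
noncomputable def contractChart (φ₁ φ₂ : OpenPartialHomeomorph X nodeModel) (x : X) : nodeModel :=
  if x ∈ φ₁.source then nodeAxis₁ (φ₁ x).1.2
  else if x ∈ φ₂.source then nodeAxis₂ (φ₂ x).1.2 else nodeOrigin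

theorem contractChart_of_mem₁ {x : X} (hx : x ∈ φ₁.source) :
    contractChart φ₁ φ₂ x = nodeAxis₁ (φ₁ x).1.2 :=
  if_pos hx

theorem contractChart_of_mem₂ (hd : Disjoint φ₁.source φ₂.source) {x : X} (hx : x ∈ φ₂.source) :
    contractChart φ₁ φ₂ x = nodeAxis₂ (φ₂ x).1.2 :=
  (if_neg (Set.disjoint_right.1 hd hx)).trans (if_pos hx)

variable [HolSpace X] {p₁ p₂ : X} (h₁ : IsBranchChart K φ₁ p₁) (h₂ : IsBranchChart K φ₂ p₂)

include h₁ h₂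

theorem contractChart_of_mem {x : X} (hx : x ∈ K) : contractChart φ₁ φ₂ x = nodeOrigin := by
  unfold contractChart
  split_ifs with hx1 hx2
  · rw [(h₁.mem_iff x hx1).1 hx, nodeAxis₁_zero]
  · rw [(h₂.mem_iff x hx2).1 hx, nodeAxis₂_zero]
  · rfl

/-- The domain on which the two branches and `K` fill a neighbourhood of `K`. -/
theorem subset_contractDomain (hKZ : K ∩ closure Kᶜ ⊆ {p₁, p₂}) :
    K ⊆ φ₁.source ∪ φ₂.source ∪ (closure Kᶜ)ᶜ := by
  intro x hx
  by_cases hxZ : x ∈ closure Kᶜ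
  · rcases hKZ ⟨hx, hxZ⟩ with rfl | rfl
    · exact Or.inl (Or.inl h₁.mem_source)
    · exact Or.inl (Or.inr h₂.mem_source)
  · exact Or.inr hxZ

/-- The chart determines the image in the contraction of a point taken to the first axis. -/
theorem contractMap_eq_of_contractChart₁ (hd : Disjoint φ₁.source φ₂.source) {x : X} {u : ℂ}
    (hx : x ∈ φ₁.source ∪ φ₂.source ∪ (closure Kᶜ)ᶜ)
    (hu : contractChart φ₁ φ₂ x = nodeAxis₁ u) :
    nodeAxis₂ u ∈ φ₁.target ∧ contractMap K x = contractMap K (φ₁.symm (nodeAxis₂ u)) := by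
  have hKx : x ∈ K → u = 0 := by
    intro hxK
    rw [contractChart_of_mem h₁ h₂ hxK] at hu
    exact congrArg (fun y : nodeModel => y.1.1) hu.symm
  have hxKcase : x ∈ K → nodeAxis₂ u ∈ φ₁.target ∧
      contractMap K x = contractMap K (φ₁.symm (nodeAxis₂ u)) := by
    intro hxK
    rw [hKx hxK, nodeAxis₂_zero]
    refine ⟨h₁.origin_mem_target, contractMap_eq_iff.2 (Or.inr ⟨hxK, ?_⟩)⟩
    rw [h₁.symm_origin]
    exact h₁.self_mem
  by_cases hxK : x ∈ K
  · exact hxKcase hxK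
  rcases hx with (hx | hx) | hx
  · rw [contractChart_of_mem₁ hx] at hu
    have hu' : (φ₁ x).1.2 = u := congrArg (fun y : nodeModel => y.1.1) hu
    have h0 : (φ₁ x).1.2 ≠ 0 := fun h => hxK ((h₁.mem_iff x hx).2 h)
    have h3 : φ₁ x = nodeAxis₂ u := by
      rw [← hu']
      exact eq_nodeAxis₂ ((mul_eq_zero.1 (nodeModel_mul_eq_zero _)).resolve_right h0)
    rw [← h3, φ₁.left_inv hx]
    exact ⟨φ₁.map_source hx, rfl⟩
  · rw [contractChart_of_mem₂ hd hx] at hu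
    exact absurd ((h₂.mem_iff x hx).2 (congrArg (fun y : nodeModel => y.1.2) hu)) hxK
  · exact absurd (by by_contra h; exact hx (subset_closure h)) hxK

/-- The chart determines the image in the contraction of a point taken to the second axis. -/
theorem contractMap_eq_of_contractChart₂ (hd : Disjoint φ₁.source φ₂.source) {x : X} {u : ℂ}
    (hx : x ∈ φ₁.source ∪ φ₂.source ∪ (closure Kᶜ)ᶜ)
    (hu : contractChart φ₁ φ₂ x = nodeAxis₂ u) :
    nodeAxis₂ u ∈ φ₂.target ∧ contractMap K x = contractMap K (φ₂.symm (nodeAxis₂ u)) := by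
  have hKx : x ∈ K → u = 0 := by
    intro hxK
    rw [contractChart_of_mem h₁ h₂ hxK] at hu
    exact congrArg (fun y : nodeModel => y.1.2) hu.symm
  have hxKcase : x ∈ K → nodeAxis₂ u ∈ φ₂.target ∧
      contractMap K x = contractMap K (φ₂.symm (nodeAxis₂ u)) := by
    intro hxK
    rw [hKx hxK, nodeAxis₂_zero]
    refine ⟨h₂.origin_mem_target, contractMap_eq_iff.2 (Or.inr ⟨hxK, ?_⟩)⟩
    rw [h₂.symm_origin]
    exact h₂.self_mem
  by_cases hxK : x ∈ K
  · exact hxKcase hxK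
  rcases hx with (hx | hx) | hx
  · rw [contractChart_of_mem₁ hx] at hu
    exact absurd ((h₁.mem_iff x hx).2 (congrArg (fun y : nodeModel => y.1.1) hu)) hxK
  · rw [contractChart_of_mem₂ hd hx] at hu
    have hu' : (φ₂ x).1.2 = u := congrArg (fun y : nodeModel => y.1.2) hu
    have h0 : (φ₂ x).1.2 ≠ 0 := fun h => hxK ((h₂.mem_iff x hx).2 h)
    have h3 : φ₂ x = nodeAxis₂ u := by
      rw [← hu']
      exact eq_nodeAxis₂ ((mul_eq_zero.1 (nodeModel_mul_eq_zero _)).resolve_right h0)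
    rw [← h3, φ₂.left_inv hx]
    exact ⟨φ₂.map_source hx, rfl⟩
  · exact absurd (by by_contra h; exact hx (subset_closure h)) hxK

/-- The three local descriptions of the contraction chart. -/
theorem contractChart_eventuallyEq (hd : Disjoint φ₁.source φ₂.source) {x : X}
    (hx : x ∈ φ₁.source ∪ φ₂.source ∪ (closure Kᶜ)ᶜ) :
    (x ∈ φ₁.source ∧ contractChart φ₁ φ₂ =ᶠ[𝓝 x] fun y => nodeAxis₁ (φ₁ y).1.2) ∨
    (x ∈ φ₂.source ∧ contractChart φ₁ φ₂ =ᶠ[𝓝 x] fun y => nodeAxis₂ (φ₂ y).1.2) ∨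
    (x ∈ K ∧ contractChart φ₁ φ₂ =ᶠ[𝓝 x] fun _ => nodeOrigin) := by
  rcases hx with (hx | hx) | hx
  · exact Or.inl ⟨hx, by
      filter_upwards [φ₁.open_source.mem_nhds hx] with y hy using contractChart_of_mem₁ hy⟩
  · exact Or.inr (Or.inl ⟨hx, by
      filter_upwards [φ₂.open_source.mem_nhds hx] with y hy using contractChart_of_mem₂ hd hy⟩)
  · have hK : K ∈ 𝓝 x := mem_nhds_of_notMem_closure_compl hx
    exact Or.inr (Or.inr ⟨mem_of_mem_nhds hK, by
      filter_upwards [hK] with y hy using contractChart_of_mem h₁ h₂ hy⟩)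

theorem continuousOn_contractChart (hd : Disjoint φ₁.source φ₂.source) :
    ContinuousOn (contractChart φ₁ φ₂) (φ₁.source ∪ φ₂.source ∪ (closure Kᶜ)ᶜ) := by
  have c2 : Continuous fun y : nodeModel => y.1.2 := by fun_prop
  intro x hx
  refine ContinuousAt.continuousWithinAt ?_
  rcases contractChart_eventuallyEq h₁ h₂ hd hx with ⟨hx, h⟩ | ⟨hx, h⟩ | ⟨hx, h⟩
  · exact ((continuous_nodeAxis₁.comp c2).continuousAt.comp (φ₁.continuousAt hx)).congr h.symm
  · exact ((continuous_nodeAxis₂.comp c2).continuousAt.comp (φ₂.continuousAt hx)).congr h.symm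
  · exact continuousAt_const.congr h.symm

/-- The contraction chart pulls holomorphic functions back to holomorphic functions. -/
theorem holAt_comp_contractChart (hd : Disjoint φ₁.source φ₂.source) {x : X}
    (hx : x ∈ φ₁.source ∪ φ₂.source ∪ (closure Kᶜ)ᶜ) {f : nodeModel → ℂ}
    (hf : HolAt f (contractChart φ₁ φ₂ x)) : HolAt (f ∘ contractChart φ₁ φ₂) x := by
  rcases contractChart_eventuallyEq h₁ h₂ hd hx with ⟨hx, h⟩ | ⟨hx, h⟩ | ⟨hx, h⟩
  · rw [h.self_of_nhds] at hf
    have h3 := holAt_nodeModel_comp (m := fun z : ℂ × ℂ => (z.2, 0))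
      (fun z => analyticAt_snd.prod analyticAt_const) (n := fun y => nodeAxis₁ y.1.2)
      (fun _ => rfl) (x := φ₁ x) hf
    exact HolSpace.congr ((h₁.isBiholChart x hx _).2 h3)
      (h.mono fun y hy => (congrArg f hy).symm)
  · rw [h.self_of_nhds] at hf
    have h3 := holAt_nodeModel_comp (m := fun z : ℂ × ℂ => (0, z.2))
      (fun z => analyticAt_const.prod analyticAt_snd) (n := fun y => nodeAxis₂ y.1.2)
      (fun _ => rfl) (x := φ₂ x) hf
    exact HolSpace.congr ((h₂.isBiholChart x hx _).2 h3)
      (h.mono fun y hy => (congrArg f hy).symm)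
  · exact HolSpace.congr (HolSpace.const (f nodeOrigin) x)
      (h.mono fun y hy => (congrArg f hy).symm)

omit h₂ in
theorem analyticAt_of_holAt_contractChart₁ {x : X} (hx : x ∈ φ₁.source) (h0 : (φ₁ x).1.1 = 0)
    {f : nodeModel → ℂ} (hf : HolAt (f ∘ contractChart φ₁ φ₂) x) :
    AnalyticAt ℂ (fun u => f (nodeAxis₁ u)) (φ₁ x).1.2 := by
  rw [h₁.isBiholChart.holAt_iff hx, eq_nodeAxis₂ h0] at hf
  refine (analyticAt_nodeAxis₂ hf).congr ?_
  have hxt : nodeAxis₂ (φ₁ x).1.2 ∈ φ₁.target := eq_nodeAxis₂ h0 ▸ φ₁.map_source hx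
  filter_upwards [continuous_nodeAxis₂.continuousAt.eventually
    (φ₁.open_target.mem_nhds hxt)] with u hu
  simp only [Function.comp_apply]
  rw [contractChart_of_mem₁ (φ₁.map_target hu), φ₁.right_inv hu, nodeAxis₂_snd]

omit h₁ in
theorem analyticAt_of_holAt_contractChart₂ (hd : Disjoint φ₁.source φ₂.source) {x : X}
    (hx : x ∈ φ₂.source) (h0 : (φ₂ x).1.1 = 0)
    {f : nodeModel → ℂ} (hf : HolAt (f ∘ contractChart φ₁ φ₂) x) :
    AnalyticAt ℂ (fun u => f (nodeAxis₂ u)) (φ₂ x).1.2 := by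
  rw [h₂.isBiholChart.holAt_iff hx, eq_nodeAxis₂ h0] at hf
  refine (analyticAt_nodeAxis₂ hf).congr ?_
  have hxt : nodeAxis₂ (φ₂ x).1.2 ∈ φ₂.target := eq_nodeAxis₂ h0 ▸ φ₂.map_source hx
  filter_upwards [continuous_nodeAxis₂.continuousAt.eventually
    (φ₂.open_target.mem_nhds hxt)] with u hu
  simp only [Function.comp_apply]
  rw [contractChart_of_mem₂ hd (φ₂.map_target hu), φ₂.right_inv hu, nodeAxis₂_snd]

/-- Contracting a closed set that is a branch at two nodes and whose boundary consists of these
nodes produces a node: its branches are the remaining branches at the two nodes. -/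
theorem isNode_contractMap (hd : Disjoint φ₁.source φ₂.source)
    (hKZ : K ∩ closure Kᶜ ⊆ {p₁, p₂}) : IsNode (contractMap K p₁) := by
  set U : Set X := φ₁.source ∪ φ₂.source ∪ (closure Kᶜ)ᶜ with hU
  set F := contractChart φ₁ φ₂ with hF
  have hUo : IsOpen U :=
    (φ₁.open_source.union φ₂.open_source).union isClosed_closure.isOpen_compl
  have hKU : K ⊆ U := subset_contractDomain h₁ h₂ hKZ
  have hFc : ContinuousOn F U := continuousOn_contractChart h₁ h₂ hd
  have hresp : ∀ x y : X, (contractSetoid K).r x y → F x = F y := by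
    rintro x y (rfl | ⟨hx, hy⟩)
    · rfl
    · rw [hF, contractChart_of_mem h₁ h₂ hx, contractChart_of_mem h₁ h₂ hy]
  let G : Contraction K → nodeModel := Quotient.lift F hresp
  have hG : ∀ x, G (contractMap K x) = F x := fun _ => rfl
  -- open subsets `F ⁻¹' O` of `U` are saturated
  have hsat : ∀ O : Set nodeModel, (∃ x ∈ U ∩ F ⁻¹' O, x ∈ K) → K ⊆ U ∩ F ⁻¹' O := by
    rintro O ⟨x, ⟨_, hxO⟩, hxK⟩ y hy
    refine ⟨hKU hy, ?_⟩
    rw [Set.mem_preimage, hF, contractChart_of_mem h₁ h₂ hxK] at hxO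
    rwa [Set.mem_preimage, hF, contractChart_of_mem h₁ h₂ hy]
  have hsatU : contractMap K ⁻¹' (contractMap K '' U) = U :=
    preimage_image_contractMap fun _ => hKU
  obtain ⟨ψ, hψs, hψx, hψ⟩ := exists_isBiholChart (X := Contraction K) (Y := nodeModel)
    (U := contractMap K '' U) (f := G) (isOpen_image_contractMap hUo fun _ => hKU)
    ⟨_, p₁, Or.inl (Or.inl h₁.mem_source), rfl⟩
    (by
      rw [continuousOn_open_iff (isOpen_image_contractMap hUo fun _ => hKU)]
      intro O hO
      refine isOpen_coinduced.2 ?_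
      rw [Set.preimage_inter, hsatU]
      exact hFc.isOpen_inter_preimage hUo hO)
    (by
      rintro _ ⟨x, hx, rfl⟩ _ ⟨y, hy, rfl⟩ hxy
      rw [hG, hG] at hxy
      rcases nodeModel_cases (F x) with h | h
      · rw [(contractMap_eq_of_contractChart₁ h₁ h₂ hd hx h).2,
          (contractMap_eq_of_contractChart₁ h₁ h₂ hd hy (hxy.symm.trans h)).2]
      · rw [(contractMap_eq_of_contractChart₂ h₁ h₂ hd hx h).2,
          (contractMap_eq_of_contractChart₂ h₁ h₂ hd hy (hxy.symm.trans h)).2])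
    (by
      intro W hWU hW
      have hW' : IsOpen (contractMap K ⁻¹' W) := hW.preimage (continuous_contractMap K)
      have e₁ : nodeAxis₁ ⁻¹' (G '' W) =
          nodeAxis₂ ⁻¹' (φ₁.target ∩ φ₁.symm ⁻¹' (contractMap K ⁻¹' W)) := by
        ext u
        constructor
        · rintro ⟨q, hq, hqu⟩
          obtain ⟨x, hx, rfl⟩ := hWU hq
          obtain ⟨h3, h4⟩ := contractMap_eq_of_contractChart₁ h₁ h₂ hd hx hqu
          exact ⟨h3, by rw [Set.mem_preimage, Set.mem_preimage, ← h4]; exact hq⟩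
        · rintro ⟨hu, huW⟩
          refine ⟨_, huW, ?_⟩
          rw [hG, hF, contractChart_of_mem₁ (φ₁.map_target hu), φ₁.right_inv hu, nodeAxis₂_snd]
      have e₂ : nodeAxis₂ ⁻¹' (G '' W) =
          nodeAxis₂ ⁻¹' (φ₂.target ∩ φ₂.symm ⁻¹' (contractMap K ⁻¹' W)) := by
        ext u
        constructor
        · rintro ⟨q, hq, hqu⟩
          obtain ⟨x, hx, rfl⟩ := hWU hq
          obtain ⟨h3, h4⟩ := contractMap_eq_of_contractChart₂ h₁ h₂ hd hx hqu
          exact ⟨h3, by rw [Set.mem_preimage, Set.mem_preimage, ← h4]; exact hq⟩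
        · rintro ⟨hu, huW⟩
          refine ⟨_, huW, ?_⟩
          rw [hG, hF, contractChart_of_mem₂ hd (φ₂.map_target hu), φ₂.right_inv hu, nodeAxis₂_snd]
      rw [isOpen_nodeModel_iff, e₁, e₂]
      exact ⟨(φ₁.isOpen_inter_preimage_symm hW').preimage continuous_nodeAxis₂,
        (φ₂.isOpen_inter_preimage_symm hW').preimage continuous_nodeAxis₂⟩)
    (by
      rintro _ ⟨x, hx, rfl⟩ f
      constructor
      · intro h
        have hpull : ∀ y, contractMap K y = contractMap K x → HolAt (f ∘ F) y := fun y hy =>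
          h.self_of_nhds y hy
        rw [hG]
        by_cases hxK : x ∈ K
        · have hp₁ := hpull p₁ (contractMap_eq_iff.2 (Or.inr ⟨h₁.self_mem, hxK⟩))
          have hp₂ := hpull p₂ (contractMap_eq_iff.2 (Or.inr ⟨h₂.self_mem, hxK⟩))
          rw [hF, contractChart_of_mem h₁ h₂ hxK]
          have a₁ := analyticAt_of_holAt_contractChart₁ h₁ h₁.mem_source
            (by rw [h₁.map_eq]; rfl) hp₁
          have a₂ := analyticAt_of_holAt_contractChart₂ h₂ hd h₂.mem_source
            (by rw [h₂.map_eq]; rfl) hp₂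
          rw [h₁.map_eq] at a₁
          rw [h₂.map_eq] at a₂
          exact holAt_nodeOrigin a₁ a₂
        · have hxZ : x ∈ closure Kᶜ := subset_closure hxK
          have hxx := hpull x rfl
          rcases hx with (hx | hx) | hx
          · have a₁ := analyticAt_of_holAt_contractChart₁ h₁ hx
              ((h₁.mem_closure_compl_iff hx).1 hxZ) hxx
            rw [hF, contractChart_of_mem₁ hx]
            exact holAt_nodeAxis₁ (fun h => hxK ((h₁.mem_iff x hx).2 h)) a₁
          · have a₂ := analyticAt_of_holAt_contractChart₂ h₂ hd hx
              ((h₂.mem_closure_compl_iff hx).1 hxZ) hxx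
            rw [hF, contractChart_of_mem₂ hd hx]
            exact holAt_nodeAxis₂ (fun h => hxK ((h₂.mem_iff x hx).2 h)) a₂
          · exact absurd hxZ hx
      · intro h
        exact holAt_contraction (hFc.isOpen_inter_preimage hUo (isOpen_setOf_holAt f)) (hsat _)
          (fun y hy => holAt_comp_contractChart h₁ h₂ hd hy.1 hy.2) ⟨hx, h⟩)
  refine ⟨ψ, hψs ▸ ⟨p₁, Or.inl (Or.inl h₁.mem_source), rfl⟩, ?_, hψ⟩
  rw [hψx, hG, hF, contractChart_of_mem h₁ h₂ h₁.self_mem]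

theorem IsNodalCurve.contraction (hX : IsNodalCurve X) (hK : IsClosed K)
    (hd : Disjoint φ₁.source φ₂.source) (hKZ : K ∩ closure Kᶜ ⊆ {p₁, p₂}) :
    IsNodalCurve (Contraction K) := by
  have := hX.compact
  have := hX.t2
  refine ⟨⟨?_⟩, t2Space_contraction hK, fun q => ?_⟩
  · rw [← contractMap_surjective.range_eq]
    exact isCompact_range (continuous_contractMap K)
  · obtain ⟨x, rfl⟩ := contractMap_surjective q
    by_cases hx : x ∈ K
    · rw [contractMap_eq_iff.2 (Or.inr ⟨hx, h₁.self_mem⟩)]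
      exact Or.inr (isNode_contractMap h₁ h₂ hd hKZ)
    · obtain ⟨ψ, hψs, hψx, hψ⟩ := exists_contractMap_chart hK ⟨x, hx⟩
      rw [← hψx]
      rcases hX.smooth_or_node x with h | h
      · exact Or.inl (hψ.isSmoothPoint (hψs ▸ hx) h)
      · exact Or.inr (hψ.isNode (hψs ▸ hx) h)

end ContractNode

/-! ### The direct image of a line bundle under the contraction -/

section DirectImage

variable {X : Type u} [TopologicalSpace X] [HolSpace X] {K : Set X}

namespace ModuleSheaf

variable {M : ModuleSheaf.{u, v} X}

/-- The direct image of `M` under the contraction of `K`. -/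
abbrev contract (M : ModuleSheaf.{u, v} X) (K : Set X) :
    ModuleSheaf.{u, max u v} (Contraction K) :=
  M.directImage (contractMap K) (isHolMap_contractMap K)

/-- A section of `M`, regarded as a section of the direct image. -/
def descend (M : ModuleSheaf.{u, v} X) (K : Set X) (s : ∀ x, M.fiber x) :
    ∀ q, (M.contract K).fiber q :=
  fun _ x => s x.1

/-- A section of the direct image, regarded as a section of `M`. -/
def pull (t : ∀ q, (M.contract K).fiber q) : ∀ x, M.fiber x :=
  fun x => t (contractMap K x) ⟨x, rfl⟩

/-- The direct image has the same global sections. -/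
theorem h0_contract (M : ModuleSheaf.{u, v} X) (K : Set X) : M.h0 = (M.contract K).h0 := by
  let Ψ : (M.contract K).globalSections →ₗ[ℂ] M.globalSections :=
    { toFun := fun t => ⟨pull t.1, fun x => (t.2 (contractMap K x)).self_of_nhds x rfl⟩
      map_add' := fun _ _ => rfl
      map_smul' := fun _ _ => rfl }
  have hΨ : Function.Bijective Ψ := by
    constructor
    · intro s t hst
      refine Subtype.ext (funext fun q => funext fun x => ?_)
      obtain ⟨x, rfl⟩ := x
      exact congrFun (congrArg Subtype.val hst) x
    · rintro ⟨s, hs⟩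
      exact ⟨⟨M.descend K s, fun q => Eventually.of_forall fun _ x _ => hs x⟩, rfl⟩
  exact (LinearEquiv.ofBijective Ψ hΨ).rank_eq.symm

/-- A frame `e` of `M` over a saturated open set `U` gives a frame of the direct image, provided
that sections around `K` are constant multiples of `e` along `K` (if `K` lies in `U`), so that their
coefficient functions descend to the contraction. -/
theorem IsLineBundle.frame_contract (hM : M.IsLineBundle) {e : ∀ x, M.fiber x} {U : Set X}
    (hU : IsOpen U) (hsat : (∃ x ∈ U, x ∈ K) → K ⊆ U) (he : ∀ x ∈ U, M.IsFrameAt e x)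
    (hconst : K ⊆ U → ∀ s : ∀ x, M.fiber x, (∀ x ∈ K, M.HolAt s x) →
      ∃ c : ℂ, ∀ x ∈ K, s x = c • e x) {q : Contraction K} (hq : q ∈ contractMap K '' U) :
    (∀ t : ∀ q, (M.contract K).fiber q, (M.contract K).HolAt t q ↔
      ∃ f : Contraction K → ℂ, HolSpace.HolAt f q ∧
        ∀ᶠ z in 𝓝 q, t z = f z • M.descend K e z) ∧
    ∀ f : Contraction K → ℂ, HolSpace.HolAt f q →
      (∀ᶠ z in 𝓝 q, f z • M.descend K e z = 0) → ∀ᶠ z in 𝓝 q, f z = 0 := by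
  have hUq : ∀ x, contractMap K x ∈ contractMap K '' U → x ∈ U := fun x hx => by
    rwa [← Set.mem_preimage, preimage_image_contractMap hsat] at hx
  have hUo := isOpen_image_contractMap hU hsat
  refine ⟨fun t => ⟨fun ht => ?_, ?_⟩, fun f _ h => ?_⟩
  · obtain ⟨O, hO, hOo, hqO⟩ := eventually_nhds_iff.1
      (show ∀ᶠ q' in 𝓝 q, ∀ x, contractMap K x = q' → M.HolAt (pull t) x from ht)
    obtain ⟨g, hg⟩ := hM.exists_coeff e (pull t)
    set V : Set X := U ∩ contractMap K ⁻¹' O with hV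
    have hVo : IsOpen V := hU.inter (hOo.preimage (continuous_contractMap K))
    have hVsat : (∃ x ∈ V, x ∈ K) → K ⊆ V := by
      rintro ⟨x, ⟨hxU, hxO⟩, hxK⟩ y hy
      refine ⟨hsat ⟨x, hxU, hxK⟩ hy, ?_⟩
      rw [Set.mem_preimage, contractMap_eq_iff.2 (Or.inr ⟨hy, hxK⟩)]
      exact hxO
    -- `g` is constant along `K`, so it does not matter which point of a fibre is chosen
    let f : Contraction K → ℂ := fun z => g (Function.surjInv contractMap_surjective z)
    have hfg : ∀ x ∈ V, f (contractMap K x) = g x := by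
      intro x hx
      have hx' := Function.surjInv_eq contractMap_surjective (contractMap K x)
      change g (Function.surjInv contractMap_surjective (contractMap K x)) = g x
      rcases contractMap_eq_iff.1 hx' with h | ⟨h1, h2⟩
      · rw [h]
      · have hKV := hVsat ⟨x, hx, h2⟩
        obtain ⟨c, hc⟩ := hconst (fun y hy => (hKV hy).1) (pull t) fun y hy =>
          hO _ (hKV hy).2 y rfl
        have hgc : ∀ y ∈ K, g y = c := fun y hy => by
          have hy0 := (he y (hKV hy).1).ne_zero
          exact smul_left_injective ℂ hy0 ((hg y hy0).symm.trans (hc y hy))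
        rw [hgc _ h1, hgc _ h2]
    have hts : ∀ x ∈ V, pull t x = f (contractMap K x) • e x := fun x hx => by
      rw [hfg x hx]
      exact hg x (he x hx.1).ne_zero
    have hfV : ∀ x ∈ V, HolSpace.HolAt (f ∘ contractMap K) x := fun x hx =>
      ((he x hx.1).holAt_iff (s := pull t) (by
        filter_upwards [hVo.mem_nhds hx] with y hy using hts y hy)).1 (hO _ hx.2 x rfl)
    refine ⟨f, ?_, ?_⟩
    · obtain ⟨x, hx, rfl⟩ := hq
      exact holAt_contraction hVo hVsat hfV ⟨hx, hqO⟩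
    · filter_upwards [hOo.mem_nhds hqO, hUo.mem_nhds hq] with z hzO hzU
      funext x
      obtain ⟨x, rfl⟩ := x
      exact hts x ⟨hUq x hzU, hzO⟩
  · rintro ⟨f, hf, hft⟩
    change ∀ᶠ q' in 𝓝 q, ∀ x, contractMap K x = q' → M.HolAt (pull t) x
    filter_upwards [HolSpace.eventually hf, hft.eventually_nhds, hUo.mem_nhds hq]
      with z h1 h2 h3 x hx
    subst hx
    refine ((he x (hUq x h3)).holAt_iff (g := f ∘ contractMap K) ?_).2
      ((isHolMap_contractMap K).2 x f h1)
    filter_upwards [(continuous_contractMap K).continuousAt.eventually h2] with y hy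
    exact congrFun hy ⟨y, rfl⟩
  · filter_upwards [h, hUo.mem_nhds hq] with z hz hzU
    obtain ⟨x, hx, rfl⟩ := hzU
    have h1 : f (contractMap K x) • e x = 0 := congrFun hz ⟨x, rfl⟩
    exact (smul_eq_zero.1 h1).resolve_right (he x hx).ne_zero

/-- A section over `K` extends to a section around `K`, if `K` has two boundary points and is a
branch there. -/
theorem IsLineBundle.exists_extension_of_restrict (hM : M.IsLineBundle) (hK : IsClosed K)
    {φ₁ φ₂ : OpenPartialHomeomorph X nodeModel} {p₁ p₂ : X} (h₁ : IsBranchChart K φ₁ p₁)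
    (h₂ : IsBranchChart K φ₂ p₂) (hd : Disjoint φ₁.source φ₂.source)
    (hKZ : K ∩ closure Kᶜ ⊆ {p₁, p₂}) (s : (M.restrict K).globalSections) :
    ∃ e : ∀ x, M.fiber x, (∀ x ∈ K, M.HolAt e x) ∧ ∀ x : K, e x.1 = s.1 x := by
  classical
  have hval : ∀ (p : X) (hp : p ∈ K), ∃ ε : ∀ x, M.fiber x, M.HolAt ε p ∧ ε p = s.1 ⟨p, hp⟩ := by
    intro p hp
    obtain ⟨ε, hε⟩ := hM.2 p
    obtain ⟨c, hc⟩ := (finrank_eq_one_iff_of_nonzero' (ε p) hε.ne_zero).1 (hM.1 p) (s.1 ⟨p, hp⟩)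
    exact ⟨fun y => c • ε y, M.smul (HolSpace.const c p) hε.holAt, hc⟩
  obtain ⟨ε₁, hε₁, hs₁⟩ := hval p₁ h₁.self_mem
  obtain ⟨ε₂, hε₂, hs₂⟩ := hval p₂ h₂.self_mem
  -- off `K` any section around the node with the right value at the node will do
  let t : ∀ x, M.fiber x := fun x => if x ∈ φ₁.source then ε₁ x else ε₂ x
  have ht₁ : ∀ᶠ y in 𝓝 p₁, ε₁ y = t y := by
    filter_upwards [φ₁.open_source.mem_nhds h₁.mem_source] with y hy
    exact (if_pos hy).symm
  have ht₂ : ∀ᶠ y in 𝓝 p₂, ε₂ y = t y := by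
    filter_upwards [φ₂.open_source.mem_nhds h₂.mem_source] with y hy
    exact (if_neg (Set.disjoint_right.1 hd hy)).symm
  let e : ∀ x, M.fiber x := fun x => if hx : x ∈ K then s.1 ⟨x, hx⟩ else t x
  have heK : ∀ x : K, e x.1 = s.1 x := fun x => dif_pos x.2
  have heZ : ∀ y : ↥(closure Kᶜ), e y.1 = t y.1 := by
    intro y
    by_cases hy : y.1 ∈ K
    · rw [heK ⟨y.1, hy⟩]
      obtain ⟨y, hyZ⟩ := y
      rcases hKZ ⟨hy, hyZ⟩ with rfl | rfl
      · rw [← hs₁]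
        exact ht₁.self_of_nhds
      · rw [← hs₂]
        exact ht₂.self_of_nhds
    · exact dif_neg hy
  have hb : ∀ p ∈ K, p ∈ closure Kᶜ → ∃ φ, IsBranchChart K φ p := by
    intro p hp hpZ
    rcases hKZ ⟨hp, hpZ⟩ with rfl | rfl
    · exact ⟨φ₁, h₁⟩
    · exact ⟨φ₂, h₂⟩
  refine ⟨e, fun x hx => hM.holAt_of_restrict hK hb (fun hx => ?_) fun hxZ => ?_, heK⟩
  · exact (M.restrict K).congr (s.2 ⟨x, hx⟩) (Eventually.of_forall fun y => (heK y).symm)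
  · refine (M.restrict (closure Kᶜ)).congr (s := fun y => t y.1) ?_
      (Eventually.of_forall fun y => (heZ y).symm)
    rcases hKZ ⟨hx, hxZ⟩ with rfl | rfl
    · exact restrict_holAt (x := (⟨x, hxZ⟩ : ↥(closure Kᶜ))) (M.congr hε₁ ht₁)
    · exact restrict_holAt (x := (⟨x, hxZ⟩ : ↥(closure Kᶜ))) (M.congr hε₂ ht₂)

/-- If the bundle is trivial over `K`, and the only sections over `K` are the constant multiples of
a global frame, then the direct image under the contraction of `K` is locally free. -/
theorem IsLineBundle.isLocallyFreeRankOne_contract (hM : M.IsLineBundle)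
    (hX : ∀ x : X, HolSpace.LocalAt x) (hK : IsClosed K)
    {φ₁ φ₂ : OpenPartialHomeomorph X nodeModel} {p₁ p₂ : X} (h₁ : IsBranchChart K φ₁ p₁)
    (h₂ : IsBranchChart K φ₂ p₂) (hd : Disjoint φ₁.source φ₂.source)
    (hKZ : K ∩ closure Kᶜ ⊆ {p₁, p₂}) {ε : ∀ x : K, (M.restrict K).fiber x}
    (hε : ε ∈ (M.restrict K).globalSections) (hε0 : ∀ x, ε x ≠ 0)
    (hε1 : ∀ s ∈ (M.restrict K).globalSections, ∃ c : ℂ, s = c • ε) :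
    (M.contract K).IsLocallyFreeRankOne := by
  intro q
  obtain ⟨x, rfl⟩ := contractMap_surjective q
  have hframe : ∀ e : ∀ x, M.fiber x, IsOpen {y | M.IsFrameAt e y} := fun e =>
    isOpen_iff_eventually.2 fun y hy => IsFrameAt.eventually hy
  by_cases hx : x ∈ K
  · obtain ⟨e, he, heε⟩ := hM.exists_extension_of_restrict hK h₁ h₂ hd hKZ ⟨ε, hε⟩
    have hKU : K ⊆ {y | M.IsFrameAt e y} := fun y hy =>
      hM.isFrameAt (hX y) (he y hy) ((heε ⟨y, hy⟩).symm ▸ hε0 ⟨y, hy⟩)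
    refine ⟨M.descend K e, ?_⟩
    filter_upwards [(isOpen_image_contractMap (hframe e) fun _ => hKU).mem_nhds
      ⟨x, hKU hx, rfl⟩] with q hq
    refine hM.frame_contract (hframe e) (fun _ => hKU) (fun y hy => hy) (fun _ s hs => ?_) hq
    obtain ⟨c, hc⟩ := hε1 (fun y => s y.1) fun y => restrict_holAt (hs y.1 y.2)
    refine ⟨c, fun y hy => ?_⟩
    rw [heε ⟨y, hy⟩]
    exact congrFun hc ⟨y, hy⟩
  · obtain ⟨e, he⟩ := hM.2 x
    have hsat : (∃ y ∈ Kᶜ ∩ {y | M.IsFrameAt e y}, y ∈ K) → K ⊆ Kᶜ ∩ {y | M.IsFrameAt e y} := by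
      rintro ⟨y, hy, hyK⟩
      exact absurd hyK hy.1
    have hUo := hK.isOpen_compl.inter (hframe e)
    refine ⟨M.descend K e, ?_⟩
    filter_upwards [(isOpen_image_contractMap hUo hsat).mem_nhds ⟨x, ⟨hx, he⟩, rfl⟩] with q hq
    refine hM.frame_contract hUo hsat (fun y hy => hy.2) (fun hKU s _ => ⟨0, fun y hy => ?_⟩) hq
    exact absurd hy (hKU hy).1

end ModuleSheaf

end DirectImage

/-! ### Interior edges -/

theorem IsInteriorEdge.isClosed {X : Type u} [TopologicalSpace X] [HolSpace X] {K K₁ K₂ : Set X}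
    {p₁ p₂ : X} (h : IsInteriorEdge K K₁ K₂ p₁ p₂) : IsClosed K := by
  obtain ⟨x, -, rfl⟩ := h.component
  exact isClosed_closure

theorem IsInteriorEdge.accPt {X : Type u} [TopologicalSpace X] [HolSpace X] {K K₁ K₂ : Set X}
    {p₁ p₂ : X} (h : IsInteriorEdge K K₁ K₂ p₁ p₂) {p : X} (hp : p ∈ K) : AccPt p (𝓟 K) := by
  obtain ⟨e, he⟩ := h.rational
  rw [accPt_iff_nhds]
  intro U hU
  have := neBot_nhdsNE_sphere he ⟨p, hp⟩
  obtain ⟨y, hyU, hyp⟩ := Filter.nonempty_of_mem (f := 𝓝[≠] (⟨p, hp⟩ : K)) (inter_mem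
    (nhdsWithin_le_nhds (continuous_subtype_val.continuousAt.preimage_mem_nhds hU))
    self_mem_nhdsWithin)
  exact ⟨y.1, ⟨hyU, y.2⟩, fun h => hyp (Subtype.ext h)⟩

/-- The component is a branch at each of its two nodes; the charts can be taken disjoint. -/
theorem IsInteriorEdge.exists_isBranchChart {X : Type u} [TopologicalSpace X] [HolSpace X]
    [T2Space X] {K K₁ K₂ : Set X} {p₁ p₂ : X} (h : IsInteriorEdge K K₁ K₂ p₁ p₂) :
    ∃ φ₁ φ₂ : OpenPartialHomeomorph X nodeModel, IsBranchChart K φ₁ p₁ ∧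
      IsBranchChart K φ₂ p₂ ∧ Disjoint φ₁.source φ₂.source := by
  have hp₁ : p₁ ∈ K ∩ closure Kᶜ := h.inter_rest.symm ▸ Or.inl rfl
  have hp₂ : p₂ ∈ K ∩ closure Kᶜ := h.inter_rest.symm ▸ Or.inr rfl
  obtain ⟨U₁, U₂, hU₁, hU₂, hpU₁, hpU₂, hd⟩ := t2_separation h.nodes_ne
  have hcases : ∀ x, x ∈ K → x ∈ closure Kᶜ → x = p₁ ∨ x = p₂ := fun x hx hx' => by
    have : x ∈ ({p₁, p₂} : Set X) := h.inter_rest ▸ ⟨hx, hx'⟩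
    simpa using this
  obtain ⟨φ₁, hφ₁, hs₁⟩ := _root_.exists_isBranchChart h.isClosed h.node₁ hp₁.2 (h.accPt hp₁.1) hU₁
    hpU₁ fun x hx hxK hxZ => (hcases x hxK hxZ).resolve_right fun h =>
      Set.disjoint_left.1 hd hx (h ▸ hpU₂)
  obtain ⟨φ₂, hφ₂, hs₂⟩ := _root_.exists_isBranchChart h.isClosed h.node₂ hp₂.2 (h.accPt hp₂.1) hU₂
    hpU₂ fun x hx hxK hxZ => (hcases x hxK hxZ).resolve_left fun h =>
      Set.disjoint_left.1 hd (h ▸ hpU₁) hx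
  exact ⟨φ₁, φ₂, hφ₁, hφ₂, hd.mono hs₁ hs₂⟩

theorem mainTheorem1 {C : Type u} [TopologicalSpace C] [HolSpace C] (hC : IsNodalCurve C)
    (L : ModuleSheaf.{u, v} C) (hL : L.IsLineBundle)
    (Cmid C₁ C₂ : Set C) (p₁ p₂ : C) (hmid : IsInteriorEdge Cmid C₁ C₂ p₁ p₂)
    (d : ℤ) (hd : (L.restrict Cmid).HasDegree d) :
    (IsNodalCurve (closure Cmidᶜ) ∧ (L.restrict (closure Cmidᶜ)).IsLineBundle) ∧
    (0 < d →
      L.h0 = (L.restrict (closure Cmidᶜ)).h0 + ((d - 1).toNat : Cardinal)) ∧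
    (d < 0 →
      ((L.restrict (closure Cmidᶜ)).twistNeg (Subtype.val ⁻¹' {p₁, p₂})).IsLocallyFreeRankOne ∧
      L.h0 = ((L.restrict (closure Cmidᶜ)).twistNeg (Subtype.val ⁻¹' {p₁, p₂})).h0) ∧
    (d = 0 →
      IsNodalCurve (Contraction Cmid) ∧ IsNode (contractMap Cmid p₁) ∧
      (L.directImage (contractMap Cmid) (isHolMap_contractMap Cmid)).IsLocallyFreeRankOne ∧
      L.h0 = (L.directImage (contractMap Cmid) (isHolMap_contractMap Cmid)).h0) := by
  have := hC.t2
  have hX := hC.localAt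
  have hK := hmid.isClosed
  obtain ⟨φ₁, φ₂, h₁, h₂, hdisj⟩ := hmid.exists_isBranchChart
  have hKZ : Cmid ∩ closure Cmidᶜ ⊆ {p₁, p₂} := hmid.inter_rest.subset
  have hb : ∀ p ∈ Cmid, p ∈ closure Cmidᶜ → ∃ φ, IsBranchChart Cmid φ p := by
    intro p hp hpZ
    rcases hKZ ⟨hp, hpZ⟩ with rfl | rfl
    · exact ⟨φ₁, h₁⟩
    · exact ⟨φ₂, h₂⟩
  have hZ := hC.closure_compl hK hb
  have hLK := hL.restrict Cmid
  have hXK : ∀ x : Cmid, HolSpace.LocalAt x := fun x => (hX x.1).subset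
  obtain ⟨e, he⟩ := hmid.rational
  obtain ⟨e₀, e₁, he₀, he₁, he₀₁⟩ := hLK.exists_frames_of_hasDegree he hXK hd
  refine ⟨⟨hZ, hL.restrict _⟩, fun hpos => ?_, fun hneg => ⟨?_, ?_⟩, fun hzero => ?_⟩
  · obtain ⟨n, rfl⟩ := Int.eq_ofNat_of_zero_le hpos.le
    have hn : 0 < n := by exact_mod_cast hpos
    have hne : (⟨p₁, h₁.self_mem⟩ : Cmid) ≠ ⟨p₂, h₂.self_mem⟩ := fun h =>
      hmid.nodes_ne (congrArg Subtype.val h)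
    rw [hL.h0_eq_add hK hb h₁.self_mem h₂.self_mem hmid.inter_rest
      (ModuleSheaf.evalPair_surjective he hLK he₀ he₁ he₀₁ hn hne),
      ModuleSheaf.rank_ker_evalPair he hLK he₀ he₁ he₀₁ hn hne]
    congr 2
    omega
  · have := hZ.t2
    refine (hL.restrict _).isLocallyFreeRankOne_twistNeg hZ.localAt
      ((Set.toFinite {p₁, p₂}).preimage Subtype.val_injective.injOn) fun x hx => ?_
    obtain ⟨x, hxZ⟩ := x
    rcases hx with hx | hx
    · obtain rfl : x = p₁ := hx
      exact h₁.isSmoothPoint_closure_compl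
    · obtain rfl : x = p₂ := hx
      exact h₂.isSmoothPoint_closure_compl
  · exact hL.h0_eq_twistNeg hK hb (fun s => Subtype.ext
      (ModuleSheaf.eq_zero_of_degree_neg he hLK he₀ he₁ he₀₁ hneg s.2)) hmid.inter_rest
  · subst hzero
    obtain ⟨ε, hε, hε0, hε1⟩ := ModuleSheaf.exists_global_frame he hLK he₀ he₁ he₀₁
    exact ⟨hC.contraction h₁ h₂ hK hdisj hKZ, isNode_contractMap h₁ h₂ hdisj hKZ,
      hL.isLocallyFreeRankOne_contract hX hK h₁ h₂ hdisj hKZ hε hε0 hε1,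
      L.h0_contract Cmid⟩
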